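/- Let $\mathbb T=\mathbb R/2\pi\mathbb Z$ and let $\Phi:\mathbb R\times\mathbb T\to\mathbb R$ be a $C^\infty$ function for which there are $R,c\in\mathbb R$ with $\Phi(x,y)=c$ whenever $|x|\ge R$. Put $\Omega=\{(x,y)\in\mathbb R\times\mathbb T: x\ne 0\}$, $\Omega_-=\{x<0\}$, $\Omega_+=\{x>0\}$, and equip $\Omega$ with the Riemannian metric $g=\mathrm{diag}\left(1,x^{-2}e^{-2\Phi(x,y)}\right)$. Let $\omega=\sqrt{\det g}$, let $d\omega=\omega\,dx\,dy$ be its Riemannian area, and let $\Delta\varphi=\frac1\omega\sum_{i,j}\partial_i\left(\omega g^{ij}\partial_j\varphi\right)$ be its Laplace–Beltrami operator. All functions in the $L^2$ spaces are complex valued. For each $U\in\{\Omega,\Omega_-,\Omega_+\}$, the operator $\Delta$ with domain $C_0^\infty(U)$ has exactly one self-adjoint extension in $L^2(U,d\omega)$. Denote these extensions by $\Delta$, $\Delta^-$, $\Delta^+$ respectively. With respect to $L^2(\Omega,d\omega)=L^2(\Omega_-,d\omega)\oplus^\perp L^2(\Omega_+,d\omega)$ one has $\Delta=\Delta^-\oplus\Delta^+$: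 for $v,w\in L^2(\Omega,d\omega)$, $v\in D(\Delta)$ and $\Delta v=w$ if and only if $v|_{\Omega_\pm}\in D(\Delta^\pm)$ and $\Delta^\pm(v|_{\Omega_\pm})=w|_{\Omega_\pm}$ for both signs. Moreover, for all $u_0,u_1\in L^2(\Omega,d\omega)$, each of the problems (with the self-adjoint operator $\Delta$) 1. (Schrödinger) $i\partial_tu+\Delta u=0$, $u(0)=u_0$; 2. (heat) $\partial_tu=\Delta u$, $u(0)=u_0$; 3. (wave) $\partial_t^2u=\Delta u$, $u(0)=u_0$, $\partial_tu(0)=u_1$ has a unique solution $u$ on $[0,\infty)$. If $u_0$ (and, for the wave equation, also $u_1$) is supported in $\Omega_+$, then $u(t)$ is supported in $\Omega_+$ for every $t\ge 0$. Here an element of $L^2(\Omega,d\omega)$ is supported in $\Omega_+$ if it vanishes almost everywhere outside $\Omega_+$. A solution is a continuous map $u:[0,\infty)\to L^2(\Omega,d\omega)$ with $u(0)=u_0$ which satisfies the equation weakly, that is, for every $v\in D(\Delta)$ and $t\ge0$: $\frac{d}{dt}\langle v,u(t)\rangle=i\langle\Delta v,u(t)\rangle$ (Schrödinger); $\frac{d}{dt}\langle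 v,u(t)\rangle=\langle\Delta v,u(t)\rangle$ (heat); $t\mapsto\langle v,u(t)\rangle$ is twice differentiable with $\frac{d^2}{dt^2}\langle v,u(t)\rangle=\langle\Delta v,u(t)\rangle$ and $\frac{d}{dt}\langle v,u(t)\rangle\big|_{t=0}=\langle v,u_1\rangle$ (wave). The inner product is antilinear in the first variable, and derivatives at $t=0$ are one-sided. -/

import Mathlib

open Set Filter Topology MeasureTheory
open scoped ContDiff InnerProductSpace

noncomputable section

namespace AlmostRiem

instance fact_two_pi_pos : Fact (0 < 2 * Real.pi) := ⟨Real.two_pi_pos⟩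

/-- The circle `𝕋 = ℝ / 2πℤ`. -/
abbrev Circ : Type := AddCircle (2 * Real.pi)

/-- The cylinder `ℝ × 𝕋`. -/
abbrev Cyl : Type := ℝ × Circ

/-- `Ω = {x ≠ 0}`. -/
def regOmega : Set Cyl := {p | p.1 ≠ 0}

/-- `Ω₋ = {x < 0}`. -/
def regMinus : Set Cyl := {p | p.1 < 0}

/-- `Ω₊ = {x > 0}`. -/
def regPlus : Set Cyl := {p | 0 < p.1}

lemma regMinus_subset : regMinus ⊆ regOmega := fun _ hp => ne_of_lt hp

lemma regPlus_subset : regPlus ⊆ regOmega := fun _ hp => ne_of_gt hp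

/-- The covering map `ℝ × ℝ → ℝ × 𝕋`. -/
def cover (q : ℝ × ℝ) : Cyl := (q.1, (q.2 : Circ))

/-- `f` is a `C^∞` function on the cylinder: its pull-back to the universal cover is `C^∞`. -/
def IsSmooth {E : Type*} [NormedAddCommGroup E] [NormedSpace ℝ E] (f : Cyl → E) : Prop :=
  ContDiff ℝ ∞ (fun q : ℝ × ℝ => f (cover q))

/-- The coordinate derivatives `∂₀ = ∂ₓ` and `∂₁ = ∂_y` on the cylinder. -/
def pderiv (i : Fin 2) (f : Cyl → ℂ) (p : Cyl) : ℂ :=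
  ![deriv (fun s : ℝ => f (s, p.2)) p.1,
    deriv (fun s : ℝ => f (p.1, p.2 + (s : Circ))) 0] i

/-- The metric `diag(1, x⁻² e^{-2Φ})` in the coordinates `(x, y)`. -/
def metric (Φ : Cyl → ℝ) (p : Cyl) : Matrix (Fin 2) (Fin 2) ℝ :=
  Matrix.diagonal ![1, p.1 ^ (-2 : ℤ) * Real.exp (-2 * Φ p)]

/-- The density `ω = √(det g)` of the Riemannian area. -/
def areaDensity (Φ : Cyl → ℝ) (p : Cyl) : ℝ := √((metric Φ p).det)

/-- The Laplace-Beltrami expression `Δφ = ω⁻¹ ∑ᵢⱼ ∂ᵢ(ω gⁱʲ ∂ⱼ φ)`. -/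
def laplaceBeltrami (Φ : Cyl → ℝ) (φ : Cyl → ℂ) (p : Cyl) : ℂ :=
  ((areaDensity Φ p)⁻¹ : ℝ) * ∑ i : Fin 2, ∑ j : Fin 2,
    pderiv i (fun q => ((areaDensity Φ q * (metric Φ q)⁻¹ i j : ℝ) : ℂ) * pderiv j φ q) p

/-- The Riemannian area `dω` on `U`. -/
def area (Φ : Cyl → ℝ) (U : Set Cyl) : Measure Cyl :=
  ((volume : Measure Cyl).restrict U).withDensity (fun p => ENNReal.ofReal (areaDensity Φ p))

/-- The complex Hilbert space `L²(U, dω)`. -/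
abbrev L2 (Φ : Cyl → ℝ) (U : Set Cyl) : Type := Lp ℂ 2 (area Φ U)

/-! ### Smoothness and supports -/

lemma continuous_cover : Continuous cover := by
  unfold cover
  exact continuous_fst.prodMk ((AddCircle.continuous_mk' _).comp continuous_snd)

lemma isOpenQuotientMap_cover : IsOpenQuotientMap cover :=
  IsOpenQuotientMap.id.prodMap QuotientAddGroup.isOpenQuotientMap_mk

lemma cover_surj (p : Cyl) : ∃ q, cover q = p := isOpenQuotientMap_cover.surjective p

lemma IsSmooth.continuous {E : Type*} [NormedAddCommGroup E] [NormedSpace ℝ E] {f : Cyl → E}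
    (hf : IsSmooth f) : Continuous f :=
  isOpenQuotientMap_cover.isQuotientMap.continuous_iff.2 (ContDiff.continuous hf)

lemma isOpen_regOmega : IsOpen regOmega := isOpen_ne_fun continuous_fst continuous_const

lemma pderiv_zero (f : Cyl → ℂ) (p : Cyl) :
    pderiv 0 f p = deriv (fun s : ℝ => f (s, p.2)) p.1 := rfl

lemma pderiv_one (f : Cyl → ℂ) (p : Cyl) :
    pderiv 1 f p = deriv (fun s : ℝ => f (p.1, p.2 + (s : Circ))) 0 := rfl

/-- The coordinate vectors of `ℝ²`. -/
def coordVec (i : Fin 2) : ℝ × ℝ := ![(1, 0), (0, 1)] i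

lemma pderiv_cover {f : Cyl → ℂ} (hf : IsSmooth f) (i : Fin 2) (q : ℝ × ℝ) :
    pderiv i f (cover q) = fderiv ℝ (fun q => f (cover q)) q (coordVec i) := by
  have hd : DifferentiableAt ℝ (fun q => f (cover q)) q :=
    (ContDiff.differentiable hf (by simp)).differentiableAt
  fin_cases i
  · have h1 : HasDerivAt (fun s : ℝ => (s, q.2)) ((1 : ℝ), (0 : ℝ)) q.1 :=
      (hasDerivAt_id _).prodMk (hasDerivAt_const _ _)
    exact (HasFDerivAt.comp_hasDerivAt (f := fun s : ℝ => (s, q.2)) q.1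
      hd.hasFDerivAt h1).deriv
  · have h1 : HasDerivAt (fun s : ℝ => (q.1, q.2 + s)) ((0 : ℝ), (1 : ℝ)) 0 :=
      (hasDerivAt_const _ _).prodMk ((hasDerivAt_id (0 : ℝ)).const_add q.2)
    have hd' : HasFDerivAt (fun q => f (cover q)) (fderiv ℝ (fun q => f (cover q)) q)
        ((fun s : ℝ => (q.1, q.2 + s)) 0) := by simpa using hd.hasFDerivAt
    exact (HasFDerivAt.comp_hasDerivAt (f := fun s : ℝ => (q.1, q.2 + s)) 0 hd' h1).deriv

lemma IsSmooth.pderiv {f : Cyl → ℂ} (hf : IsSmooth f) (i : Fin 2) : IsSmooth (pderiv i f) := by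
  have h : (fun q => AlmostRiem.pderiv i f (cover q)) =
      fun q => fderiv ℝ (fun q => f (cover q)) q (coordVec i) :=
    funext fun q => pderiv_cover hf i q
  unfold IsSmooth
  rw [h]
  exact (ContDiff.fderiv_right (m := ∞) hf (by simp)).clm_apply contDiff_const

lemma pderiv_eq_zero {f : Cyl → ℂ} (i : Fin 2) {p : Cyl} (h : p ∉ tsupport f) :
    pderiv i f p = 0 := by
  have h0 : f =ᶠ[𝓝 p] 0 := notMem_tsupport_iff_eventuallyEq.1 h
  fin_cases i
  · have hc : Tendsto (fun s : ℝ => ((s, p.2) : Cyl)) (𝓝 p.1) (𝓝 p) :=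
      (continuous_id.prodMk continuous_const).tendsto' _ _ rfl
    have : (fun s : ℝ => f (s, p.2)) =ᶠ[𝓝 p.1] fun _ => (0 : ℂ) := hc.eventually h0
    exact this.deriv_eq.trans (deriv_const _ _)
  · have hc : Tendsto (fun s : ℝ => ((p.1, p.2 + (s : Circ)) : Cyl)) (𝓝 0) (𝓝 p) :=
      (continuous_const.prodMk (continuous_const.add
        (AddCircle.continuous_mk' _))).tendsto' _ _ (by simp)
    have : (fun s : ℝ => f (p.1, p.2 + (s : Circ))) =ᶠ[𝓝 0] fun _ => (0 : ℂ) := hc.eventually h0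
    exact this.deriv_eq.trans (deriv_const _ _)

lemma tsupport_subset_of_eq_zero {f g : Cyl → ℂ} (h : ∀ p, p ∉ tsupport f → g p = 0) :
    tsupport g ⊆ tsupport f :=
  closure_minimal (fun p hp => by
    by_contra hc
    exact hp (h p hc)) (isClosed_tsupport f)

lemma pderiv_add {f g : Cyl → ℂ} (hf : IsSmooth f) (hg : IsSmooth g) (i : Fin 2) :
    pderiv i (f + g) = pderiv i f + pderiv i g := by
  have hfg : IsSmooth (f + g) := ContDiff.add hf hg
  funext p
  obtain ⟨q, rfl⟩ := cover_surj p
  rw [Pi.add_apply, pderiv_cover hf, pderiv_cover hg, pderiv_cover hfg]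
  have := fderiv_add (x := q) (ContDiff.differentiable hf (by simp)).differentiableAt
    (ContDiff.differentiable hg (by simp)).differentiableAt
  exact congrArg (fun L : (ℝ × ℝ) →L[ℝ] ℂ => L (coordVec i)) this

lemma pderiv_smul (c : ℂ) (f : Cyl → ℂ) (i : Fin 2) :
    pderiv i (c • f) = c • pderiv i f := by
  funext p
  fin_cases i
  · exact deriv_const_mul_field c
  · exact deriv_const_mul_field c

/-- The test functions `C_0^∞(U)`: complex-valued smooth functions on the cylinder with compact
support contained in `U`. -/
def testFunctions (U : Set Cyl) : Submodule ℂ (Cyl → ℂ) where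
  carrier := {φ | IsSmooth φ ∧ HasCompactSupport φ ∧ tsupport φ ⊆ U}
  add_mem' := fun {f g} hf hg => ⟨ContDiff.add hf.1 hg.1, hf.2.1.add hg.2.1,
    (tsupport_add f g).trans (union_subset hf.2.2 hg.2.2)⟩
  zero_mem' := ⟨contDiff_const, HasCompactSupport.zero, by simp [tsupport]⟩
  smul_mem' := fun c f hf => ⟨ContDiff.const_smul c hf.1, hf.2.1.smul_left (f := fun _ => c),
    (tsupport_smul_subset_right (fun _ => c) f).trans hf.2.2⟩

lemma pderiv_mem {U : Set Cyl} {φ : Cyl → ℂ} (hφ : φ ∈ testFunctions U) (i : Fin 2) :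
    pderiv i φ ∈ testFunctions U := by
  have hs : tsupport (pderiv i φ) ⊆ tsupport φ :=
    tsupport_subset_of_eq_zero fun p hp => pderiv_eq_zero i hp
  exact ⟨hφ.1.pderiv i, hφ.2.1.of_isClosed_subset (isClosed_tsupport _) hs, hs.trans hφ.2.2⟩

lemma mul_mem {U : Set Cyl} (hU : U ⊆ regOmega) {c : Cyl → ℝ}
    (hc : ContDiffOn ℝ ∞ (fun q => c (cover q)) (cover ⁻¹' regOmega))
    {φ : Cyl → ℂ} (hφ : φ ∈ testFunctions U) :
    (fun p => (c p : ℂ) * φ p) ∈ testFunctions U := by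
  have hs : tsupport (fun p => (c p : ℂ) * φ p) ⊆ tsupport φ :=
    tsupport_subset_of_eq_zero fun p hp => by simp [image_eq_zero_of_notMem_tsupport hp]
  refine ⟨?_, hφ.2.1.of_isClosed_subset (isClosed_tsupport _) hs, hs.trans hφ.2.2⟩
  refine contDiff_iff_contDiffAt.2 fun q => ?_
  by_cases hq : cover q ∈ tsupport φ
  · have h1 : ContDiffAt ℝ ∞ (fun q => c (cover q)) q :=
      hc.contDiffAt ((isOpen_regOmega.preimage continuous_cover).mem_nhds (hU (hφ.2.2 hq)))
    exact (Complex.ofRealCLM.contDiff.contDiffAt.comp q h1).mul (ContDiff.contDiffAt hφ.1)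
  · have h0 : φ =ᶠ[𝓝 (cover q)] 0 := notMem_tsupport_iff_eventuallyEq.1 hq
    have h1 : (fun q => (c (cover q) : ℂ) * φ (cover q)) =ᶠ[𝓝 q] fun _ => 0 := by
      filter_upwards [continuous_cover.continuousAt.eventually h0] with r hr
      simp [hr]
    exact contDiffAt_const.congr_of_eventuallyEq h1

lemma areaDensity_eq (Φ : Cyl → ℝ) (p : Cyl) :
    areaDensity Φ p = |p.1|⁻¹ * Real.exp (-Φ p) := by
  have h : (metric Φ p).det = (|p.1|⁻¹ * Real.exp (-Φ p)) ^ 2 := by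
    rw [metric, Matrix.det_diagonal, mul_pow, inv_pow, sq_abs, ← Real.exp_nat_mul]
    simp [zpow_neg]
  rw [areaDensity, h, Real.sqrt_sq (by positivity)]

lemma areaDensity_pos (Φ : Cyl → ℝ) {p : Cyl} (hp : p ∈ regOmega) : 0 < areaDensity Φ p := by
  rw [areaDensity_eq]
  have : 0 < |p.1| := abs_pos.2 hp
  positivity

lemma contDiffOn_areaDensity {Φ : Cyl → ℝ} (hΦ : IsSmooth Φ) :
    ContDiffOn ℝ ∞ (fun q => areaDensity Φ (cover q)) (cover ⁻¹' regOmega) := by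
  intro q hq
  have h0 : q.1 ≠ 0 := hq
  refine ContDiffAt.contDiffWithinAt ?_
  have h : (fun q => areaDensity Φ (cover q)) =
      fun q : ℝ × ℝ => |q.1|⁻¹ * Real.exp (-Φ (cover q)) := funext fun q => areaDensity_eq Φ _
  rw [h]
  refine ContDiffAt.mul (ContDiffAt.inv ?_ (abs_ne_zero.2 h0)) ?_
  · exact (contDiffAt_abs h0).comp q contDiffAt_fst
  · exact (ContDiff.contDiffAt hΦ).neg.exp

lemma contDiffOn_metric_inv {Φ : Cyl → ℝ} (hΦ : IsSmooth Φ) (i j : Fin 2) :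
    ContDiffOn ℝ ∞ (fun q => (metric Φ (cover q))⁻¹ i j) (cover ⁻¹' regOmega) := by
  have h : EqOn (fun q => (metric Φ (cover q))⁻¹ i j)
      (fun q : ℝ × ℝ => (Matrix.diagonal
        ![1, q.1 ^ 2 * Real.exp (2 * Φ (cover q))] : Matrix (Fin 2) (Fin 2) ℝ) i j)
      (cover ⁻¹' regOmega) := by
    intro q hq
    have h0 : q.1 ≠ 0 := hq
    have : (metric Φ (cover q))⁻¹ = Matrix.diagonal
        ![1, q.1 ^ 2 * Real.exp (2 * Φ (cover q))] := by
      refine Matrix.inv_eq_right_inv ?_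
      rw [metric, Matrix.diagonal_mul_diagonal, ← Matrix.diagonal_one]
      congr 1
      funext k
      fin_cases k
      · simp
      · have : Real.exp (2 * Φ (cover q)) ≠ 0 := (Real.exp_pos _).ne'
        simp [cover, zpow_neg, Real.exp_neg] at *
        field_simp
        try norm_cast
        try field_simp
    simp only [this]
  refine ContDiffOn.congr ?_ h
  have hΦ' : ContDiff ℝ ∞ (fun q : ℝ × ℝ => Φ (cover q)) := hΦ
  refine ContDiff.contDiffOn ?_
  have h11 : ContDiff ℝ ∞ (fun q : ℝ × ℝ => q.1 ^ 2 * Real.exp (2 * Φ (cover q))) :=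
    (contDiff_fst.pow 2).mul (contDiff_const.mul hΦ').exp
  fin_cases i <;> fin_cases j <;> simp [contDiff_const, h11]

lemma laplaceBeltrami_mem {Φ : Cyl → ℝ} (hΦ : IsSmooth Φ) {U : Set Cyl} (hU : U ⊆ regOmega)
    {φ : Cyl → ℂ} (hφ : φ ∈ testFunctions U) : laplaceBeltrami Φ φ ∈ testFunctions U := by
  have h1 : ∀ i j : Fin 2, pderiv i (fun q =>
      ((areaDensity Φ q * (metric Φ q)⁻¹ i j : ℝ) : ℂ) * pderiv j φ q) ∈ testFunctions U :=
    fun i j => pderiv_mem (mul_mem hU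
      ((contDiffOn_areaDensity hΦ).mul (contDiffOn_metric_inv hΦ i j)) (pderiv_mem hφ j)) i
  have h2 := (testFunctions U).sum_mem (t := Finset.univ) fun i _ =>
    (testFunctions U).sum_mem (t := Finset.univ) fun j _ => h1 i j
  have h3 := mul_mem (c := fun p => (areaDensity Φ p)⁻¹) hU
    ((contDiffOn_areaDensity hΦ).inv fun q hq => (areaDensity_pos Φ hq).ne') h2
  convert h3 using 1
  funext p
  simp only [laplaceBeltrami, Finset.sum_apply]

lemma laplaceBeltrami_add {Φ : Cyl → ℝ} (hΦ : IsSmooth Φ) {U : Set Cyl} (hU : U ⊆ regOmega)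
    {φ ψ : Cyl → ℂ} (hφ : φ ∈ testFunctions U) (hψ : ψ ∈ testFunctions U) :
    laplaceBeltrami Φ (φ + ψ) = laplaceBeltrami Φ φ + laplaceBeltrami Φ ψ := by
  have hs : ∀ (i j : Fin 2) {χ : Cyl → ℂ}, χ ∈ testFunctions U → IsSmooth (fun q =>
      ((areaDensity Φ q * (metric Φ q)⁻¹ i j : ℝ) : ℂ) * pderiv j χ q) := fun i j χ hχ =>
    (mul_mem hU ((contDiffOn_areaDensity hΦ).mul (contDiffOn_metric_inv hΦ i j))
      (pderiv_mem hχ j)).1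
  have h : ∀ i j : Fin 2, pderiv i (fun q =>
        ((areaDensity Φ q * (metric Φ q)⁻¹ i j : ℝ) : ℂ) * pderiv j (φ + ψ) q) =
      pderiv i (fun q => ((areaDensity Φ q * (metric Φ q)⁻¹ i j : ℝ) : ℂ) * pderiv j φ q) +
      pderiv i (fun q => ((areaDensity Φ q * (metric Φ q)⁻¹ i j : ℝ) : ℂ) * pderiv j ψ q) := by
    intro i j
    rw [← pderiv_add (hs i j hφ) (hs i j hψ), pderiv_add hφ.1 hψ.1]
    congr 1
    funext q
    simp [mul_add]
  funext p
  simp only [laplaceBeltrami, h, Pi.add_apply, Finset.sum_add_distrib, mul_add]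

lemma laplaceBeltrami_smul (Φ : Cyl → ℝ) (c : ℂ) (φ : Cyl → ℂ) :
    laplaceBeltrami Φ (c • φ) = c • laplaceBeltrami Φ φ := by
  have h : ∀ i j : Fin 2, pderiv i (fun q =>
        ((areaDensity Φ q * (metric Φ q)⁻¹ i j : ℝ) : ℂ) * pderiv j (c • φ) q) =
      c • pderiv i
        (fun q => ((areaDensity Φ q * (metric Φ q)⁻¹ i j : ℝ) : ℂ) * pderiv j φ q) := by
    intro i j
    rw [← pderiv_smul, pderiv_smul c φ]
    congr 1
    funext q
    simp [mul_left_comm]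
  funext p
  simp only [laplaceBeltrami, h, Pi.smul_apply, smul_eq_mul, ← Finset.mul_sum, mul_left_comm]

lemma memLp_of_mem {Φ : Cyl → ℝ} (hΦ : IsSmooth Φ) {U : Set Cyl} (hU : U ⊆ regOmega)
    {φ : Cyl → ℂ} (hφ : φ ∈ testFunctions U) : MemLp φ 2 (area Φ U) := by
  have hK : IsCompact (tsupport φ) := hφ.2.1
  have hKm : MeasurableSet (tsupport φ) := (isClosed_tsupport φ).measurableSet
  have hcont : ContinuousOn (areaDensity Φ) (tsupport φ) := by
    have : areaDensity Φ = fun p : Cyl => |p.1|⁻¹ * Real.exp (-Φ p) :=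
      funext fun p => areaDensity_eq Φ p
    rw [this]
    refine ContinuousOn.mul (ContinuousOn.inv₀ (by fun_prop) fun p hp =>
      abs_ne_zero.2 (hU (hφ.2.2 hp))) ?_
    exact (hΦ.continuous.neg.rexp).continuousOn
  obtain ⟨C, hC⟩ := hK.exists_bound_of_continuousOn hcont
  have hfin : area Φ U (tsupport φ) < ⊤ := by
    rw [area, withDensity_apply _ hKm]
    calc ∫⁻ p in tsupport φ, ENNReal.ofReal (areaDensity Φ p) ∂(volume.restrict U)
        ≤ ∫⁻ _ in tsupport φ, ENNReal.ofReal C ∂(volume.restrict U) :=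
          setLIntegral_mono' hKm fun p hp =>
            ENNReal.ofReal_le_ofReal ((le_abs_self _).trans (hC p hp))
      _ = ENNReal.ofReal C * (volume.restrict U) (tsupport φ) := by
          rw [setLIntegral_const]
      _ < ⊤ := ENNReal.mul_lt_top ENNReal.ofReal_lt_top
          ((Measure.restrict_apply_le _ _).trans_lt hK.measure_lt_top)
  have hfi : IsFiniteMeasure ((area Φ U).restrict (tsupport φ)) :=
    ⟨by rwa [Measure.restrict_apply_univ]⟩
  obtain ⟨D, hD⟩ := hK.exists_bound_of_continuousOn hφ.1.continuous.continuousOn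
  have hres : MemLp φ 2 ((area Φ U).restrict (tsupport φ)) :=
    MemLp.of_bound hφ.1.continuous.aestronglyMeasurable D
      ((ae_restrict_iff' hKm).2 (Eventually.of_forall hD))
  have hind : (tsupport φ).indicator φ = φ :=
    indicator_eq_self.2 (subset_tsupport φ)
  rw [← hind]
  exact (memLp_indicator_iff_restrict hKm).2 hres

lemma eq_zero_of_ae {Φ : Cyl → ℝ} (hΦ : IsSmooth Φ) {U : Set Cyl} (hU : U ⊆ regOmega)
    {φ : Cyl → ℂ} (hφ : φ ∈ testFunctions U) (h : φ =ᵐ[area Φ U] 0) : φ = 0 := by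
  have hsub : Function.support φ ⊆ U := (subset_tsupport φ).trans hφ.2.2
  have hopen : IsOpen (Function.support φ) := hφ.1.continuous.isOpen_support
  have hm : Measurable fun p => ENNReal.ofReal (areaDensity Φ p) := by
    have : areaDensity Φ = fun p : Cyl => |p.1|⁻¹ * Real.exp (-Φ p) :=
      funext fun p => areaDensity_eq Φ p
    rw [this]
    have hc := hΦ.continuous.measurable
    fun_prop
  have h0 : area Φ U (Function.support φ) = 0 := h
  have h1 : {p | ENNReal.ofReal (areaDensity Φ p) ≠ 0} ∩ Function.support φ =
      Function.support φ := inter_eq_right.2 fun p hp => by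
    simpa using areaDensity_pos Φ (hU (hsub hp))
  rw [area, withDensity_apply_eq_zero hm, h1, Measure.restrict_apply hopen.measurableSet,
    inter_eq_left.2 hsub] at h0
  exact Function.support_eq_empty_iff.1 ((hopen.measure_eq_zero_iff volume).1 h0)

/-! ### The Laplace-Beltrami operator with domain `C_0^∞(U)` -/

/-- The inclusion of `C_0^∞(U)` into `L²(U, dω)`. -/
def testToL2 (Φ : Cyl → ℝ) (hΦ : IsSmooth Φ) (U : Set Cyl) (hU : U ⊆ regOmega) :
    testFunctions U →ₗ[ℂ] L2 Φ U where
  toFun φ := (memLp_of_mem hΦ hU φ.2).toLp _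
  map_add' _ _ := rfl
  map_smul' _ _ := rfl

/-- The map `φ ↦ Δφ` from `C_0^∞(U)` to `L²(U, dω)`. -/
def laplaceToL2 (Φ : Cyl → ℝ) (hΦ : IsSmooth Φ) (U : Set Cyl) (hU : U ⊆ regOmega) :
    testFunctions U →ₗ[ℂ] L2 Φ U where
  toFun φ := (memLp_of_mem hΦ hU (laplaceBeltrami_mem hΦ hU φ.2)).toLp _
  map_add' φ ψ := by
    rw [← MemLp.toLp_add]
    exact MemLp.toLp_congr _ _ (Eventually.of_forall fun p =>
      congrFun (laplaceBeltrami_add hΦ hU φ.2 ψ.2) p)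
  map_smul' c φ := by
    rw [RingHom.id_apply, ← MemLp.toLp_const_smul]
    exact MemLp.toLp_congr _ _ (Eventually.of_forall fun p =>
      congrFun (laplaceBeltrami_smul Φ c φ) p)

lemma testToL2_injective (Φ : Cyl → ℝ) (hΦ : IsSmooth Φ) (U : Set Cyl) (hU : U ⊆ regOmega) :
    Function.Injective (testToL2 Φ hΦ U hU) := by
  refine (injective_iff_map_eq_zero _).2 fun φ h => Subtype.ext ?_
  refine eq_zero_of_ae hΦ hU φ.2 ?_
  exact (MemLp.coeFn_toLp (memLp_of_mem hΦ hU φ.2)).symm.trans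
    ((Lp.eq_zero_iff_ae_eq_zero).1 h)

/-- The Laplace-Beltrami operator with domain `C_0^∞(U)`, as an unbounded operator in
`L²(U, dω)`. -/
def laplacian (Φ : Cyl → ℝ) (hΦ : IsSmooth Φ) (U : Set Cyl) (hU : U ⊆ regOmega) :
    L2 Φ U →ₗ.[ℂ] L2 Φ U where
  domain := LinearMap.range (testToL2 Φ hΦ U hU)
  toFun := (laplaceToL2 Φ hΦ U hU).comp
    (LinearEquiv.ofInjective _ (testToL2_injective Φ hΦ U hU)).symm.toLinearMap

/-- On the class of a test function `φ` the operator is given by the class of `Δφ`. -/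
lemma laplacian_apply (Φ : Cyl → ℝ) (hΦ : IsSmooth Φ) (U : Set Cyl) (hU : U ⊆ regOmega)
    (φ : testFunctions U) :
    laplacian Φ hΦ U hU ⟨testToL2 Φ hΦ U hU φ, LinearMap.mem_range_self _ φ⟩ =
      laplaceToL2 Φ hΦ U hU φ := by
  change laplaceToL2 Φ hΦ U hU ((LinearEquiv.ofInjective _
    (testToL2_injective Φ hΦ U hU)).symm ⟨testToL2 Φ hΦ U hU φ, _⟩) = _
  congr 1
  rw [LinearEquiv.symm_apply_eq]
  rfl

/-! ### Self-adjoint extensions and evolution equations -/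

section Abstract

variable {H : Type*} [NormedAddCommGroup H] [InnerProductSpace ℂ H] [CompleteSpace H]

/-- `A` is a self-adjoint extension of `T`, and the only one. -/
def IsUniqueSelfAdjointExtension (T A : H →ₗ.[ℂ] H) : Prop :=
  IsSelfAdjoint A ∧ T ≤ A ∧ ∀ B : H →ₗ.[ℂ] H, IsSelfAdjoint B → T ≤ B → B = A

/-- `u : [0, ∞) → H` is the (weak) solution of `i ∂ₜ u + A u = 0`, `u(0) = u₀`, for `A`
self-adjoint: `u` is continuous, and `d/dt ⟪v, u⟫ = i ⟪A v, u⟫` for every `v` in the domain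
of `A`. -/
def IsSchrodingerSolution (A : H →ₗ.[ℂ] H) (u₀ : H) (u : ℝ → H) : Prop :=
  ContinuousOn u (Ici 0) ∧ u 0 = u₀ ∧ ∀ v : A.domain, ∀ t ∈ Ici (0 : ℝ),
    HasDerivWithinAt (fun s => ⟪(v : H), u s⟫_ℂ) (Complex.I * ⟪A v, u t⟫_ℂ) (Ici 0) t

/-- `u : [0, ∞) → H` is the (weak) solution of `∂ₜ u = A u`, `u(0) = u₀`, for `A`
self-adjoint. -/
def IsHeatSolution (A : H →ₗ.[ℂ] H) (u₀ : H) (u : ℝ → H) : Prop :=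
  ContinuousOn u (Ici 0) ∧ u 0 = u₀ ∧ ∀ v : A.domain, ∀ t ∈ Ici (0 : ℝ),
    HasDerivWithinAt (fun s => ⟪(v : H), u s⟫_ℂ) ⟪A v, u t⟫_ℂ (Ici 0) t

/-- `u : [0, ∞) → H` is the (weak) solution of `∂ₜ² u = A u`, `u(0) = u₀`, `∂ₜ u(0) = u₁`, for
`A` self-adjoint: `u` is continuous and, for every `v` in the domain of `A`, the function
`⟪v, u⟫` has a derivative `f` with `f(0) = ⟪v, u₁⟫` and `f' = ⟪A v, u⟫`. -/
def IsWaveSolution (A : H →ₗ.[ℂ] H) (u₀ u₁ : H) (u : ℝ → H) : Prop :=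
  ContinuousOn u (Ici 0) ∧ u 0 = u₀ ∧ ∀ v : A.domain, ∃ f : ℝ → ℂ,
    f 0 = ⟪(v : H), u₁⟫_ℂ ∧ ∀ t ∈ Ici (0 : ℝ),
      HasDerivWithinAt (fun s => ⟪(v : H), u s⟫_ℂ) (f t) (Ici 0) t ∧
      HasDerivWithinAt f ⟪A v, u t⟫_ℂ (Ici 0) t

end Abstract

/-- `A = A₋ ⊕ A₊` with respect to `L²(Ω) = L²(Ω₋) ⊕ L²(Ω₊)`: a pair `(v, w)` belongs to the graph
of `A` if and only if the restrictions of `v`, `w` to `Ω₋` and to `Ω₊` form pairs in the graphs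
of `A₋` and of `A₊`. -/
def IsDirectSum {Φ : Cyl → ℝ} (A : L2 Φ regOmega →ₗ.[ℂ] L2 Φ regOmega)
    (Aminus : L2 Φ regMinus →ₗ.[ℂ] L2 Φ regMinus)
    (Aplus : L2 Φ regPlus →ₗ.[ℂ] L2 Φ regPlus) : Prop :=
  ∀ v w : L2 Φ regOmega, (v, w) ∈ A.graph ↔
    (∃ v' w' : L2 Φ regMinus, (v', w') ∈ Aminus.graph ∧
      v' =ᵐ[area Φ regMinus] v ∧ w' =ᵐ[area Φ regMinus] w) ∧
    (∃ v' w' : L2 Φ regPlus, (v', w') ∈ Aplus.graph ∧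
      v' =ᵐ[area Φ regPlus] v ∧ w' =ᵐ[area Φ regPlus] w)

/-- `v ∈ L²(Ω, dω)` is supported in `Ω₊`: it vanishes almost everywhere outside `Ω₊`. -/
def SupportedInPlus {Φ : Cyl → ℝ} (v : L2 Φ regOmega) : Prop :=
  ∀ᵐ p ∂(area Φ regOmega), p ∉ regPlus → v p = 0

end AlmostRiem

end

/-!
All conclusions reduce to one analytic fact: for some `l > 0`, the range of `Δ - l` on test
functions is dense, on `Ω` as well as on each half-cylinder.

*Operator theory.* A symmetric operator `T ≤ 0` for which the range of `T - l` is dense has its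
adjoint `T†` as only self-adjoint extension, and `R = (l - T†)⁻¹` is a bounded self-adjoint operator
with spectrum in `[0, 1 / l]` (`exists_isResolvent_adjoint`). Solutions of the evolution equations
come from the continuous functional calculus of `R`: a bounded continuous function `f` of `T†` is
the function `r ↦ f (l - 1 / r)` of `R`, which need not extend continuously to `r = 0` but becomes
continuous there after multiplication by `r` (`symbolOp`, `IsResolvent.exists_heat`,
`IsResolvent.exists_schrodinger`, `IsResolvent.exists_wave`). Solutions are unique by energy
estimates, applied after `R` so that all curves are differentiable
(`IsResolvent.firstOrder_eq_zero`, `IsResolvent.secondOrder_eq_zero`).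

*Density of the range.* Let `ψ` be orthogonal to the range of `Δ - l`. Conjugation with `ω^{1/2}`
turns `ψ` into a square integrable weak solution `u = ω^{1/2} ψ` on a flat half-cylinder of
`∂ₓ² u + ∂_y (α ∂_y u) = (Q + l) u`, where `α = x² e^{2Φ}` and `Q = 3 / (4 x²)` up to errors of
order `1 / |x|` (`laplaceBeltrami_modeTest`, `isWeakSolution_of_orthogonal`,
`exists_potential_bound`). Multiplying the equation by `f(x)² u` and applying Hardy's inequality to
`f u` suggests `∫ f² |u|² (1 / (4 x²) + Q + l) ≤ ∫ f'² |u|²` for every test function `f` of `x`,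
which is `IsWeakSolution.weighted_inequality`. As `u` is only a weak solution, Hardy's inequality is
applied to its Fourier modes in `y`, which satisfy ordinary differential equations in the sense of
distributions (`weak_hardy`). These are coupled, since `α` depends on `y`. They are summed with
the weights of `(1 - ε ∂_y²)⁻¹`, whose commutator with `∂_y α ∂_y` is bounded uniformly in `ε`
(`re_integral_mul_conj_le`). For `f` a truncation of `|x| e^{-b |x|}` the truncation errors remain
bounded, because `f` is linear at `0`, and `1 / (4 x²) + 3 / (4 x²) = 1 / x²` is just enough to
compensate `f'²`; hence `u = 0` once `l` is large (`IsWeakSolution.ae_eq_zero`,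
`exists_deficiency_eq_zero`).

*Decoupling.* A test function on `Ω = {x ≠ 0}` is the sum of a test function on each half-cylinder,
so the adjoints satisfy `Δ = Δ⁻ ⊕ Δ⁺` (`isDirectSum_adjoint`). Multiplication by the indicator
function of `Ω₊` therefore maps solutions to solutions (`reduces_restrictPlus`), and by uniqueness
it fixes those with initial data supported in `Ω₊`.
-/

open Set Filter Topology MeasureTheory
open scoped ContDiff InnerProductSpace

set_option linter.unusedSectionVars false

noncomputable section

namespace AlmostRiem

/-! ### Self-adjointness of semibounded operators and their resolvents -/

section Resolvent

open scoped LinearPMap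

variable {H : Type*} [NormedAddCommGroup H] [InnerProductSpace ℂ H] [CompleteSpace H]

/-- `R` is the resolvent `(l - A)⁻¹` of a self-adjoint operator `A ≤ 0`. The graph of `A` is the
set of the pairs `(x, z)` with `x = R (l x - z)`, and `A ≤ 0` is the inequality
`l ‖R y‖² ≤ ⟪R y, y⟫`. -/
structure IsResolvent (A : H →ₗ.[ℂ] H) (l : ℝ) (R : H →L[ℂ] H) : Prop where
  pos : 0 < l
  mem_graph_iff : ∀ x z, (x, z) ∈ A.graph ↔ x = R ((l : ℂ) • x - z)
  symm : ∀ x y, ⟪R x, y⟫_ℂ = ⟪x, R y⟫_ℂ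
  sq_le : ∀ y, l * ‖R y‖ ^ 2 ≤ (⟪R y, y⟫_ℂ).re
  dense : DenseRange R

lemma mem_graph_adjoint_iff {T : H →ₗ.[ℂ] H} (hT : Dense (T.domain : Set H)) (x z : H) :
    (x, z) ∈ T†.graph ↔ ∀ t : T.domain, ⟪z, (t : H)⟫_ℂ = ⟪x, T t⟫_ℂ := by
  rw [LinearPMap.adjoint_graph_eq_graph_adjoint hT, Submodule.mem_adjoint_iff]
  constructor
  · intro h t
    have := h t (T t) (T.mem_graph t)
    rw [sub_eq_zero] at this
    rw [← inner_conj_symm, ← this, inner_conj_symm]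
  · intro h a b hab
    obtain ⟨t, rfl, rfl⟩ := (T.mem_graph_iff).1 hab
    rw [sub_eq_zero, ← inner_conj_symm, ← h t, inner_conj_symm]

lemma adjoint_antitone {S T : H →ₗ.[ℂ] H} (hS : Dense (S.domain : Set H)) (h : S ≤ T) :
    T† ≤ S† := by
  have hT : Dense (T.domain : Set H) := hS.mono h.1
  refine LinearPMap.le_of_le_graph fun p hp => ?_
  obtain ⟨x, z⟩ := p
  rw [mem_graph_adjoint_iff hT] at hp
  rw [mem_graph_adjoint_iff hS]
  intro t
  have := hp ⟨t, h.1 t.2⟩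
  rw [h.2 (x := t) (y := ⟨t, h.1 t.2⟩) rfl]
  exact this

/-- A self-adjoint adjoint `T†` of an operator `T ≤ T†` is its only self-adjoint extension, since
a self-adjoint `B` extending `T` satisfies `B = B† ≤ T†` and thus `T† = T†† ≤ B† = B`. -/
lemma isUniqueSelfAdjointExtension_adjoint {T : H →ₗ.[ℂ] H} (hT : Dense (T.domain : Set H))
    (hle : T ≤ T†) (hsa : IsSelfAdjoint T†) : IsUniqueSelfAdjointExtension T T† := by
  refine ⟨hsa, hle, fun B hB hTB => ?_⟩
  have hB' : B† = B := hB
  have h1 : B ≤ T† := hB' ▸ adjoint_antitone hT hTB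
  have h2 : T†† ≤ B† := adjoint_antitone (hT.mono hTB.1) h1
  rw [hB', show T†† = T† from hsa] at h2
  exact le_antisymm h1 h2

/-- A symmetric operator `T ≤ 0` for which the range of `T - l` is dense, for one `l > 0`, is
essentially self-adjoint. -/
theorem exists_isResolvent_adjoint {T : H →ₗ.[ℂ] H} (hT : Dense (T.domain : Set H))
    (hsymm : ∀ s t : T.domain, ⟪T s, (t : H)⟫_ℂ = ⟪(s : H), T t⟫_ℂ)
    (hnonpos : ∀ t : T.domain, (⟪(t : H), T t⟫_ℂ).re ≤ 0) {l : ℝ} (hl : 0 < l)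
    (hrange : ∀ ψ : H, (∀ t : T.domain, ⟪ψ, T t - (l : ℂ) • (t : H)⟫_ℂ = 0) → ψ = 0) :
    IsUniqueSelfAdjointExtension T T† ∧ ∃ R : H →L[ℂ] H, IsResolvent T† l R := by
  -- `R` is the continuous extension of the inverse of `e = l - T`
  let e : T.domain →ₗ[ℂ] H := (l : ℂ) • T.domain.subtype - T.toFun
  have he : ∀ t, e t = (l : ℂ) • (t : H) - T t := fun t => rfl
  have hdense : DenseRange e := by
    have : (LinearMap.range e)ᗮ = ⊥ := by
      refine (Submodule.eq_bot_iff _).2 fun ψ hψ => hrange ψ fun t => ?_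
      have h1 := (Submodule.mem_orthogonal' _ _).1 hψ (e t) ⟨t, rfl⟩
      rw [← neg_sub, inner_neg_right, ← he, h1, neg_zero]
    have h2 := (Submodule.topologicalClosure_eq_top_iff).2 this
    have h3 : Dense ((LinearMap.range e : Submodule ℂ H) : Set H) :=
      Submodule.dense_iff_topologicalClosure_eq_top.2 h2
    rwa [LinearMap.coe_range] at h3
  have hre : ∀ t : T.domain, l * ‖(t : H)‖ ^ 2 ≤ (⟪(t : H), e t⟫_ℂ).re := by
    intro t
    have h1 := hnonpos t
    rw [he, inner_sub_right, inner_smul_right, inner_self_eq_norm_sq_to_K, Complex.sub_re]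
    have : ((l : ℂ) * ((‖(t : H)‖ : ℂ)) ^ 2).re = l * ‖(t : H)‖ ^ 2 := by
      norm_cast
    simp only [Complex.coe_algebraMap]
    rw [this]
    linarith
  have hbound : ∀ t : T.domain, ‖T.domain.subtype t‖ ≤ l⁻¹ * ‖e t‖ := by
    intro t
    have h1 := (hre t).trans ((Complex.re_le_norm _).trans (norm_inner_le_norm _ _))
    rw [Submodule.subtype_apply, le_inv_mul_iff₀ hl]
    by_cases h0 : ‖(t : H)‖ = 0
    · rw [h0, mul_zero]; exact norm_nonneg _
    · have : 0 < ‖(t : H)‖ := lt_of_le_of_ne (norm_nonneg _) (Ne.symm h0)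
      nlinarith
  let R : H →L[ℂ] H := (T.domain.subtype).extendOfNorm e
  have hR : ∀ t, R (e t) = t := fun t => LinearMap.extendOfNorm_eq hdense ⟨_, hbound⟩ t
  have hRsymm : ∀ x y, ⟪R x, y⟫_ℂ = ⟪x, R y⟫_ℂ := by
    refine fun x y => hdense.induction_on₂ (p := fun x y => ⟪R x, y⟫_ℂ = ⟪x, R y⟫_ℂ) ?_ ?_ x y
    · exact isClosed_eq (by fun_prop) (by fun_prop)
    · intro s t
      rw [hR, hR, he, he, inner_sub_right, inner_sub_left, hsymm, inner_smul_left,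
        inner_smul_right, Complex.conj_ofReal]
  have hgraph : ∀ x z, (x, z) ∈ T†.graph ↔ x = R ((l : ℂ) • x - z) := by
    intro x z
    rw [mem_graph_adjoint_iff hT]
    have h1 : x = R ((l : ℂ) • x - z) ↔ ∀ y, ⟪R ((l : ℂ) • x - z), y⟫_ℂ = ⟪x, y⟫_ℂ :=
      ⟨fun h y => by rw [← h], fun h => (ext_inner_right ℂ h).symm⟩
    have h2 : (∀ y, ⟪R ((l : ℂ) • x - z), y⟫_ℂ = ⟪x, y⟫_ℂ) ↔
        ∀ t, ⟪R ((l : ℂ) • x - z), e t⟫_ℂ = ⟪x, e t⟫_ℂ :=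
      ⟨fun h t => h _, fun h y => hdense.induction_on
        (p := fun y => ⟪R ((l : ℂ) • x - z), y⟫_ℂ = ⟪x, y⟫_ℂ) y
        (isClosed_eq (by fun_prop) (by fun_prop)) h⟩
    rw [h1, h2]
    refine forall_congr' fun t => ?_
    rw [hRsymm, hR, he, inner_sub_left, inner_sub_right, inner_smul_left, inner_smul_right,
      Complex.conj_ofReal]
    constructor
    · intro h; rw [h]
    · intro h; exact sub_right_injective h
  have hRdense : DenseRange R := hT.mono fun t ht => ⟨e ⟨t, ht⟩, hR ⟨t, ht⟩⟩
  have hsq : ∀ y, l * ‖R y‖ ^ 2 ≤ (⟪R y, y⟫_ℂ).re := by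
    intro y
    refine hdense.induction_on (p := fun y => l * ‖R y‖ ^ 2 ≤ (⟪R y, y⟫_ℂ).re) y ?_ ?_
    · exact isClosed_le (by fun_prop) (Complex.continuous_re.comp (by fun_prop))
    · intro t
      rw [hR]
      exact hre t
  have hres : IsResolvent T† l R := ⟨hl, hgraph, hRsymm, hsq, hRdense⟩
  have hle : T ≤ T† := LinearPMap.IsFormalAdjoint.le_adjoint hT fun s t => (hsymm s t)
  have hdense' : Dense (T†.domain : Set H) := hT.mono hle.1
  have hsa : IsSelfAdjoint T† := by
    rw [LinearPMap.isSelfAdjoint_def]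
    refine LinearPMap.eq_of_eq_graph (Submodule.ext fun p => ?_)
    obtain ⟨x, z⟩ := p
    rw [hgraph, mem_graph_adjoint_iff hdense']
    constructor
    · intro h
      refine ext_inner_right ℂ fun y => ?_
      have hmem : (R y, (l : ℂ) • R y - y) ∈ T†.graph := by
        rw [hgraph, sub_sub_cancel]
      obtain ⟨t, ht1, ht2⟩ := (LinearPMap.mem_graph_iff _).1 hmem
      have h1 := h t
      rw [ht1, ht2] at h1
      rw [hRsymm, inner_sub_left, h1, inner_sub_right, inner_smul_left, inner_smul_right,
        Complex.conj_ofReal]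
      simp
    · intro h t
      have hmem := (hgraph _ _).1 (LinearPMap.mem_graph _ t)
      have h1 : ⟪(l : ℂ) • x - z, (t : H)⟫_ℂ = ⟪x, (l : ℂ) • (t : H) - T† t⟫_ℂ := by
        conv_lhs => rw [hmem, ← hRsymm, ← h]
      rw [inner_sub_left, inner_sub_right, inner_smul_left, inner_smul_right,
        Complex.conj_ofReal] at h1
      exact sub_right_injective h1
  exact ⟨isUniqueSelfAdjointExtension_adjoint hT hle hsa, R, hres⟩

end Resolvent

/-! ### Functional calculus of the resolvent -/

section Calculus

variable {H : Type*} [NormedAddCommGroup H] [InnerProductSpace ℂ H] [CompleteSpace H]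
  {A : H →ₗ.[ℂ] H} {l : ℝ} {R : H →L[ℂ] H}

lemma IsResolvent.isSelfAdjoint (h : IsResolvent A l R) : IsSelfAdjoint R :=
  ContinuousLinearMap.isSelfAdjoint_iff_isSymmetric.2 h.symm

lemma IsResolvent.nonneg (h : IsResolvent A l R) : 0 ≤ R := by
  rw [ContinuousLinearMap.nonneg_iff_isPositive]
  refine ⟨h.symm, fun x => ?_⟩
  exact (mul_nonneg h.pos.le (sq_nonneg _)).trans (h.sq_le x)

lemma IsResolvent.norm_apply_le (h : IsResolvent A l R) (y : H) : ‖R y‖ ≤ l⁻¹ * ‖y‖ := by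
  have h1 := (h.sq_le y).trans ((Complex.re_le_norm _).trans (norm_inner_le_norm _ _))
  rw [le_inv_mul_iff₀ h.pos]
  by_cases h0 : ‖R y‖ = 0
  · rw [h0, mul_zero]; exact norm_nonneg _
  · have : 0 < ‖R y‖ := lt_of_le_of_ne (norm_nonneg _) (Ne.symm h0)
    nlinarith

lemma IsResolvent.le_algebraMap (h : IsResolvent A l R) :
    R ≤ algebraMap ℝ (H →L[ℂ] H) l⁻¹ := by
  rw [ContinuousLinearMap.le_def]
  refine ⟨fun x y => ?_, fun x => ?_⟩
  · have := h.symm x y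
    simp [Algebra.algebraMap_eq_smul_one, inner_sub_left, inner_sub_right, this,
      inner_smul_left_eq_smul, inner_smul_right_eq_smul]
  · have h1 : (⟪R x, x⟫_ℂ).re ≤ l⁻¹ * ‖x‖ ^ 2 := by
      refine (Complex.re_le_norm _).trans ((norm_inner_le_norm _ _).trans ?_)
      have := mul_le_mul_of_nonneg_right (h.norm_apply_le x) (norm_nonneg x)
      nlinarith
    simp only [ContinuousLinearMap.reApplyInnerSelf_apply]
    simp [Algebra.algebraMap_eq_smul_one, inner_sub_left,
      inner_smul_left_eq_smul, inner_self_eq_norm_sq_to_K]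
    norm_cast

lemma IsResolvent.spectrum_subset (h : IsResolvent A l R) : spectrum ℝ R ⊆ Icc 0 l⁻¹ := by
  intro r hr
  refine ⟨spectrum_nonneg_of_nonneg h.nonneg hr, ?_⟩
  exact (le_algebraMap_iff_spectrum_le h.isSelfAdjoint).1 h.le_algebraMap r hr

/-- A family of continuous functions on `(0, c]`, depending continuously on a parameter `t` and
bounded locally uniformly in `t`. A function of a self-adjoint `A ≤ 0` is encoded as a function of
the variable `r` standing for the resolvent `(l - A)⁻¹`, so `A` itself is `l - 1 / r`. -/
structure IsSymbol (c : ℝ) (F : ℝ → ℝ → ℝ) : Prop where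
  cont : ContinuousOn (Function.uncurry F) (univ ×ˢ Ioc 0 c)
  bdd : ∀ T : ℝ, ∃ M : ℝ, ∀ t, |t| ≤ T → ∀ r ∈ Ioc 0 c, |F t r| ≤ M

lemma IsSymbol.continuousOn_mul {c : ℝ} {F : ℝ → ℝ → ℝ} (hF : IsSymbol c F) :
    ContinuousOn (fun p : ℝ × ℝ => p.2 * F p.1 p.2) (univ ×ˢ Icc 0 c) := by
  rintro ⟨t, r⟩ ⟨-, hr⟩
  rcases eq_or_lt_of_le hr.1 with h0 | h0
  · obtain rfl : r = 0 := h0.symm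
    obtain ⟨M, hM⟩ := hF.bdd (|t| + 1)
    have hev : ∀ᶠ p : ℝ × ℝ in 𝓝[univ ×ˢ Icc 0 c] (t, 0), ‖p.2 * F p.1 p.2‖ ≤ |p.2| * M := by
      have h1 : ∀ᶠ p : ℝ × ℝ in 𝓝 (t, (0 : ℝ)), |p.1| < |t| + 1 :=
        (continuous_fst.abs.continuousAt (x := (t, (0 : ℝ)))).eventually_lt
          continuousAt_const (by simp)
      filter_upwards [nhdsWithin_le_nhds h1, self_mem_nhdsWithin] with p hp1 hp2
      rcases eq_or_lt_of_le hp2.2.1 with h | h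
      · rw [← h]; simp
      · rw [norm_mul, Real.norm_eq_abs, Real.norm_eq_abs]
        exact mul_le_mul_of_nonneg_left (hM _ hp1.le _ ⟨h, hp2.2.2⟩) (abs_nonneg _)
    have hlim : Tendsto (fun p : ℝ × ℝ => |p.2| * M) (𝓝[univ ×ˢ Icc 0 c] (t, 0)) (𝓝 0) := by
      have : Continuous fun p : ℝ × ℝ => |p.2| * M := by fun_prop
      simpa using (this.tendsto (t, (0 : ℝ))).mono_left nhdsWithin_le_nhds
    have := squeeze_zero_norm' hev hlim
    simpa [ContinuousWithinAt] using this
  · have h1 : ContinuousWithinAt (fun p : ℝ × ℝ => p.2 * F p.1 p.2) (univ ×ˢ Ioc 0 c) (t, r) :=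
      continuous_snd.continuousWithinAt.mul (hF.cont (t, r) ⟨mem_univ _, h0, hr.2⟩)
    refine h1.mono_of_mem_nhdsWithin ?_
    have h2 : {p : ℝ × ℝ | 0 < p.2} ∈ 𝓝 (t, r) :=
      (isOpen_lt continuous_const continuous_snd).mem_nhds h0
    filter_upwards [self_mem_nhdsWithin, nhdsWithin_le_nhds h2] with p hp1 hp2
    exact ⟨mem_univ _, hp2, hp1.2.2⟩

lemma IsSymbol.continuousOn_mul_apply {c : ℝ} {F : ℝ → ℝ → ℝ} (hF : IsSymbol c F) (t : ℝ) :
    ContinuousOn (fun r => r * F t r) (Icc 0 c) :=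
  hF.continuousOn_mul.comp (f := fun r => (t, r)) (by fun_prop) fun _ hr => ⟨mem_univ _, hr⟩

/-- The operator `f(A)` for a bounded function `f` of `A`, where `r ↦ f (l - 1 / r)` is `F` and `R`
is the resolvent of `A`. As `F` need not extend continuously to `r = 0`, it is determined by
`f(A) R = (r F)(R)` on the dense range of `R`. -/
def symbolOp (R : H →L[ℂ] H) (F : ℝ → ℝ) : H →L[ℂ] H :=
  (cfc (fun r => r * F r) R : H →L[ℂ] H).toLinearMap.extendOfNorm R.toLinearMap

lemma IsResolvent.norm_cfc_mul_apply_le (h : IsResolvent A l R) {F : ℝ → ℝ} {M : ℝ}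
    (hc : ContinuousOn (fun r => r * F r) (Icc 0 l⁻¹)) (hM : ∀ r ∈ Ioc 0 l⁻¹, |F r| ≤ M) (y : H) :
    ‖cfc (fun r => r * F r) R y‖ ≤ M * ‖R y‖ := by
  have hM0 : 0 ≤ M := (abs_nonneg _).trans (hM l⁻¹ ⟨inv_pos.2 h.pos, le_rfl⟩)
  have hsp := h.spectrum_subset
  have hc' := hc.mono hsp
  set S : H →L[ℂ] H := cfc (fun r => r * F r) R with hS
  have hSsa : IsSelfAdjoint S := cfc_predicate _ _
  have hmul : S * S = cfc (fun r => (r * F r) * (r * F r)) R := by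
    rw [hS, ← cfc_mul _ _ R hc' hc']
  have hRR : (M ^ 2) • (R * R) = cfc (fun r : ℝ => M ^ 2 * (r * r)) R := by
    rw [cfc_const_mul (M ^ 2) (fun r : ℝ => r * r) R (by fun_prop),
      cfc_mul (fun r : ℝ => r) (fun r => r) R, cfc_id' ℝ R h.isSelfAdjoint]
  have hle : S * S ≤ (M ^ 2) • (R * R) := by
    rw [hmul, hRR]
    refine cfc_mono (fun r hr => ?_) (hc'.mul hc') (by fun_prop)
    rcases eq_or_lt_of_le (hsp hr).1 with h0 | h0
    · rw [← h0]; simp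
    · have := abs_le.1 (hM r ⟨h0, (hsp hr).2⟩)
      have h2 : F r * F r ≤ M ^ 2 := by nlinarith
      have h3 : 0 ≤ r * r := mul_self_nonneg r
      nlinarith
  have hpos := ((ContinuousLinearMap.le_def _ _).1 hle).re_inner_nonneg_left y
  have h1 : ⟪(S * S) y, y⟫_ℂ = (‖S y‖ : ℂ) ^ 2 := by
    have := (ContinuousLinearMap.isSelfAdjoint_iff_isSymmetric.1 hSsa) (S y) y
    rw [← Complex.coe_algebraMap, ← inner_self_eq_norm_sq_to_K]
    exact this
  have h2 : ⟪(R * R) y, y⟫_ℂ = (‖R y‖ : ℂ) ^ 2 := by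
    rw [← Complex.coe_algebraMap, ← inner_self_eq_norm_sq_to_K]
    exact h.symm (R y) y
  rw [sub_apply, smul_apply, inner_sub_left,
    inner_smul_left_eq_smul, h1, h2] at hpos
  have h3 : ‖S y‖ ^ 2 ≤ (M * ‖R y‖) ^ 2 := by
    rw [mul_pow]
    have : RCLike.re ((M ^ 2 : ℝ) • (‖R y‖ : ℂ) ^ 2 - (‖S y‖ : ℂ) ^ 2) =
        M ^ 2 * ‖R y‖ ^ 2 - ‖S y‖ ^ 2 := by
      simp [← Complex.ofReal_pow]
    linarith
  exact (sq_le_sq₀ (norm_nonneg _) (by positivity)).1 h3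

variable {F G : ℝ → ℝ → ℝ}

lemma IsResolvent.symbolOp_apply (h : IsResolvent A l R) (hF : IsSymbol l⁻¹ F) (t : ℝ) (y : H) :
    symbolOp R (F t) (R y) = cfc (fun r => r * F t r) R y := by
  obtain ⟨M, hM⟩ := hF.bdd |t|
  exact LinearMap.extendOfNorm_eq h.dense
    ⟨M, h.norm_cfc_mul_apply_le (hF.continuousOn_mul_apply t) (hM t le_rfl)⟩ y

lemma IsResolvent.norm_symbolOp_le (h : IsResolvent A l R) (hF : IsSymbol l⁻¹ F) (T : ℝ) :
    ∃ M, 0 ≤ M ∧ ∀ t, |t| ≤ T → ∀ x, ‖symbolOp R (F t) x‖ ≤ M * ‖x‖ := by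
  obtain ⟨M, hM⟩ := hF.bdd T
  refine ⟨|M|, abs_nonneg _, fun t ht x => ?_⟩
  exact LinearMap.norm_extendOfNorm_apply_le h.dense |M|
    (h.norm_cfc_mul_apply_le (hF.continuousOn_mul_apply t)
      fun r hr => (hM t ht r hr).trans (le_abs_self _)) x

lemma IsResolvent.continuous_cfc (h : IsResolvent A l R) {E : ℝ → ℝ → ℝ}
    (hE : ContinuousOn (Function.uncurry E) (univ ×ˢ Icc 0 l⁻¹)) :
    Continuous fun t => cfc (E t) R := by
  have hE' : ContinuousOn (Function.uncurry E) (univ ×ˢ spectrum ℝ R) :=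
    hE.mono (prod_mono_right h.spectrum_subset)
  have hc : ∀ t, ContinuousOn (E t) (spectrum ℝ R) := fun t =>
    hE'.comp (f := fun r => (t, r)) (by fun_prop) fun _ hr => ⟨mem_univ _, hr⟩
  rw [continuous_iff_continuousAt]
  intro t
  refine tendsto_cfc_fun (fun u hu => ?_) (Eventually.of_forall hc)
  obtain ⟨v, hv, hv'⟩ := (spectrum.isCompact R).mem_uniformity_of_prod hE' (mem_univ t)
    (symm_le_uniformity hu)
  rw [nhdsWithin_univ] at hv
  filter_upwards [hv] with s hs r hr
  exact hv' s hs r hr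

/-- The operators attached to a symbol depend strongly continuously on the parameter. -/
lemma IsResolvent.continuous_symbolOp (h : IsResolvent A l R) (hF : IsSymbol l⁻¹ F) (x : H) :
    Continuous fun t => symbolOp R (F t) x := by
  rw [continuous_iff_continuousAt]
  intro t
  obtain ⟨M, hM0, hM⟩ := h.norm_symbolOp_le hF (|t| + 1)
  rw [Metric.continuousAt_iff]
  intro ε hε
  obtain ⟨y, hy⟩ := h.dense.exists_dist_lt x (ε := ε / (4 * (M + 1))) (by positivity)
  have hcont : Continuous fun s => symbolOp R (F s) (R y) := by
    simp only [h.symbolOp_apply hF]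
    have := h.continuous_cfc (E := fun t r => r * F t r) hF.continuousOn_mul
    fun_prop
  obtain ⟨δ, hδ, hδ'⟩ :=
    Metric.continuousAt_iff.1 (hcont.continuousAt (x := t)) (ε / 2) (by linarith)
  refine ⟨min δ 1, lt_min hδ one_pos, fun s hs => ?_⟩
  have hs1 := hδ' (hs.trans_le (min_le_left _ _))
  have hs2 : |s| ≤ |t| + 1 := by
    have h1 : |s - t| < 1 := hs.trans_le (min_le_right _ _)
    have h2 := abs_sub_abs_le_abs_sub s t
    linarith
  have hd : ∀ r, |r| ≤ |t| + 1 → dist (symbolOp R (F r) x) (symbolOp R (F r) (R y)) ≤ ε / 4 := by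
    intro r hr
    rw [dist_eq_norm, ← map_sub]
    refine (hM r hr _).trans ?_
    rw [dist_eq_norm] at hy
    have h3 : M * ‖x - R y‖ ≤ (M + 1) * (ε / (4 * (M + 1))) := by
      gcongr
      linarith
    refine h3.trans (le_of_eq ?_)
    field_simp
  have h4 := dist_triangle4 (symbolOp R (F s) x) (symbolOp R (F s) (R y))
    (symbolOp R (F t) (R y)) (symbolOp R (F t) x)
  have h5 := hd s hs2
  have h6 := hd t (by linarith)
  rw [dist_comm] at h6
  linarith

/-- Integration of a symbol with respect to the parameter. -/
lemma IsResolvent.symbolOp_eq_add_integral (h : IsResolvent A l R) (hF : IsSymbol l⁻¹ F)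
    (hG : IsSymbol l⁻¹ G) {t : ℝ} (ht : 0 ≤ t)
    (hFG : ∀ r ∈ Ioc 0 l⁻¹, F t r = F 0 r + ∫ s in (0 : ℝ)..t, G s r) (x : H) :
    symbolOp R (F t) x = symbolOp R (F 0) x + ∫ s in (0 : ℝ)..t, symbolOp R (G s) x := by
  have hsp := h.spectrum_subset
  refine h.dense.induction_on
    (p := fun x => symbolOp R (F t) x = symbolOp R (F 0) x + ∫ s in (0 : ℝ)..t, symbolOp R (G s) x)
    x ?_ ?_
  · refine isClosed_eq (by fun_prop) ((by fun_prop : Continuous _).add ?_)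
    -- the integral is a bounded linear function of `x`
    obtain ⟨M, hM0, hM⟩ := h.norm_symbolOp_le hG t
    have hi : ∀ x, IntervalIntegrable (fun s => symbolOp R (G s) x) volume 0 t := fun x =>
      (h.continuous_symbolOp hG x).intervalIntegrable _ _
    let I : H →ₗ[ℂ] H :=
      { toFun := fun x => ∫ s in (0 : ℝ)..t, symbolOp R (G s) x
        map_add' := fun x y => by
          simp only [map_add]
          exact intervalIntegral.integral_add (hi x) (hi y)
        map_smul' := fun c x => by
          simp only [map_smul, RingHom.id_apply]
          exact intervalIntegral.integral_smul c _ }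
    refine (I.mkContinuous (M * |t - 0|) fun x => ?_).continuous
    have := intervalIntegral.norm_integral_le_of_norm_le_const (a := 0) (b := t)
      (f := fun s => symbolOp R (G s) x) (C := M * ‖x‖) fun s hs => by
        rw [uIoc_of_le ht] at hs
        exact hM s (by rw [abs_of_pos hs.1]; exact hs.2) x
    calc ‖I x‖ ≤ M * ‖x‖ * |t - 0| := this
      _ = M * |t - 0| * ‖x‖ := by ring
  · intro y
    have hGc : ContinuousOn (Function.uncurry fun s r => r * G s r) (univ ×ˢ Icc 0 l⁻¹) :=
      hG.continuousOn_mul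
    have hcont := h.continuous_cfc hGc
    have hint : cfc (fun r => ∫ s in Ioc 0 t, r * G s r) R =
        ∫ s in Ioc 0 t, cfc (fun r => r * G s r) R := by
      obtain ⟨M, hM⟩ := hG.bdd t
      refine cfc_setIntegral measurableSet_Ioc _ (fun _ => l⁻¹ * |M|) R
        (hGc.mono (prod_mono (subset_univ _) hsp)) ?_ ?_ h.isSelfAdjoint
      · refine (ae_restrict_mem measurableSet_Ioc).mono fun s hs r hr => ?_
        have hr' := hsp hr
        rcases eq_or_lt_of_le hr'.1 with h0 | h0
        · rw [← h0]
          simp only [zero_mul, norm_zero]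
          have := h.pos
          positivity
        · rw [norm_mul, Real.norm_eq_abs, Real.norm_eq_abs, abs_of_pos h0]
          have := hM s (by rw [abs_of_pos hs.1]; exact hs.2) r ⟨h0, hr'.2⟩
          exact mul_le_mul hr'.2 (this.trans (le_abs_self _)) (abs_nonneg _)
            (inv_pos.2 h.pos).le
      · exact (integrable_const _).2
    have hIc : ContinuousOn (fun r => ∫ s in Ioc 0 t, r * G s r) (spectrum ℝ R) := by
      have h1 : ContinuousOn (fun r => r * F t r - r * F 0 r) (spectrum ℝ R) :=
        ((hF.continuousOn_mul_apply t).sub (hF.continuousOn_mul_apply 0)).mono hsp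
      refine h1.congr fun r hr => ?_
      have hr' := hsp hr
      simp only [integral_const_mul]
      rcases eq_or_lt_of_le hr'.1 with h0 | h0
      · rw [← h0]; simp
      · rw [hFG r ⟨h0, hr'.2⟩, intervalIntegral.integral_of_le ht]
        ring
    have hcfc : cfc (fun r => r * F t r) R =
        cfc (fun r => r * F 0 r) R + ∫ s in (0 : ℝ)..t, cfc (fun r => r * G s r) R := by
      rw [intervalIntegral.integral_of_le ht, ← hint,
        ← cfc_add R _ _ ((hF.continuousOn_mul_apply 0).mono hsp) hIc]
      · refine cfc_congr fun r hr => ?_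
        have hr' := hsp hr
        simp only [integral_const_mul]
        rcases eq_or_lt_of_le hr'.1 with h0 | h0
        · rw [← h0]; simp
        · rw [hFG r ⟨h0, hr'.2⟩, intervalIntegral.integral_of_le ht, mul_add]
    simp only [h.symbolOp_apply hF, h.symbolOp_apply hG]
    rw [hcfc, add_apply]
    congr 1
    exact ContinuousLinearMap.intervalIntegral_apply (μ := volume) (hcont.intervalIntegrable 0 t) y

/-- `symbolOp` is compatible with multiplication by functions continuous up to `r = 0`. -/
lemma IsResolvent.symbolOp_mul (h : IsResolvent A l R) (hF : IsSymbol l⁻¹ F) {q : ℝ → ℝ}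
    (hq : Continuous q) (hqF : IsSymbol l⁻¹ fun t r => q r * F t r) (t : ℝ) (x : H) :
    symbolOp R (fun r => q r * F t r) x = cfc q R (symbolOp R (F t) x) := by
  refine h.dense.induction_on
    (p := fun x => symbolOp R (fun r => q r * F t r) x = cfc q R (symbolOp R (F t) x)) x
    (isClosed_eq (by fun_prop) (by fun_prop)) fun y => ?_
  rw [h.symbolOp_apply hqF t y, h.symbolOp_apply hF t y, ← mul_apply_eq_comp,
    ← cfc_mul _ _ R hq.continuousOn ((hF.continuousOn_mul_apply t).mono h.spectrum_subset)]
  congr 2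
  funext r
  ring

lemma IsSymbol.mul_left {c : ℝ} (hF : IsSymbol c F) {q : ℝ → ℝ} (hq : Continuous q) :
    IsSymbol c fun t r => q r * F t r := by
  refine ⟨(hq.comp continuous_snd).continuousOn.mul hF.cont, fun T => ?_⟩
  obtain ⟨M, hM⟩ := hF.bdd T
  obtain ⟨C, hC⟩ := isCompact_Icc.exists_bound_of_continuousOn (hq.continuousOn (s := Icc 0 c))
  refine ⟨C * M, fun t ht r hr => ?_⟩
  rw [abs_mul]
  have h1 := hC r ⟨hr.1.le, hr.2⟩
  exact mul_le_mul h1 (hM t ht r hr) (abs_nonneg _) ((norm_nonneg _).trans h1)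

lemma IsResolvent.symbolOp_one (h : IsResolvent A l R) (hF : IsSymbol l⁻¹ F) {t : ℝ}
    (h1 : ∀ r, F t r = 1) (x : H) : symbolOp R (F t) x = x := by
  refine h.dense.induction_on (p := fun x => symbolOp R (F t) x = x) x
    (isClosed_eq (by fun_prop) (by fun_prop)) fun y => ?_
  rw [h.symbolOp_apply hF]
  simp only [h1, mul_one]
  rw [cfc_id' ℝ R h.isSelfAdjoint]

lemma IsResolvent.symbolOp_zero (h : IsResolvent A l R) (hF : IsSymbol l⁻¹ F) {t : ℝ}
    (h1 : ∀ r, F t r = 0) (x : H) : symbolOp R (F t) x = 0 := by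
  refine h.dense.induction_on (p := fun x => symbolOp R (F t) x = 0) x
    (isClosed_eq (by fun_prop) (by fun_prop)) fun y => ?_
  rw [h.symbolOp_apply hF]
  simp only [h1, mul_zero]
  simp

end Calculus

/-! ### Evolution equations -/

section Evolution

variable {H : Type*} [NormedAddCommGroup H] [InnerProductSpace ℂ H] [CompleteSpace H]
  {A : H →ₗ.[ℂ] H} {l : ℝ} {R : H →L[ℂ] H}

lemma eq_of_hasDerivWithinAt_zero {E : Type*} [NormedAddCommGroup E] [NormedSpace ℝ E]
    {f : ℝ → E} (h : ∀ t ∈ Ici (0 : ℝ), HasDerivWithinAt f 0 (Ici 0) t) {t : ℝ} (ht : 0 ≤ t) :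
    f t = f 0 := by
  refine constant_of_has_deriv_right_zero (a := 0) (b := t) (fun s hs => ?_) (fun s hs => ?_) t
    ⟨ht, le_rfl⟩
  · exact (h s hs.1).continuousWithinAt.mono Icc_subset_Ici_self
  · exact (h s hs.1).mono (Ici_subset_Ici.2 hs.1)

lemma hasDerivAt_integral_max {E : Type*} [NormedAddCommGroup E] [NormedSpace ℝ E]
    [CompleteSpace E] {g : ℝ → E} (hg : ContinuousOn g (Ici 0)) {t : ℝ} (ht : 0 ≤ t) :
    HasDerivAt (fun t => ∫ s in (0 : ℝ)..t, g (max s 0)) (g t) t := by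
  have hc : Continuous fun s => g (max s 0) :=
    hg.comp_continuous (by fun_prop) fun s => mem_Ici.2 (le_max_right _ _)
  have := intervalIntegral.integral_hasDerivAt_right (hc.intervalIntegrable 0 t)
    (hc.stronglyMeasurableAtFilter _ _) hc.continuousAt
  rwa [max_eq_left ht] at this

/-- A weakly differentiable curve with a continuous weak derivative is differentiable. -/
lemma hasDerivWithinAt_of_inner {w g : ℝ → H} (hg : ContinuousOn g (Ici 0))
    (h : ∀ y, ∀ t ∈ Ici (0 : ℝ),
      HasDerivWithinAt (fun s => ⟪y, w s⟫_ℂ) ⟪y, g t⟫_ℂ (Ici 0) t) :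
    ∀ t ∈ Ici (0 : ℝ), HasDerivWithinAt w (g t) (Ici 0) t := by
  have hI := fun t (ht : 0 ≤ t) => (hasDerivAt_integral_max hg ht).hasDerivWithinAt (s := Ici 0)
  set I : ℝ → H := fun t => ∫ s in (0 : ℝ)..t, g (max s 0)
  have heq : ∀ t ∈ Ici (0 : ℝ), w t = w 0 + I t := by
    intro t ht
    refine ext_inner_left ℂ fun y => ?_
    have h1 : ∀ s ∈ Ici (0 : ℝ),
        HasDerivWithinAt (fun s => ⟪y, w s⟫_ℂ - ⟪y, I s⟫_ℂ) 0 (Ici 0) s := fun s hs => by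
      have h2 := ((innerSL ℂ y).hasFDerivAt.restrictScalars ℝ).comp_hasDerivWithinAt s (hI s hs)
      exact ((h y s hs).sub h2).congr_deriv (sub_self _)
    have h2 := eq_of_hasDerivWithinAt_zero h1 ht
    have h3 : I 0 = 0 := intervalIntegral.integral_same
    rw [h3, inner_zero_right, sub_zero, sub_eq_iff_eq_add] at h2
    rw [inner_add_right, h2]
  intro t ht
  exact ((hI t ht).const_add (w 0)).congr heq (heq t ht)

lemma IsResolvent.exists_domain (h : IsResolvent A l R) (y : H) :
    ∃ v : A.domain, (v : H) = R y ∧ A v = (l : ℂ) • R y - y := by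
  have : (R y, (l : ℂ) • R y - y) ∈ A.graph := by rw [h.mem_graph_iff, sub_sub_cancel]
  obtain ⟨v, h1, h2⟩ := (LinearPMap.mem_graph_iff _).1 this
  exact ⟨v, h1, h2⟩

lemma IsResolvent.exists_preimage (h : IsResolvent A l R) (v : A.domain) :
    ∃ y, (v : H) = R y ∧ A v = (l : ℂ) • R y - y := by
  have h1 := (h.mem_graph_iff _ _).1 (A.mem_graph v)
  exact ⟨_, h1, by rw [← h1, sub_sub_cancel]⟩

lemma IsResolvent.inner_apply (h : IsResolvent A l R) (x y : H) :
    ⟪(l : ℂ) • R y - y, x⟫_ℂ = ⟪y, (l : ℂ) • R x - x⟫_ℂ := by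
  rw [inner_sub_left, inner_sub_right, inner_smul_left, inner_smul_right, Complex.conj_ofReal,
    h.symm]

lemma IsResolvent.eq_zero (h : IsResolvent A l R) {x : H} (hx : R x = 0) : x = 0 :=
  h.dense.eq_zero_of_inner_left ℂ fun y => by rw [← h.symm, hx, inner_zero_left]

/-- The energy method for `∂ₜ d = c A d` with `Re c ≥ 0`: the norm of `R d` does not increase. -/
lemma IsResolvent.firstOrder_eq_zero (h : IsResolvent A l R) {c : ℂ} (hc : 0 ≤ c.re)
    {d : ℝ → H} (hd : ContinuousOn d (Ici 0)) (hd0 : d 0 = 0)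
    (hderiv : ∀ v : A.domain, ∀ t ∈ Ici (0 : ℝ),
      HasDerivWithinAt (fun s => ⟪(v : H), d s⟫_ℂ) (c * ⟪A v, d t⟫_ℂ) (Ici 0) t)
    {t : ℝ} (ht : 0 ≤ t) : d t = 0 := by
  set g : ℝ → H := fun s => c • ((l : ℂ) • R (d s) - d s)
  have hg : ContinuousOn g (Ici 0) := by fun_prop
  have hz : ∀ s ∈ Ici (0 : ℝ), HasDerivWithinAt (fun s => R (d s)) (g s) (Ici 0) s := by
    refine hasDerivWithinAt_of_inner hg fun y s hs => ?_
    obtain ⟨v, hv1, hv2⟩ := h.exists_domain y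
    have h1 := hderiv v s hs
    rw [hv1, hv2, h.inner_apply, ← inner_smul_right] at h1
    simpa only [h.symm] using h1
  have hE : ∀ s ∈ Ici (0 : ℝ), HasDerivWithinAt (fun s => (⟪R (d s), R (d s)⟫_ℂ).re)
      (⟪R (d s), g s⟫_ℂ + ⟪g s, R (d s)⟫_ℂ).re (Ici 0) s := fun s hs =>
    Complex.reCLM.hasFDerivAt.comp_hasDerivWithinAt s ((hz s hs).inner ℂ (hz s hs))
  have hneg : ∀ s, (⟪R (d s), g s⟫_ℂ + ⟪g s, R (d s)⟫_ℂ).re ≤ 0 := by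
    intro s
    have h1 : (⟪g s, R (d s)⟫_ℂ).re = (⟪R (d s), g s⟫_ℂ).re := inner_re_symm (𝕜 := ℂ) _ _
    have h2 : (⟪R (d s), d s⟫_ℂ).im = 0 := by
      have h3 : (⟪R (d s), d s⟫_ℂ).im = -(⟪d s, R (d s)⟫_ℂ).im := inner_im_symm (𝕜 := ℂ) _ _
      rw [← h.symm] at h3
      linarith
    have h4 := h.sq_le (d s)
    have h5 : ⟪R (d s), R (d s)⟫_ℂ = ((‖R (d s)‖ ^ 2 : ℝ) : ℂ) := by
      rw [inner_self_eq_norm_sq_to_K]; norm_cast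
    rw [Complex.add_re, h1]
    simp only [g, inner_smul_right, inner_sub_right, h5, Complex.mul_re, Complex.sub_re,
      Complex.sub_im, h2, Complex.ofReal_re, Complex.ofReal_im, Complex.mul_im]
    nlinarith
  have hanti : AntitoneOn (fun s => (⟪R (d s), R (d s)⟫_ℂ).re) (Ici 0) := by
    refine antitoneOn_of_hasDerivWithinAt_nonpos (convex_Ici 0)
      (fun s hs => (hE s hs).continuousWithinAt)
      (fun s hs => (hE s (interior_subset hs)).mono interior_subset) fun s _ => hneg s
  have h1 := hanti (mem_Ici.2 le_rfl) (mem_Ici.2 ht) ht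
  simp only [hd0, map_zero, inner_zero_right, Complex.zero_re] at h1
  have h2 : ‖R (d t)‖ ^ 2 ≤ 0 := (norm_sq_eq_re_inner (𝕜 := ℂ) (R (d t))).trans_le h1
  exact h.eq_zero (norm_eq_zero.1 ((pow_eq_zero_iff two_ne_zero).1
    (le_antisymm h2 (sq_nonneg _))))

/-- The energy method for the wave equation. With `z = R d` and `x = z'` the energy is
`⟪x, R x⟫ + ⟪z, z - l R z⟫`. -/
lemma IsResolvent.secondOrder_eq_zero (h : IsResolvent A l R)
    {d : ℝ → H} (hd : ContinuousOn d (Ici 0)) (hd0 : d 0 = 0)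
    (hderiv : ∀ v : A.domain, ∃ f : ℝ → ℂ, f 0 = 0 ∧ ∀ t ∈ Ici (0 : ℝ),
      HasDerivWithinAt (fun s => ⟪(v : H), d s⟫_ℂ) (f t) (Ici 0) t ∧
      HasDerivWithinAt f ⟪A v, d t⟫_ℂ (Ici 0) t)
    {t : ℝ} (ht : 0 ≤ t) : d t = 0 := by
  set g : ℝ → H := fun s => (l : ℂ) • R (d s) - d s with hg_def
  have hg : ContinuousOn g (Ici 0) := by fun_prop
  set x : ℝ → H := fun t => ∫ s in (0 : ℝ)..t, g (max s 0)
  have hx : ∀ t ∈ Ici (0 : ℝ), HasDerivWithinAt x (g t) (Ici 0) t := fun t ht =>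
    (hasDerivAt_integral_max hg ht).hasDerivWithinAt
  have hx0 : x 0 = 0 := intervalIntegral.integral_same
  have hz : ∀ s ∈ Ici (0 : ℝ), HasDerivWithinAt (fun s => R (d s)) (x s) (Ici 0) s := by
    refine hasDerivWithinAt_of_inner (fun s hs => (hx s hs).continuousWithinAt) fun y s hs => ?_
    obtain ⟨v, hv1, hv2⟩ := h.exists_domain y
    obtain ⟨f, hf0, hf⟩ := hderiv v
    have h1 := (hf s hs).1
    have h2 : f s = ⟪y, x s⟫_ℂ := by
      have h3 : ∀ r ∈ Ici (0 : ℝ),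
          HasDerivWithinAt (fun r => f r - ⟪y, x r⟫_ℂ) 0 (Ici 0) r := fun r hr => by
        have h4 := ((innerSL ℂ y).hasFDerivAt.restrictScalars ℝ).comp_hasDerivWithinAt r (hx r hr)
        have h5 := ((hf r hr).2).sub h4
        rw [hv2, h.inner_apply] at h5
        exact h5.congr_deriv (sub_self _)
      have h4 := eq_of_hasDerivWithinAt_zero h3 hs
      rw [hf0, hx0, inner_zero_right, sub_zero, sub_eq_zero] at h4
      exact h4
    rw [hv1, h2] at h1
    simpa only [h.symm] using h1
  have hRx : ∀ s ∈ Ici (0 : ℝ), HasDerivWithinAt (fun s => R (x s)) (R (g s)) (Ici 0) s :=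
    fun s hs => (R.hasFDerivAt.restrictScalars ℝ).comp_hasDerivWithinAt s (hx s hs)
  have hRz : ∀ s ∈ Ici (0 : ℝ),
      HasDerivWithinAt (fun s => R (d s) - (l : ℂ) • R (R (d s))) (x s - (l : ℂ) • R (x s))
        (Ici 0) s := fun s hs =>
    (hz s hs).sub (((R.hasFDerivAt.restrictScalars ℝ).comp_hasDerivWithinAt s
      (hz s hs)).const_smul (l : ℂ))
  set E : ℝ → ℝ := fun s =>
    (⟪x s, R (x s)⟫_ℂ + ⟪R (d s), R (d s) - (l : ℂ) • R (R (d s))⟫_ℂ).re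
  have hE : ∀ s ∈ Ici (0 : ℝ), HasDerivWithinAt E 0 (Ici 0) s := by
    intro s hs
    have h1 := Complex.reCLM.hasFDerivAt.comp_hasDerivWithinAt s
      (((hx s hs).inner ℂ (hRx s hs)).add ((hz s hs).inner ℂ (hRz s hs)))
    refine h1.congr_deriv ?_
    have e1 : ∀ a b : H, (⟪a, b⟫_ℂ).re = (⟪b, a⟫_ℂ).re := fun a b => inner_re_symm (𝕜 := ℂ) _ _
    have e2 : ⟪x s, R (g s)⟫_ℂ =
        -⟪x s, R (d s) - (l : ℂ) • R (R (d s))⟫_ℂ := by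
      rw [← inner_neg_right, neg_sub, hg_def]
      simp only [map_sub, map_smul]
    have e3 : (⟪g s, R (x s)⟫_ℂ).re = (⟪x s, R (g s)⟫_ℂ).re := by
      rw [← h.symm, e1]
    have e4 : ⟪R (d s), x s - (l : ℂ) • R (x s)⟫_ℂ =
        ⟪R (d s) - (l : ℂ) • R (R (d s)), x s⟫_ℂ := by
      rw [inner_sub_left, inner_sub_right, inner_smul_left, inner_smul_right,
        Complex.conj_ofReal, h.symm (R (d s))]
    rw [Complex.reCLM_apply]
    simp only [Complex.add_re]
    rw [e3, e4, e2, e1 (R (d s) - _) (x s), Complex.neg_re]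
    ring
  have hE0 : E t = 0 := by
    rw [eq_of_hasDerivWithinAt_zero hE ht]
    simp [E, hx0, hd0]
  have hRx0 : ∀ s ∈ Ici (0 : ℝ), x s = 0 := by
    intro s hs
    have hEs : E s = 0 := by
      rw [eq_of_hasDerivWithinAt_zero hE hs]
      simp [E, hx0, hd0]
    have h1 := h.sq_le (x s)
    rw [h.symm] at h1
    have h2 : 0 ≤ (⟪R (d s), R (d s) - (l : ℂ) • R (R (d s))⟫_ℂ).re := by
      have h3 : (⟪R (d s), R (R (d s))⟫_ℂ).re ≤ l⁻¹ * ‖R (d s)‖ ^ 2 := by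
        refine (Complex.re_le_norm _).trans ((norm_inner_le_norm _ _).trans ?_)
        have := mul_le_mul_of_nonneg_left (h.norm_apply_le (R (d s))) (norm_nonneg (R (d s)))
        nlinarith
      have h5 : ⟪R (d s), R (d s)⟫_ℂ = ((‖R (d s)‖ ^ 2 : ℝ) : ℂ) := by
        rw [inner_self_eq_norm_sq_to_K]; norm_cast
      rw [inner_sub_right, inner_smul_right, h5, Complex.sub_re, Complex.re_ofReal_mul,
        Complex.ofReal_re]
      have h4 := mul_le_mul_of_nonneg_left h3 h.pos.le
      rw [← mul_assoc, mul_inv_cancel₀ h.pos.ne', one_mul] at h4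
      linarith
    have h3 : E s = (⟪x s, R (x s)⟫_ℂ).re +
        (⟪R (d s), R (d s) - (l : ℂ) • R (R (d s))⟫_ℂ).re := Complex.add_re _ _
    have h4 : l * ‖R (x s)‖ ^ 2 ≤ 0 := by linarith
    have h5 : ‖R (x s)‖ ^ 2 = 0 :=
      le_antisymm (nonpos_of_mul_nonpos_right h4 h.pos) (sq_nonneg _)
    exact h.eq_zero (norm_eq_zero.1 (pow_eq_zero_iff two_ne_zero |>.1 h5))
  have h1 := eq_of_hasDerivWithinAt_zero
    (fun s hs => (hz s hs).congr_deriv (hRx0 s hs)) ht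
  rw [hd0, map_zero] at h1
  exact h.eq_zero h1

variable {F G : ℝ → ℝ → ℝ}

lemma IsResolvent.symbolOp_id_mul (h : IsResolvent A l R) (hF : IsSymbol l⁻¹ F) (t : ℝ) (x : H) :
    symbolOp R (fun r => r * F t r) x = R (symbolOp R (F t) x) := by
  have h1 := h.symbolOp_mul hF continuous_id (hF.mul_left continuous_id) t x
  rwa [cfc_id ℝ R h.isSelfAdjoint] at h1

lemma IsResolvent.symbolOp_sub_mul (h : IsResolvent A l R) (hF : IsSymbol l⁻¹ F) (t : ℝ) (x : H) :
    symbolOp R (fun r => (l * r - 1) * F t r) x =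
      (l : ℂ) • R (symbolOp R (F t) x) - symbolOp R (F t) x := by
  have hq : Continuous fun r : ℝ => l * r - 1 := by fun_prop
  rw [h.symbolOp_mul hF hq (hF.mul_left hq) t x]
  have := h.isSelfAdjoint
  rw [cfc_sub (fun r : ℝ => l * r) (fun _ => (1 : ℝ)) R, cfc_const_mul l (fun r => r) R,
    cfc_id' ℝ R, cfc_const_one ℝ R]
  simp

/-- If `r ∂ₜF = (l r - 1) G`, that is `∂ₜF = a G` for the function `a = l - 1 / r` standing for
`A`, then `F(A) x` is an integral of `A G(A) x`, after application of `R`. -/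
lemma IsResolvent.apply_symbolOp_eq (h : IsResolvent A l R) (hF : IsSymbol l⁻¹ F)
    (hG : IsSymbol l⁻¹ G) {t : ℝ} (ht : 0 ≤ t)
    (hFG : ∀ r ∈ Ioc 0 l⁻¹, ∀ s ∈ Ici (0 : ℝ),
      HasDerivWithinAt (fun s => r * F s r) ((l * r - 1) * G s r) (Ici 0) s) (x : H) :
    R (symbolOp R (F t) x) = R (symbolOp R (F 0) x) +
      ∫ s in (0 : ℝ)..t, ((l : ℂ) • R (symbolOp R (G s) x) - symbolOp R (G s) x) := by
  have hq : Continuous fun r : ℝ => l * r - 1 := by fun_prop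
  have hF' := hF.mul_left continuous_id
  have hG' := hG.mul_left hq
  have h1 := h.symbolOp_eq_add_integral hF' hG' ht (fun r hr => ?_) x
  · simp only [h.symbolOp_sub_mul hG] at h1
    rw [← h.symbolOp_id_mul hF, ← h.symbolOp_id_mul hF]
    exact h1
  · have hGc : Continuous fun s => (l * r - 1) * G s r := by
      refine continuous_const.mul ?_
      exact hG.cont.comp_continuous (f := fun s => (s, r)) (by fun_prop)
        fun s => ⟨mem_univ _, hr⟩
    have h2 := intervalIntegral.integral_eq_sub_of_hasDeriv_right_of_le ht
      (f := fun s => r * F s r) (f' := fun s => (l * r - 1) * G s r)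
      (fun s hs => ((hFG r hr s hs.1).continuousWithinAt).mono Icc_subset_Ici_self)
      (fun s hs => (hFG r hr s hs.1.le).mono ((Ioi_subset_Ici_self).trans
        (Ici_subset_Ici.2 hs.1.le))) (hGc.intervalIntegrable _ _)
    rw [h2]
    simp

lemma isSymbol_of_bound {c : ℝ} {f : ℝ → ℝ → ℝ} (hf : Continuous (Function.uncurry f))
    {a : ℝ → ℝ} (ha : ContinuousOn a (Ioc 0 c)) {M : ℝ}
    (hM : ∀ t, ∀ r ∈ Ioc 0 c, |f t (a r)| ≤ M) : IsSymbol c fun t r => f t (a r) := by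
  refine ⟨?_, fun T => ⟨M, fun t _ r hr => hM t r hr⟩⟩
  have h1 : ContinuousOn (fun p : ℝ × ℝ => (p.1, a p.2)) (univ ×ˢ Ioc 0 c) :=
    continuousOn_fst.prodMk (ha.comp continuousOn_snd fun p hp => hp.2)
  exact hf.comp_continuousOn h1

lemma continuousOn_sub_inv (l c : ℝ) : ContinuousOn (fun r : ℝ => l - r⁻¹) (Ioc 0 c) :=
  continuousOn_const.sub (continuousOn_inv₀.mono fun _ hr => hr.1.ne')

lemma IsResolvent.firstOrder_weak (h : IsResolvent A l R) {c : ℂ} {u : ℝ → H} {t : ℝ}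
    (hu : HasDerivWithinAt (fun s => R (u s)) (c • ((l : ℂ) • R (u t) - u t)) (Ici 0) t)
    (v : A.domain) :
    HasDerivWithinAt (fun s => ⟪(v : H), u s⟫_ℂ) (c * ⟪A v, u t⟫_ℂ) (Ici 0) t := by
  obtain ⟨y, hy1, hy2⟩ := h.exists_preimage v
  have h1 := ((innerSL ℂ y).hasFDerivAt.restrictScalars ℝ).comp_hasDerivWithinAt t hu
  rw [hy1, hy2, h.inner_apply, ← inner_smul_right]
  simp only [h.symm]
  exact h1

lemma hasDerivWithinAt_add_integral {E : Type*} [NormedAddCommGroup E] [NormedSpace ℝ E]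
    [CompleteSpace E] {f g : ℝ → E} (hg : Continuous g)
    (h : ∀ t, 0 ≤ t → f t = f 0 + ∫ s in (0 : ℝ)..t, g s) {t : ℝ} (ht : 0 ≤ t) :
    HasDerivWithinAt f (g t) (Ici 0) t := by
  have h1 := (intervalIntegral.integral_hasDerivAt_right (hg.intervalIntegrable 0 t)
    (hg.stronglyMeasurableAtFilter _ _) hg.continuousAt).hasDerivWithinAt (s := Ici 0)
  exact (h1.const_add (f 0)).congr (fun s hs => h s hs) (h t ht)

/-- The heat semigroup. -/
theorem IsResolvent.exists_heat (h : IsResolvent A l R) (u₀ : H) :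
    ∃ u, IsHeatSolution A u₀ u := by
  let F : ℝ → ℝ → ℝ := fun t r => Real.exp (max t 0 * (l - r⁻¹))
  have hF : IsSymbol l⁻¹ F := by
    refine isSymbol_of_bound (f := fun t a => Real.exp (max t 0 * a)) (M := 1) (by fun_prop)
      (continuousOn_sub_inv _ _) fun t r hr => ?_
    rw [abs_of_pos (Real.exp_pos _), Real.exp_le_one_iff]
    have : l ≤ r⁻¹ := (le_inv_comm₀ hr.1 h.pos).1 hr.2
    exact mul_nonpos_of_nonneg_of_nonpos (le_max_right _ _) (by linarith)
  have hc := h.continuous_symbolOp hF u₀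
  refine ⟨fun t => symbolOp R (F t) u₀, hc.continuousOn,
    h.symbolOp_one hF (fun r => by simp [F]) u₀, fun v t ht => ?_⟩
  have hFG : ∀ r ∈ Ioc 0 l⁻¹, ∀ s ∈ Ici (0 : ℝ),
      HasDerivWithinAt (fun s => r * F s r) ((l * r - 1) * F s r) (Ici 0) s := by
    intro r hr s hs
    have hr0 : r ≠ 0 := hr.1.ne'
    have h1 : HasDerivAt (fun s => r * Real.exp (s * (l - r⁻¹)))
        (r * (Real.exp (s * (l - r⁻¹)) * (1 * (l - r⁻¹)))) s :=
      (((hasDerivAt_id s).mul_const (l - r⁻¹)).exp).const_mul r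
    have h2 : ∀ s ∈ Ici (0 : ℝ), r * F s r = r * Real.exp (s * (l - r⁻¹)) := fun s hs => by
      simp only [F, max_eq_left (mem_Ici.1 hs)]
    refine (h1.hasDerivWithinAt.congr h2 (h2 s hs)).congr_deriv ?_
    simp only [F, max_eq_left (mem_Ici.1 hs)]
    field_simp
  have h1 := hasDerivWithinAt_add_integral (by fun_prop)
    (fun t ht => h.apply_symbolOp_eq hF hF ht hFG u₀) ht
  rw [← one_smul ℂ ((l : ℂ) • R (symbolOp R (F t) u₀) - symbolOp R (F t) u₀)] at h1
  simpa using h.firstOrder_weak h1 v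

/-- The unitary group, as `cos(t A) + i sin(t A)`. -/
theorem IsResolvent.exists_schrodinger (h : IsResolvent A l R) (u₀ : H) :
    ∃ u, IsSchrodingerSolution A u₀ u := by
  let C : ℝ → ℝ → ℝ := fun t r => Real.cos (t * (l - r⁻¹))
  let S : ℝ → ℝ → ℝ := fun t r => Real.sin (t * (l - r⁻¹))
  have hC : IsSymbol l⁻¹ C :=
    isSymbol_of_bound (f := fun t a => Real.cos (t * a)) (M := 1) (by fun_prop)
      (continuousOn_sub_inv _ _) fun t r hr => Real.abs_cos_le_one _
  have hS : IsSymbol l⁻¹ S :=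
    isSymbol_of_bound (f := fun t a => Real.sin (t * a)) (M := 1) (by fun_prop)
      (continuousOn_sub_inv _ _) fun t r hr => Real.abs_sin_le_one _
  have hS' : IsSymbol l⁻¹ fun t r => -S t r :=
    isSymbol_of_bound (f := fun t a => -Real.sin (t * a)) (M := 1) (by fun_prop)
      (continuousOn_sub_inv _ _) fun t r hr => by rw [abs_neg]; exact Real.abs_sin_le_one _
  have hneg : ∀ t x, symbolOp R (fun r => -S t r) x = -symbolOp R (S t) x := by
    intro t x
    have h1 := h.symbolOp_mul hS (q := fun _ => -1) continuous_const
      (hS.mul_left continuous_const) t x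
    have := h.isSelfAdjoint
    rw [cfc_const (-1 : ℝ) R] at h1
    simpa [Algebra.algebraMap_eq_smul_one] using h1
  have hcC := h.continuous_symbolOp hC u₀
  have hcS := h.continuous_symbolOp hS u₀
  refine ⟨fun t => symbolOp R (C t) u₀ + Complex.I • symbolOp R (S t) u₀, by fun_prop, ?_,
    fun v t ht => h.firstOrder_weak ?_ v⟩
  · simp only [h.symbolOp_one hC (t := 0) (fun r => by simp [C]) u₀,
      h.symbolOp_zero hS (t := 0) (fun r => by simp [S]) u₀, smul_zero, add_zero]
  have hin : ∀ r s : ℝ, HasDerivAt (fun s => s * (l - r⁻¹)) (1 * (l - r⁻¹)) s := fun r s =>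
    (hasDerivAt_id s).mul_const (l - r⁻¹)
  have h1 := hasDerivWithinAt_add_integral (by simp only [hneg]; fun_prop)
    (fun t ht => h.apply_symbolOp_eq hC hS' ht (fun r hr s _ => by
      have hr0 : r ≠ 0 := hr.1.ne'
      refine (((hin r s).cos).const_mul r).hasDerivWithinAt.congr_deriv ?_
      simp only [S]
      field_simp) u₀) ht
  have h2 := hasDerivWithinAt_add_integral (by fun_prop)
    (fun t ht => h.apply_symbolOp_eq hS hC ht (fun r hr s _ => by
      have hr0 : r ≠ 0 := hr.1.ne'
      refine (((hin r s).sin).const_mul r).hasDerivWithinAt.congr_deriv ?_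
      simp only [C]
      field_simp) u₀) ht
  simp only [map_add, map_smul]
  refine (h1.add (h2.const_smul Complex.I)).congr_deriv ?_
  simp only [hneg, map_neg, smul_add, smul_sub, smul_neg, smul_smul, Complex.I_mul_I, neg_smul,
    one_smul, mul_comm (l : ℂ) Complex.I]
  rw [← mul_assoc, Complex.I_mul_I, neg_one_mul, neg_smul]
  abel

/-- The solution `cos(t √(-A)) u₀ + ∫₀ᵗ cos(s √(-A)) u₁ ds` of the wave equation. -/
theorem IsResolvent.exists_wave (h : IsResolvent A l R) (u₀ u₁ : H) :
    ∃ u, IsWaveSolution A u₀ u₁ u := by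
  let C : ℝ → ℝ → ℝ := fun t r => Real.cos (t * √(r⁻¹ - l))
  -- the symbol of `R ∂ₜ cos(t √(-A))`
  let N : ℝ → ℝ → ℝ := fun t r => -(r * √(r⁻¹ - l) * Real.sin (t * √(r⁻¹ - l)))
  have hcont : ContinuousOn (fun r : ℝ => √(r⁻¹ - l)) (Ioc 0 l⁻¹) :=
    ((continuousOn_inv₀.mono fun _ hr => hr.1.ne').sub continuousOn_const).sqrt
  have hC : IsSymbol l⁻¹ C :=
    isSymbol_of_bound (f := fun t a => Real.cos (t * a)) (M := 1) (by fun_prop)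
      hcont fun t r hr => Real.abs_cos_le_one _
  have hsq : ∀ r ∈ Ioc 0 l⁻¹, √(r⁻¹ - l) * √(r⁻¹ - l) = r⁻¹ - l := fun r hr => by
    have : l ≤ r⁻¹ := (le_inv_comm₀ hr.1 h.pos).1 hr.2
    exact Real.mul_self_sqrt (by linarith)
  have hN : IsSymbol l⁻¹ N := by
    refine ⟨?_, fun T => ⟨√l⁻¹, fun t _ r hr => ?_⟩⟩
    · have h1 : ContinuousOn (fun p : ℝ × ℝ => √(p.2⁻¹ - l)) (univ ×ˢ Ioc 0 l⁻¹) :=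
        hcont.comp continuousOn_snd fun p hp => hp.2
      have h2 : ContinuousOn (fun p : ℝ × ℝ => Real.sin (p.1 * √(p.2⁻¹ - l)))
        (univ ×ˢ Ioc 0 l⁻¹) := Real.continuous_sin.comp_continuousOn (continuousOn_fst.mul h1)
      exact ((continuousOn_snd.mul h1).mul h2).neg
    · simp only [N]
      rw [abs_neg, abs_mul]
      have h1 : |r * √(r⁻¹ - l)| ≤ √l⁻¹ := by
        refine Real.abs_le_sqrt ?_
        have hr0 : r ≠ 0 := hr.1.ne'
        have : (r * √(r⁻¹ - l)) ^ 2 = r - l * r ^ 2 := by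
          rw [mul_pow, sq (√(r⁻¹ - l)), hsq r hr]
          field_simp
        rw [this]
        have := h.pos
        have : 0 ≤ l * r ^ 2 := by positivity
        linarith [hr.2]
      exact (mul_le_mul h1 (Real.abs_sin_le_one _) (abs_nonneg _) (Real.sqrt_nonneg _)).trans
        (by rw [mul_one])
  have hin : ∀ r s : ℝ, HasDerivAt (fun s => s * √(r⁻¹ - l)) (1 * √(r⁻¹ - l)) s := fun r s =>
    (hasDerivAt_id s).mul_const _
  have hCc : ∀ x, Continuous fun t => symbolOp R (C t) x := fun x => h.continuous_symbolOp hC x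
  have hNc : ∀ x, Continuous fun t => symbolOp R (N t) x := fun x => h.continuous_symbolOp hN x
  have hslice : ∀ {K : ℝ → ℝ → ℝ}, IsSymbol l⁻¹ K → ∀ r ∈ Ioc 0 l⁻¹, Continuous fun s => K s r :=
    fun hK r hr => hK.cont.comp_continuous (f := fun s => (s, r)) (by fun_prop)
      fun s => ⟨mem_univ _, hr⟩
  have hCint : ∀ x, ∀ t, 0 ≤ t → R (symbolOp R (C t) x) =
      R (symbolOp R (C 0) x) + ∫ s in (0 : ℝ)..t, symbolOp R (N s) x := by
    intro x t ht
    have h1 := h.symbolOp_eq_add_integral (hC.mul_left continuous_id) hN ht (fun r hr => ?_) x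
    · rw [← h.symbolOp_id_mul hC, ← h.symbolOp_id_mul hC]
      exact h1
    · have h2 := intervalIntegral.integral_eq_sub_of_hasDerivAt (a := 0) (b := t)
        (f := fun s => r * C s r) (f' := fun s => N s r)
        (fun s _ => (((hin r s).cos).const_mul r).congr_deriv (by simp only [N]; ring))
        ((hslice hN r hr).intervalIntegrable _ _)
      rw [h2]
      simp
  have hNint : ∀ x, ∀ t, 0 ≤ t → symbolOp R (N t) x = symbolOp R (N 0) x +
      ∫ s in (0 : ℝ)..t, ((l : ℂ) • R (symbolOp R (C s) x) - symbolOp R (C s) x) := by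
    intro x t ht
    have hq : Continuous fun r : ℝ => l * r - 1 := by fun_prop
    have h1 := h.symbolOp_eq_add_integral hN (hC.mul_left hq) ht (fun r hr => ?_) x
    · simpa only [h.symbolOp_sub_mul hC] using h1
    · have hr0 : r ≠ 0 := hr.1.ne'
      have h2 := intervalIntegral.integral_eq_sub_of_hasDerivAt (a := 0) (b := t)
        (f := fun s => N s r) (f' := fun s => (l * r - 1) * C s r)
        (fun s _ => ((((hin r s).sin).const_mul (r * √(r⁻¹ - l))).neg).congr_deriv (by
          simp only [C]
          have h3 : r * √(r⁻¹ - l) * (Real.cos (s * √(r⁻¹ - l)) * (1 * √(r⁻¹ - l))) =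
            r * (√(r⁻¹ - l) * √(r⁻¹ - l)) * Real.cos (s * √(r⁻¹ - l)) := by ring
          rw [h3, hsq r hr]
          field_simp
          ring))
        ((hslice (hC.mul_left hq) r hr).intervalIntegrable _ _)
      rw [h2]
      simp
  have hN0 : ∀ x, symbolOp R (N 0) x = 0 := h.symbolOp_zero hN fun r => by simp [N]
  have hC0 : ∀ x, symbolOp R (C 0) x = x := h.symbolOp_one hC fun r => by simp [C]
  have hII : ∀ t, ∫ s in (0 : ℝ)..t, ((l : ℂ) • R (symbolOp R (C s) u₁) - symbolOp R (C s) u₁) =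
      (l : ℂ) • R (∫ s in (0 : ℝ)..t, symbolOp R (C s) u₁) -
        ∫ s in (0 : ℝ)..t, symbolOp R (C s) u₁ := by
    intro t
    have hi := (hCc u₁).intervalIntegrable (μ := volume) 0 t
    rw [intervalIntegral.integral_sub (by
      exact (by fun_prop : Continuous fun s =>
        (l : ℂ) • R (symbolOp R (C s) u₁)).intervalIntegrable _ _) hi,
      intervalIntegral.integral_smul]
    congr 2
    exact R.intervalIntegral_comp_comm hi
  have hID : ∀ t, HasDerivAt (fun t => ∫ s in (0 : ℝ)..t, symbolOp R (C s) u₁)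
      (symbolOp R (C t) u₁) t := fun t =>
    intervalIntegral.integral_hasDerivAt_right ((hCc u₁).intervalIntegrable 0 t)
      ((hCc u₁).stronglyMeasurableAtFilter _ _) (hCc u₁).continuousAt
  have hIc : Continuous fun t => ∫ s in (0 : ℝ)..t, symbolOp R (C s) u₁ :=
    continuous_iff_continuousAt.2 fun t => (hID t).continuousAt
  refine ⟨fun t => symbolOp R (C t) u₀ + ∫ s in (0 : ℝ)..t, symbolOp R (C s) u₁,
    ((hCc u₀).add hIc).continuousOn, by simp [hC0], fun v => ?_⟩
  obtain ⟨y, hy1, hy2⟩ := h.exists_preimage v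
  refine ⟨fun t => ⟪y, symbolOp R (N t) u₀ + R (symbolOp R (C t) u₁)⟫_ℂ, ?_, fun t ht => ⟨?_, ?_⟩⟩
  · simp only [hN0, hC0, zero_add, hy1, h.symm]
  · have h1 := hasDerivWithinAt_add_integral (hNc u₀) (hCint u₀) ht
    have h2 := ((R.hasFDerivAt.restrictScalars ℝ).comp_hasDerivAt t (hID t)).hasDerivWithinAt
      (s := Ici 0)
    have h3 := ((innerSL ℂ y).hasFDerivAt.restrictScalars ℝ).comp_hasDerivWithinAt t (h1.add h2)
    simp only [hy1, h.symm, map_add]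
    exact h3
  · have h1 := hasDerivWithinAt_add_integral (by
      have := hCc u₀
      fun_prop) (hNint u₀) ht
    have h2 := hasDerivWithinAt_add_integral (hNc u₁) (hCint u₁) ht
    have h3 := ((innerSL ℂ y).hasFDerivAt.restrictScalars ℝ).comp_hasDerivWithinAt t (h1.add h2)
    refine h3.congr_deriv ?_
    rw [hNint u₁ t ht, hN0, zero_add, hII, hy2, h.inner_apply]
    simp only [ContinuousLinearMap.coe_restrictScalars', innerSL_apply_apply]
    congr 1
    simp only [map_add, smul_add]
    abel

end Evolution

/-! ### Distributions on an interval and the Hardy inequality -/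

section Interval

/-- Real test functions on an open subset of the line. -/
structure IsTest (J : Set ℝ) (h : ℝ → ℝ) : Prop where
  smooth : ContDiff ℝ ∞ h
  compact : HasCompactSupport h
  subset : tsupport h ⊆ J

variable {J : Set ℝ} {h : ℝ → ℝ}

lemma IsTest.deriv (hh : IsTest J h) : IsTest J (deriv h) :=
  ⟨(contDiff_infty_iff_deriv.1 hh.smooth).2, hh.compact.deriv,
    tsupport_deriv_subset.trans hh.subset⟩

lemma IsTest.continuous (hh : IsTest J h) : Continuous h := hh.smooth.continuous

lemma IsTest.hasDerivAt (hh : IsTest J h) (x : ℝ) : HasDerivAt h (_root_.deriv h x) x :=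
  ((hh.smooth.differentiable (by simp)) x).hasDerivAt

lemma IsTest.integrable (hh : IsTest J h) : Integrable h :=
  hh.continuous.integrable_of_hasCompactSupport hh.compact

lemma IsTest.sub_smul {k : ℝ → ℝ} (hh : IsTest J h) (hk : IsTest J k) (c : ℝ) :
    IsTest J fun x => h x - c * k x := by
  have h1 : tsupport (fun x => c * k x) ⊆ tsupport k :=
    closure_mono fun x hx => right_ne_zero_of_mul hx
  refine ⟨hh.smooth.sub (contDiff_const.mul hk.smooth),
    hh.compact.sub (hk.compact.mul_left (f := fun _ => c)), ?_⟩
  exact (tsupport_sub h fun x => c * k x).trans (union_subset hh.subset (h1.trans hk.subset))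

lemma exists_Ioo_superset (hJ : IsOpen J) {K : Set ℝ} (hK : IsCompact K)
    (hKJ : K ⊆ J) {c : ℝ} (hc : c ∈ J) :
    ∃ a ∈ J, ∃ b ∈ J, a < c ∧ c < b ∧ K ⊆ Ioo a b := by
  have hK' : IsCompact (insert c K) := hK.insert c
  have hne : (insert c K).Nonempty := insert_nonempty _ _
  have hsub : insert c K ⊆ J := insert_subset hc hKJ
  obtain ⟨a, ha1, ha2⟩ := exists_Ioc_subset_of_mem_nhds (hJ.mem_nhds (hsub (hK'.sInf_mem hne)))
    (exists_lt _)
  obtain ⟨b, hb1, hb2⟩ := exists_Ico_subset_of_mem_nhds (hJ.mem_nhds (hsub (hK'.sSup_mem hne)))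
    (exists_gt _)
  obtain ⟨a', ha'1, ha'2⟩ := exists_between ha1
  obtain ⟨b', hb'1, hb'2⟩ := exists_between hb1
  have hlow : ∀ x ∈ insert c K, a' < x := fun x hx => ha'2.trans_le (csInf_le hK'.bddBelow hx)
  have hup : ∀ x ∈ insert c K, x < b' := fun x hx => (le_csSup hK'.bddAbove hx).trans_lt hb'1
  exact ⟨a', ha2 ⟨ha'1, ha'2.le⟩, b', hb2 ⟨hb'1.le, hb'2⟩, hlow c (mem_insert _ _),
    hup c (mem_insert _ _), fun x hx => ⟨hlow x (mem_insert_of_mem _ hx),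
      hup x (mem_insert_of_mem _ hx)⟩⟩

lemma integral_eq_intervalIntegral_of_support {E : Type*} [NormedAddCommGroup E]
    [NormedSpace ℝ E] {f : ℝ → E} {a b : ℝ} (hab : a ≤ b)
    (hf : ∀ x, x ∉ Ioo a b → f x = 0) : ∫ x, f x = ∫ x in a..b, f x := by
  rw [intervalIntegral.integral_of_le hab]
  refine (setIntegral_eq_integral_of_forall_compl_eq_zero fun x hx => hf x fun h => hx ?_).symm
  exact Ioo_subset_Ioc_self h

lemma IsTest.exists_primitive (hJ : IsOpen J) (hJ' : J.OrdConnected) {c : ℝ} (hc : c ∈ J)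
    (hh : IsTest J h) (h0 : ∫ x, h x = 0) : ∃ k, IsTest J k ∧ _root_.deriv k = h := by
  obtain ⟨a, ha, b, hb, hac, hcb, hab⟩ := exists_Ioo_superset hJ hh.compact hh.subset hc
  have hz : ∀ x, x ∉ Ioo a b → h x = 0 := fun x hx =>
    image_eq_zero_of_notMem_tsupport fun h => hx (hab h)
  have hd : ∀ x, HasDerivAt (fun x => ∫ s in a..x, h s) (h x) x := fun x =>
    intervalIntegral.integral_hasDerivAt_right (hh.continuous.intervalIntegrable _ _)
      (hh.continuous.stronglyMeasurableAtFilter _ _) hh.continuous.continuousAt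
  have hd' : _root_.deriv (fun x => ∫ s in a..x, h s) = h := funext fun x => (hd x).deriv
  have hint : ∫ s in a..b, h s = 0 := by
    rw [← integral_eq_intervalIntegral_of_support (hac.trans hcb).le hz, h0]
  have hsupp : Function.support (fun x => ∫ s in a..x, h s) ⊆ Icc a b := by
    intro x hx
    by_contra hx'
    refine hx ?_
    rcases lt_or_ge x a with h1 | h1
    · refine intervalIntegral.integral_zero_ae (Eventually.of_forall fun s hs => hz s fun h2 => ?_)
      rw [uIoc_of_ge h1.le] at hs
      exact absurd h2.1 (not_lt.2 hs.2)
    · have h2 : b < x := by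
        by_contra h2
        exact hx' ⟨h1, not_lt.1 h2⟩
      change ∫ s in a..x, h s = 0
      rw [← intervalIntegral.integral_add_adjacent_intervals
        (hh.continuous.intervalIntegrable a b) (hh.continuous.intervalIntegrable b x), hint,
        zero_add]
      refine intervalIntegral.integral_zero_ae (Eventually.of_forall fun s hs => hz s fun h3 => ?_)
      rw [uIoc_of_le h2.le] at hs
      exact absurd h3.2 (not_lt.2 hs.1.le)
  have hts : tsupport (fun x => ∫ s in a..x, h s) ⊆ Icc a b := closure_minimal hsupp isClosed_Icc
  refine ⟨_, ⟨?_, HasCompactSupport.of_support_subset_isCompact isCompact_Icc hsupp,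
    hts.trans (hJ'.out ha hb)⟩, hd'⟩
  rw [contDiff_infty_iff_deriv, hd']
  exact ⟨fun x => (hd x).differentiableAt, hh.smooth⟩

lemma exists_isTest_integral_eq_one (hJ : IsOpen J) {c : ℝ} (hc : c ∈ J) :
    ∃ k, IsTest J k ∧ ∫ x, k x = 1 := by
  obtain ⟨r, hr, hr'⟩ := Metric.nhds_basis_closedBall.mem_iff.1 (hJ.mem_nhds hc)
  let φ : ContDiffBump c := ⟨r / 2, r, by linarith, by linarith⟩
  refine ⟨φ.normed volume, ⟨φ.contDiff_normed, φ.hasCompactSupport_normed, ?_⟩, φ.integral_normed⟩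
  rw [φ.tsupport_normed_eq]
  exact hr'

lemma integrable_test_mul {p : ℝ → ℝ} (hp : LocallyIntegrableOn p J) (hh : Continuous h)
    (hc : HasCompactSupport h) (hs : tsupport h ⊆ J) : Integrable fun x => h x * p x := by
  have h1 : IntegrableOn (fun x => h x * p x) (tsupport h) :=
    (hp.integrableOn_compact_subset hs hc).continuousOn_mul hh.continuousOn hc
  refine (integrableOn_iff_integrable_of_support_subset fun x hx => ?_).1 h1
  exact subset_tsupport h (left_ne_zero_of_mul hx)

/-- A distribution on an interval with vanishing derivative is constant. -/
lemma ae_eq_const_of_integral_deriv_mul (hJ : IsOpen J) (hJ' : J.OrdConnected)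
    (hne : J.Nonempty) {p : ℝ → ℝ} (hp : LocallyIntegrableOn p J)
    (hw : ∀ h, IsTest J h → ∫ x, deriv h x * p x = 0) :
    ∃ a, ∀ᵐ x, x ∈ J → p x = a := by
  obtain ⟨c, hc⟩ := hne
  obtain ⟨θ, hθ, hθ1⟩ := exists_isTest_integral_eq_one hJ hc
  refine ⟨∫ x, θ x * p x, ?_⟩
  have h1 : LocallyIntegrableOn (fun x => p x - ∫ x, θ x * p x) J :=
    hp.sub ((locallyIntegrable_const _).locallyIntegrableOn _)
  have h2 := hJ.ae_eq_zero_of_integral_contDiff_smul_eq_zero (μ := volume) h1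
    fun h hs hc' hJs => ?_
  · filter_upwards [h2] with x hx hxJ
    exact sub_eq_zero.1 (hx hxJ)
  have hh : IsTest J h := ⟨hs, hc', hJs⟩
  have hI := hθ.integrable.const_mul (∫ x, h x)
  obtain ⟨k, hk, hk'⟩ := (hh.sub_smul hθ (∫ x, h x)).exists_primitive hJ hJ' hc (by
    rw [integral_sub hh.integrable hI, integral_const_mul, hθ1, mul_one, sub_self])
  have h3 := hw k hk
  have i1 := integrable_test_mul hp hh.continuous hh.compact hh.subset
  have i2 := (integrable_test_mul hp hθ.continuous hθ.compact hθ.subset).const_mul (∫ x, h x)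
  rw [hk'] at h3
  have h4 : ∫ x, (h x - (∫ x, h x) * θ x) * p x =
      (∫ x, h x * p x) - (∫ x, h x) * ∫ x, θ x * p x := by
    rw [← integral_const_mul, ← integral_sub i1 i2]
    exact integral_congr_ae (Eventually.of_forall fun x => by ring)
  rw [h4] at h3
  simp only [smul_eq_mul, mul_sub]
  rw [integral_sub i1 (hh.integrable.mul_const _), integral_mul_const]
  exact h3

/-- A distribution on an interval with vanishing second derivative is affine. -/
lemma ae_eq_affine_of_integral_deriv_deriv_mul (hJ : IsOpen J) (hJ' : J.OrdConnected)
    (hne : J.Nonempty) {p : ℝ → ℝ} (hp : LocallyIntegrableOn p J)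
    (hw : ∀ h, IsTest J h → ∫ x, deriv (deriv h) x * p x = 0) :
    ∃ a b, ∀ᵐ x, x ∈ J → p x = a + b * x := by
  obtain ⟨c, hc⟩ := hne
  obtain ⟨θ, hθ, hθ1⟩ := exists_isTest_integral_eq_one hJ hc
  set b := -∫ x, deriv θ x * p x with hb
  have hlin : LocallyIntegrableOn (fun x : ℝ => b * x) J :=
    (by fun_prop : Continuous fun x : ℝ => b * x).locallyIntegrable.locallyIntegrableOn _
  have key : ∀ h, IsTest J h → ∫ x, deriv h x * (p - fun x => b * x) x = 0 := by
    intro h hh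
    have hI := hθ.integrable.const_mul (∫ x, h x)
    obtain ⟨k, hk, hk'⟩ := (hh.sub_smul hθ (∫ x, h x)).exists_primitive hJ hJ' hc (by
      rw [integral_sub hh.integrable hI, integral_const_mul, hθ1, mul_one, sub_self])
    have h3 := hw k hk
    have hd : deriv (deriv k) = fun x => deriv h x - (∫ x, h x) * deriv θ x := by
      rw [hk']
      funext x
      exact ((hh.hasDerivAt x).sub ((hθ.hasDerivAt x).const_mul _)).deriv
    have hh' := hh.deriv
    have hθ' := hθ.deriv
    have i1 := integrable_test_mul hp hh'.continuous hh'.compact hh'.subset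
    have i2 := (integrable_test_mul hp hθ'.continuous hθ'.compact hθ'.subset).const_mul (∫ x, h x)
    have i3 := integrable_test_mul hlin hh'.continuous hh'.compact hh'.subset
    have h4 : ∫ x, (deriv h x - (∫ x, h x) * deriv θ x) * p x =
        (∫ x, deriv h x * p x) - (∫ x, h x) * ∫ x, deriv θ x * p x := by
      rw [← integral_const_mul, ← integral_sub i1 i2]
      exact integral_congr_ae (Eventually.of_forall fun x => by ring)
    rw [hd, h4] at h3
    -- integration by parts against the linear function
    have h5 : ∫ x, deriv h x * (b * x) = -(b * ∫ x, h x) := by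
      have h6 := integral_mul_deriv_eq_deriv_mul_of_integrable (u := fun x => b * x) (v := h)
        (u' := fun _ => b) (v' := deriv h) (fun x _ => by simpa using (hasDerivAt_id x).const_mul b)
        (fun x _ => hh.hasDerivAt x) ?_ (hh.integrable.const_mul b) ?_
      · rw [integral_const_mul] at h6
        rw [← h6]
        exact integral_congr_ae (Eventually.of_forall fun x => mul_comm _ _)
      · exact i3.congr (Eventually.of_forall fun x => mul_comm _ _)
      · refine (Continuous.integrable_of_hasCompactSupport (by
          have := hh.continuous
          fun_prop) (hh.compact.mul_left))
    simp only [Pi.sub_apply, mul_sub]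
    rw [integral_sub i1 i3, h5]
    rw [sub_eq_zero] at h3
    rw [h3, hb]
    ring
  obtain ⟨a, ha⟩ := ae_eq_const_of_integral_deriv_mul hJ hJ' ⟨c, hc⟩ (hp.sub hlin) key
  refine ⟨a, b, ?_⟩
  filter_upwards [ha] with x hx hxJ
  have := hx hxJ
  simp only [Pi.sub_apply] at this
  linarith

/-- Integration by parts against the primitive of an integrable function. -/
lemma integral_deriv_mul_primitive {a b c : ℝ} (hab : a < b) (hc : c ∈ Icc a b) {g K K' : ℝ → ℝ}
    (hg : IntervalIntegrable g volume a b)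
    (hK : ∀ x ∈ Icc a b, HasDerivAt K (K' x) x) (hK' : ContinuousOn K' (Icc a b))
    (ha : K a = 0) (hb : K b = 0) :
    ∫ x in a..b, K' x * ∫ s in c..x, g s = -∫ x in a..b, K x * g x := by
  have hI := uIcc_of_le hab.le
  have hKi : ∀ x ∈ Icc a b, K x = ∫ s in a..x, K' s := by
    intro x hx
    rw [intervalIntegral.integral_eq_sub_of_hasDerivAt (f := K), ha, sub_zero]
    · intro s hs
      rw [uIcc_of_le hx.1] at hs
      exact hK s ⟨hs.1, hs.2.trans hx.2⟩
    · exact (hK'.mono (Icc_subset_Icc_right hx.2)).intervalIntegrable_of_Icc hx.1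
  have hac1 : AbsolutelyContinuousOnInterval (fun x => ∫ s in c..x, g s) a b :=
    hg.absolutelyContinuousOnInterval_intervalIntegral (by rwa [hI])
  have hac2 : AbsolutelyContinuousOnInterval (fun x => ∫ s in a..x, K' s) a b :=
    (hK'.intervalIntegrable_of_Icc hab.le).absolutelyContinuousOnInterval_intervalIntegral
      left_mem_uIcc
  have h1 := hac1.integral_mul_deriv_eq_deriv_mul hac2
  have e1 : ∫ x in a..b, (∫ s in c..x, g s) * deriv (fun x => ∫ s in a..x, K' s) x =
      ∫ x in a..b, K' x * ∫ s in c..x, g s := by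
    refine intervalIntegral.integral_congr_ae ?_
    filter_upwards [(hK'.intervalIntegrable_of_Icc hab.le).ae_hasDerivAt_integral] with x hx hx'
    rw [uIoc_of_le hab.le] at hx'
    have hx2 : x ∈ uIcc a b := by rw [hI]; exact Ioc_subset_Icc_self hx'
    rw [(hx hx2 a left_mem_uIcc).deriv, mul_comm]
  have e2 : ∫ x in a..b, deriv (fun x => ∫ s in c..x, g s) x * (∫ s in a..x, K' s) =
      ∫ x in a..b, K x * g x := by
    refine intervalIntegral.integral_congr_ae ?_
    filter_upwards [hg.ae_hasDerivAt_integral] with x hx hx'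
    rw [uIoc_of_le hab.le] at hx'
    have hx2 : x ∈ uIcc a b := by rw [hI]; exact Ioc_subset_Icc_self hx'
    rw [(hx hx2 c (by rwa [hI])).deriv, ← hKi x (Ioc_subset_Icc_self hx'), mul_comm]
  rw [e1, e2, ← hKi b ⟨hab.le, le_rfl⟩, ← hKi a ⟨le_rfl, hab.le⟩, ha, hb] at h1
  linarith

/-- Hardy's inequality on an interval that avoids `0`. -/
lemma hardy_inequality {a b : ℝ} (hab : a < b) (h0 : (0 : ℝ) ∉ Icc a b) {q q' : ℝ → ℝ}
    (hq : ∀ x ∈ Icc a b, HasDerivAt q (q' x) x) (hq' : ContinuousOn q' (Icc a b))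
    (ha : q a = 0) (hb : q b = 0) :
    0 ≤ ∫ x in a..b, (q' x ^ 2 - q x ^ 2 / (4 * x ^ 2)) := by
  have hx0 : ∀ x ∈ Icc a b, x ≠ 0 := fun x hx h => h0 (h ▸ hx)
  have hqc : ContinuousOn q (Icc a b) := fun x hx => (hq x hx).continuousAt.continuousWithinAt
  set D : ℝ → ℝ := fun x => q x * q' x / x - q x ^ 2 / (2 * x ^ 2)
  have hx1 : ContinuousOn (fun x : ℝ => x) (Icc a b) := continuousOn_id
  have hDc : ContinuousOn D (Icc a b) := by
    refine ((hqc.mul hq').div hx1 hx0).sub ((hqc.pow 2).div (by fun_prop) fun x hx => ?_)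
    have := hx0 x hx
    positivity
  have hD : ∀ x ∈ uIcc a b, HasDerivAt (fun x => q x ^ 2 / (2 * x)) (D x) x := by
    intro x hx
    rw [uIcc_of_le hab.le] at hx
    have hne := hx0 x hx
    have h2 : HasDerivAt (fun x : ℝ => 2 * x) (2 * 1) x := (hasDerivAt_id x).const_mul 2
    refine (((hq x hx).pow 2).div h2 (by simpa using hne)).congr_deriv ?_
    simp only [D, Pi.pow_apply]
    field_simp
    ring
  have hDi : IntervalIntegrable D volume a b := hDc.intervalIntegrable_of_Icc hab.le
  have h1 : ∫ x in a..b, D x = 0 := by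
    rw [intervalIntegral.integral_eq_sub_of_hasDerivAt hD hDi, ha, hb]
    simp
  have hSc : ContinuousOn (fun x => (q' x - q x / (2 * x)) ^ 2) (Icc a b) :=
    (hq'.sub (hqc.div (by fun_prop) fun x hx => by simpa using hx0 x hx)).pow 2
  have h2 : ∫ x in a..b, (q' x ^ 2 - q x ^ 2 / (4 * x ^ 2)) =
      (∫ x in a..b, (q' x - q x / (2 * x)) ^ 2) + ∫ x in a..b, D x := by
    rw [← intervalIntegral.integral_add (hSc.intervalIntegrable_of_Icc hab.le) hDi]
    refine intervalIntegral.integral_congr fun x hx => ?_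
    rw [uIcc_of_le hab.le] at hx
    have hne := hx0 x hx
    simp only [D]
    field_simp
    ring
  rw [h2, h1, add_zero]
  exact intervalIntegral.integral_nonneg hab.le fun x _ => sq_nonneg _

/-- If `-p'' = g` in the sense of distributions on an interval that avoids `0`, then
`∫ f² p² / (4 x²) ≤ ∫ |(f p)'|² = ∫ f'² p² + ∫ f² g p` for every test function `f`. Only `p` and `g`
appear in the conclusion, so that no differentiability of `p` is needed to apply it. -/
theorem weak_hardy (hJ : IsOpen J) (hJ' : J.OrdConnected) (h0 : (0 : ℝ) ∉ J) (hne : J.Nonempty)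
    {p g : ℝ → ℝ} (hp : LocallyIntegrableOn p J) (hg : LocallyIntegrableOn g J)
    (hw : ∀ h, IsTest J h → ∫ x, (deriv (deriv h) x * p x + h x * g x) = 0)
    {f : ℝ → ℝ} (hf : IsTest J f) :
    0 ≤ ∫ x, (deriv f x ^ 2 * p x ^ 2 + f x ^ 2 * (g x * p x) -
      f x ^ 2 * p x ^ 2 / (4 * x ^ 2)) := by
  obtain ⟨c, hc⟩ := hne
  have hgi : ∀ a ∈ J, ∀ b ∈ J, IntervalIntegrable g volume a b := fun a ha b hb =>
    (hg.integrableOn_compact_subset (hJ'.uIcc_subset ha hb) isCompact_uIcc).intervalIntegrable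
  set G : ℝ → ℝ := fun x => ∫ s in c..x, g s with hG
  have hGc : ∀ a ∈ J, ∀ b ∈ J, a ≤ c → c ≤ b → ContinuousOn G (Icc a b) := by
    intro a ha b hb hac hcb
    have := (hgi a ha b hb).absolutelyContinuousOnInterval_intervalIntegral (c := c)
      (by rw [uIcc_of_le (hac.trans hcb)]; exact ⟨hac, hcb⟩)
    have h1 := this.continuousOn
    rwa [uIcc_of_le (hac.trans hcb)] at h1
  have hGat : ∀ x ∈ J, ContinuousAt G x := by
    intro x hx
    obtain ⟨a, ha, b, hb, hac, hcb, hab⟩ := exists_Ioo_superset hJ (isCompact_singleton (x := x))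
      (singleton_subset_iff.2 hx) hc
    exact (hGc a ha b hb hac.le hcb.le).continuousAt
      (Icc_mem_nhds (hab rfl).1 (hab rfl).2)
  have hGJ : ContinuousOn G J := fun x hx => (hGat x hx).continuousWithinAt
  set GG : ℝ → ℝ := fun x => ∫ s in c..x, G s with hGG
  have hGGd : ∀ x ∈ J, HasDerivAt GG (G x) x := by
    intro x hx
    refine intervalIntegral.integral_hasDerivAt_right
      ((hGJ.mono (hJ'.uIcc_subset hc hx)).intervalIntegrable) ?_ (hGat x hx)
    exact hGJ.stronglyMeasurableAtFilter hJ x hx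
  have hGGJ : ContinuousOn GG J := fun x hx => (hGGd x hx).continuousAt.continuousWithinAt
  have hlGG : LocallyIntegrableOn GG J := hGGJ.locallyIntegrableOn hJ.measurableSet
  -- the second primitive `-GG` of `-g` differs from `p` by an affine function
  obtain ⟨a₀, b₀, hab₀⟩ := ae_eq_affine_of_integral_deriv_deriv_mul hJ hJ' ⟨c, hc⟩ (hp.add hlGG)
    fun h hh => by
      have hh1 := hh.deriv
      have hh2 := hh1.deriv
      have i1 := integrable_test_mul hp hh2.continuous hh2.compact hh2.subset
      have i2 := integrable_test_mul hlGG hh2.continuous hh2.compact hh2.subset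
      have i3 := integrable_test_mul hg hh.continuous hh.compact hh.subset
      have h1 := hw h hh
      rw [integral_add i1 i3] at h1
      simp only [Pi.add_apply, mul_add]
      rw [integral_add i1 i2]
      obtain ⟨a, ha, b, hb, hac, hcb, hab⟩ := exists_Ioo_superset hJ hh.compact hh.subset hc
      have hlt := hac.trans hcb
      have hcm : c ∈ Icc a b := ⟨hac.le, hcb.le⟩
      have hz0 : ∀ x, x ∉ Ioo a b → h x = 0 := fun x hx =>
        image_eq_zero_of_notMem_tsupport fun h => hx (hab h)
      have hz1 : ∀ x, x ∉ Ioo a b → deriv h x = 0 := fun x hx =>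
        image_eq_zero_of_notMem_tsupport fun h => hx (hab (tsupport_deriv_subset h))
      have hz2 : ∀ x, x ∉ Ioo a b → deriv (deriv h) x = 0 := fun x hx =>
        image_eq_zero_of_notMem_tsupport fun h => hx (hab (tsupport_deriv_subset
          (tsupport_deriv_subset h)))
      have e1 := integral_deriv_mul_primitive hlt hcm (hgi a ha b hb)
        (fun x _ => hh.hasDerivAt x) hh1.continuous.continuousOn (hz0 a (by simp)) (hz0 b (by simp))
      have e2 := integral_deriv_mul_primitive hlt hcm (g := G)
        ((hGc a ha b hb hac.le hcb.le).intervalIntegrable_of_Icc hlt.le)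
        (fun x _ => hh1.hasDerivAt x) hh2.continuous.continuousOn (hz1 a (by simp))
        (hz1 b (by simp))
      rw [integral_eq_intervalIntegral_of_support (f := fun x => deriv (deriv h) x * GG x) hlt.le
        fun x hx => by rw [hz2 x hx, zero_mul], e2, e1, neg_neg,
        ← integral_eq_intervalIntegral_of_support hlt.le fun x hx => by rw [hz0 x hx, zero_mul]]
      exact h1
  set P : ℝ → ℝ := fun x => a₀ + b₀ * x - GG x with hP
  have hpP : ∀ᵐ x, x ∈ J → p x = P x := by
    filter_upwards [hab₀] with x hx hxJ
    have := hx hxJ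
    simp only [Pi.add_apply] at this
    simp only [hP]
    linarith
  have hPd : ∀ x ∈ J, HasDerivAt P (b₀ - G x) x := fun x hx => by
    have h1 : HasDerivAt (fun x => a₀ + b₀ * x) (b₀ * 1) x :=
      ((hasDerivAt_id x).const_mul b₀).const_add a₀
    exact (h1.sub (hGGd x hx)).congr_deriv (by ring)
  obtain ⟨a, ha, b, hb, hac, hcb, hab⟩ := exists_Ioo_superset hJ hf.compact hf.subset hc
  have hlt := hac.trans hcb
  have hsub : Icc a b ⊆ J := hJ'.out ha hb
  have hz0 : ∀ x, x ∉ Ioo a b → f x = 0 := fun x hx =>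
    image_eq_zero_of_notMem_tsupport fun h => hx (hab h)
  have hz1 : ∀ x, x ∉ Ioo a b → deriv f x = 0 := fun x hx =>
    image_eq_zero_of_notMem_tsupport fun h => hx (hab (tsupport_deriv_subset h))
  have hGcI := hGc a ha b hb hac.le hcb.le
  have hPcI : ContinuousOn P (Icc a b) := fun x hx =>
    (hPd x (hsub hx)).continuousAt.continuousWithinAt
  have hfc := hf.continuous
  have hfc' := hf.deriv.continuous
  set K : ℝ → ℝ := fun x => f x ^ 2 * P x with hK
  set K' : ℝ → ℝ := fun x => 2 * f x * deriv f x * P x + f x ^ 2 * (b₀ - G x) with hK'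
  have hKd : ∀ x ∈ Icc a b, HasDerivAt K (K' x) x := fun x hx => by
    refine (((hf.hasDerivAt x).pow 2).mul (hPd x (hsub hx))).congr_deriv ?_
    simp only [hK', Pi.pow_apply]
    ring
  have hK'c : ContinuousOn K' (Icc a b) := by fun_prop
  have hKa : K a = 0 := by simp [hK, hz0 a]
  have hKb : K b = 0 := by simp [hK, hz0 b]
  have e1 := integral_deriv_mul_primitive hlt ⟨hac.le, hcb.le⟩ (hgi a ha b hb) hKd hK'c hKa hKb
  have e2 : ∫ x in a..b, K' x = 0 := by
    rw [intervalIntegral.integral_eq_sub_of_hasDerivAt (f := K), hKa, hKb, sub_zero]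
    · intro x hx
      rw [uIcc_of_le hlt.le] at hx
      exact hKd x hx
    · exact hK'c.intervalIntegrable_of_Icc hlt.le
  have e3 := hardy_inequality hlt (fun h => h0 (hsub h)) (q := fun x => f x * P x)
    (q' := fun x => deriv f x * P x + f x * (b₀ - G x))
    (fun x hx => (hf.hasDerivAt x).mul (hPd x (hsub hx))) (by fun_prop)
    (by simp [hz0 a]) (by simp [hz0 b])
  rw [integral_eq_intervalIntegral_of_support hlt.le
    fun x hx => by rw [hz0 x hx, hz1 x hx]; simp]
  refine e3.trans (le_of_eq ?_)
  have hx0 : ∀ x ∈ Icc a b, 4 * x ^ 2 ≠ 0 := fun x hx => by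
    have : x ≠ 0 := fun h => h0 (h ▸ hsub hx)
    positivity
  have c1 : ContinuousOn (fun x => deriv f x ^ 2 * P x ^ 2 - f x ^ 2 * P x ^ 2 / (4 * x ^ 2))
      (Icc a b) := by
    refine ContinuousOn.sub (by fun_prop) (ContinuousOn.div (by fun_prop) (by fun_prop) hx0)
  have i1 := c1.intervalIntegrable_of_Icc (μ := volume) hlt.le
  have i2 : IntervalIntegrable (fun x => K x * g x) volume a b :=
    (hgi a ha b hb).continuousOn_mul (by
      rw [uIcc_of_le hlt.le]
      exact fun x hx => (hKd x hx).continuousAt.continuousWithinAt)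
  have i3 : IntervalIntegrable (fun x => K' x * G x) volume a b :=
    (hK'c.mul hGcI).intervalIntegrable_of_Icc hlt.le
  have i4 : IntervalIntegrable (fun x => b₀ * K' x) volume a b :=
    (continuousOn_const.mul hK'c).intervalIntegrable_of_Icc hlt.le
  have e4 : ∫ x in a..b, (deriv f x ^ 2 * p x ^ 2 + f x ^ 2 * (g x * p x) -
        f x ^ 2 * p x ^ 2 / (4 * x ^ 2)) =
      (∫ x in a..b, (deriv f x ^ 2 * P x ^ 2 - f x ^ 2 * P x ^ 2 / (4 * x ^ 2))) +
        ∫ x in a..b, K x * g x := by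
    rw [← intervalIntegral.integral_add i1 i2]
    refine intervalIntegral.integral_congr_ae ?_
    filter_upwards [hpP] with x hx hx'
    rw [uIoc_of_le hlt.le] at hx'
    rw [hx (hsub (Ioc_subset_Icc_self hx'))]
    simp only [hK]
    ring
  have e5 : ∫ x in a..b, ((deriv f x * P x + f x * (b₀ - G x)) ^ 2 -
        (f x * P x) ^ 2 / (4 * x ^ 2)) =
      (∫ x in a..b, (deriv f x ^ 2 * P x ^ 2 - f x ^ 2 * P x ^ 2 / (4 * x ^ 2))) +
        ((∫ x in a..b, b₀ * K' x) - ∫ x in a..b, K' x * G x) := by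
    rw [← intervalIntegral.integral_sub i4 i3, ← intervalIntegral.integral_add i1 (i4.sub i3)]
    refine intervalIntegral.integral_congr fun x _ => ?_
    simp only [hK']
    ring
  have e6 : ∫ x in a..b, K' x * G x = -∫ x in a..b, K x * g x := e1
  rw [e4, e5, intervalIntegral.integral_const_mul, e2, e6]
  ring

end Interval

/-! ### Fourier series in the angular variable -/

section Fourier

open AddCircle (haarAddCircle)
open scoped ComplexConjugate

lemma norm_toLp_eq_sqrt {X : Type*} [MeasurableSpace X] {μ : Measure X} {f : X → ℂ}
    (hf : MemLp f 2 μ) : ‖hf.toLp f‖ = √(∫ x, ‖f x‖ ^ 2 ∂μ) := by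
  rw [← Real.sqrt_sq (norm_nonneg (hf.toLp f))]
  congr 1
  have h1 : (‖hf.toLp f‖ ^ 2 : ℝ) = (⟪hf.toLp f, hf.toLp f⟫_ℂ).re :=
    norm_sq_eq_re_inner (𝕜 := ℂ) _
  have h2 : ⟪hf.toLp f, hf.toLp f⟫_ℂ = ((∫ x, ‖f x‖ ^ 2 ∂μ : ℝ) : ℂ) := by
    rw [L2.inner_def]
    refine Eq.trans (integral_congr_ae ?_) (integral_ofReal (𝕜 := ℂ))
    filter_upwards [hf.coeFn_toLp] with x hx
    rw [hx, inner_self_eq_norm_sq_to_K]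
    norm_cast
  rw [h1, h2, Complex.ofReal_re]

lemma inner_toLp_eq {X : Type*} [MeasurableSpace X] {μ : Measure X} {f g : X → ℂ}
    (hf : MemLp f 2 μ) (hg : MemLp g 2 μ) :
    ⟪hg.toLp g, hf.toLp f⟫_ℂ = ∫ x, f x * conj (g x) ∂μ := by
  rw [L2.inner_def]
  refine integral_congr_ae ?_
  filter_upwards [hf.coeFn_toLp, hg.coeFn_toLp] with x hx hx'
  rw [hx, hx', RCLike.inner_apply]

/-- The Cauchy-Schwarz inequality for complex functions. -/
lemma norm_integral_mul_conj_le {X : Type*} [MeasurableSpace X] {μ : Measure X} {f g : X → ℂ}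
    (hf : MemLp f 2 μ) (hg : MemLp g 2 μ) :
    ‖∫ x, f x * conj (g x) ∂μ‖ ≤ √(∫ x, ‖f x‖ ^ 2 ∂μ) * √(∫ x, ‖g x‖ ^ 2 ∂μ) := by
  rw [← inner_toLp_eq hf hg, ← norm_toLp_eq_sqrt hf, ← norm_toLp_eq_sqrt hg, mul_comm]
  exact norm_inner_le_norm _ _

lemma integrable_mul_conj {X : Type*} [MeasurableSpace X] {μ : Measure X} {f g : X → ℂ}
    (hf : MemLp f 2 μ) (hg : MemLp g 2 μ) : Integrable (fun x => f x * conj (g x)) μ := by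
  refine MemLp.integrable_mul hf (q := 2) (p := 2) ?_
  exact ⟨Complex.continuous_conj.comp_aestronglyMeasurable hg.1, by
    have : eLpNorm (fun x => conj (g x)) 2 μ = eLpNorm g 2 μ :=
      eLpNorm_congr_norm_ae (Eventually.of_forall fun x => RCLike.norm_conj _)
    rw [this]
    exact hg.2⟩

/-- The trigonometric polynomial with frequencies in `s` and coefficients `d`. -/
def trig (s : Finset ℤ) (d : ℤ → ℂ) (y : Circ) : ℂ := ∑ k ∈ s, d k * fourier k y

lemma continuous_trig (s : Finset ℤ) (d : ℤ → ℂ) : Continuous (trig s d) := by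
  unfold trig
  exact continuous_finsetSum _ fun k _ => continuous_const.mul (map_continuous (fourier k))

lemma memLp_of_continuous {g : Circ → ℂ} (hg : Continuous g) :
    MemLp g 2 (haarAddCircle : Measure Circ) := by
  obtain ⟨C, hC⟩ := isCompact_univ.exists_bound_of_continuousOn hg.continuousOn
  exact MemLp.of_bound hg.aestronglyMeasurable C (Eventually.of_forall fun x => hC x (mem_univ x))

lemma memLp_trig (s : Finset ℤ) (d : ℤ → ℂ) : MemLp (trig s d) 2 (haarAddCircle : Measure Circ) :=
  memLp_of_continuous (continuous_trig s d)

lemma hasDerivAt_fourier_two_pi (k : ℤ) (t : ℝ) :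
    HasDerivAt (fun t : ℝ => fourier k (t : Circ))
      (Complex.I * k * fourier k (t : Circ)) t := by
  refine (hasDerivAt_fourier (2 * Real.pi) k t).congr_deriv ?_
  have : (2 * Real.pi * Complex.I * k / ((2 * Real.pi : ℝ) : ℂ) : ℂ) = Complex.I * k := by
    have h : (Real.pi : ℂ) ≠ 0 := by exact_mod_cast Real.pi_ne_zero
    push_cast
    field_simp
  rw [this]

lemma hasDerivAt_trig (s : Finset ℤ) (d : ℤ → ℂ) (t : ℝ) :
    HasDerivAt (fun t : ℝ => trig s d (t : Circ))
      (trig s (fun k => Complex.I * k * d k) (t : Circ)) t := by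
  unfold trig
  refine (HasDerivAt.fun_sum fun k _ =>
    (hasDerivAt_fourier_two_pi k t).const_mul (d k)).congr_deriv ?_
  exact Finset.sum_congr rfl fun k _ => by ring

lemma toLp_trig (s : Finset ℤ) (d : ℤ → ℂ) :
    (memLp_trig s d).toLp _ = ∑ k ∈ s, d k • fourierLp (T := 2 * Real.pi) 2 k := by
  classical
  induction s using Finset.induction_on with
  | empty =>
    rw [Finset.sum_empty, ← MemLp.toLp_zero (MemLp.zero' (μ := (haarAddCircle : Measure Circ)))]
    exact MemLp.toLp_congr _ _ (Eventually.of_forall fun y => by simp [trig])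
  | insert k s hk ih =>
    rw [Finset.sum_insert hk, ← ih]
    have h1 : MemLp (fun y => d k * fourier k y) 2 (haarAddCircle : Measure Circ) :=
      memLp_of_continuous (continuous_const.mul (map_continuous (fourier k)))
    have h2 : d k • fourierLp (T := 2 * Real.pi) 2 k = h1.toLp _ := rfl
    rw [h2, ← MemLp.toLp_add]
    exact MemLp.toLp_congr _ _ (Eventually.of_forall fun y => by
      simp [trig, Finset.sum_insert hk])

lemma integral_norm_sq_trig (s : Finset ℤ) (d : ℤ → ℂ) :
    ∫ y, ‖trig s d y‖ ^ 2 ∂haarAddCircle = ∑ k ∈ s, ‖d k‖ ^ 2 := by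
  have h0 : 0 ≤ ∫ y, ‖trig s d y‖ ^ 2 ∂haarAddCircle := by positivity
  have h1 := norm_toLp_eq_sqrt (memLp_trig s d)
  rw [← Real.sq_sqrt h0, ← h1, toLp_trig]
  have h2 := (orthonormal_fourier (T := 2 * Real.pi)).inner_sum d d s
  rw [inner_self_eq_norm_sq_to_K] at h2
  have h3 : ∀ k, conj (d k) * d k = ((‖d k‖ ^ 2 : ℝ) : ℂ) := fun k => by
    rw [mul_comm, Complex.mul_conj, Complex.normSq_eq_norm_sq]
  simp only [h3] at h2
  exact Complex.ofReal_injective (by push_cast at h2 ⊢; exact h2)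

/-- Parseval's identity for the distance to a trigonometric polynomial. -/
lemma integral_norm_sq_sub_trig {w : Circ → ℂ} (hw : MemLp w 2 (haarAddCircle : Measure Circ))
    (s : Finset ℤ) (d : ℤ → ℂ) :
    ∫ y, ‖w y - trig s d y‖ ^ 2 ∂haarAddCircle =
      ∫ y, ‖w y‖ ^ 2 ∂haarAddCircle - ∑ k ∈ s, ‖fourierCoeff w k‖ ^ 2 +
        ∑ k ∈ s, ‖fourierCoeff w k - d k‖ ^ 2 := by
  have hwt := hw.sub (memLp_trig s d)
  have h0 : 0 ≤ ∫ y, ‖w y - trig s d y‖ ^ 2 ∂haarAddCircle := by positivity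
  have h0' : 0 ≤ ∫ y, ‖w y‖ ^ 2 ∂haarAddCircle := by positivity
  have hn1 : ‖hwt.toLp _‖ = √(∫ y, ‖w y - trig s d y‖ ^ 2 ∂haarAddCircle) := norm_toLp_eq_sqrt hwt
  have hn2 := norm_toLp_eq_sqrt hw
  rw [← Real.sq_sqrt h0, ← Real.sq_sqrt h0', ← hn1, ← hn2, MemLp.toLp_sub hw (memLp_trig s d),
    @norm_sub_sq ℂ, norm_toLp_eq_sqrt (memLp_trig s d), integral_norm_sq_trig,
    Real.sq_sqrt (Finset.sum_nonneg fun k _ => by positivity), toLp_trig, inner_sum]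
  have hin : ∀ k, ⟪hw.toLp w, d k • fourierLp (T := 2 * Real.pi) 2 k⟫_ℂ =
      d k * conj (fourierCoeff w k) := by
    intro k
    rw [inner_smul_right, ← inner_conj_symm, ← coe_fourierBasis, ← HilbertBasis.repr_apply_apply,
      fourierBasis_repr, fourierCoeff_congr_ae hw.coeFn_toLp]
  simp only [hin, map_sum]
  have h3 : ∀ k, ‖fourierCoeff w k - d k‖ ^ 2 = ‖fourierCoeff w k‖ ^ 2 -
      2 * (d k * conj (fourierCoeff w k)).re + ‖d k‖ ^ 2 := by
    intro k
    simp only [← Complex.normSq_eq_norm_sq, Complex.normSq_apply, Complex.sub_re, Complex.sub_im,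
      Complex.mul_re, Complex.conj_re, Complex.conj_im]
    ring
  simp only [h3, Finset.sum_add_distrib, Finset.sum_sub_distrib, ← Finset.mul_sum]
  simp only [RCLike.re_to_complex]
  ring

lemma integral_haar_eq_interval {E : Type*} [NormedAddCommGroup E] [NormedSpace ℝ E]
    (f : Circ → E) : ∫ y, f y ∂haarAddCircle =
      (2 * Real.pi)⁻¹ • ∫ t in (0 : ℝ)..2 * Real.pi, f (t : Circ) := by
  have h1 := AddCircle.intervalIntegral_preimage (2 * Real.pi) 0 f
  rw [zero_add] at h1
  rw [h1, AddCircle.integral_haarAddCircle]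

/-- The energy identity behind the commutator estimate: if `w = z - ε z''` then
`Re w (a z')‾' = - a |z'|² - ε a |z''|² + (ε / 2) a'' |z'|²` up to a derivative. -/
lemma integral_re_mul_conj_le {T ε M : ℝ} (hT : 0 ≤ T) (hε : 0 ≤ ε) {z z₁ z₂ : ℝ → ℂ}
    {a a₁ a₂ : ℝ → ℝ}
    (hz : ∀ t, HasDerivAt z (z₁ t) t) (hz₁ : ∀ t, HasDerivAt z₁ (z₂ t) t) (hz₂ : Continuous z₂)
    (ha : ∀ t, HasDerivAt a (a₁ t) t) (ha₁ : ∀ t, HasDerivAt a₁ (a₂ t) t) (ha₂ : Continuous a₂)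
    (hzT : z T = z 0) (hz₁T : z₁ T = z₁ 0) (haT : a T = a 0) (ha₁T : a₁ T = a₁ 0)
    (hpos : ∀ t, 0 ≤ a t) (hM : ∀ t, a₂ t ≤ M) :
    ∫ t in (0 : ℝ)..T, ((z t - ε * z₂ t) * conj (a t * z₂ t + a₁ t * z₁ t)).re ≤
      ε * M / 2 * ∫ t in (0 : ℝ)..T, ‖z₁ t‖ ^ 2 := by
  have hre : ∀ {f : ℝ → ℂ} {f' : ℂ} {t}, HasDerivAt f f' t →
      HasDerivAt (fun t => (f t).re) f'.re t := fun h =>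
    Complex.reCLM.hasFDerivAt.comp_hasDerivAt _ h
  have him : ∀ {f : ℝ → ℂ} {f' : ℂ} {t}, HasDerivAt f f' t →
      HasDerivAt (fun t => (f t).im) f'.im t := fun h =>
    Complex.imCLM.hasFDerivAt.comp_hasDerivAt _ h
  have hcz : Continuous z := continuous_iff_continuousAt.2 fun t => (hz t).continuousAt
  have hcz₁ : Continuous z₁ := continuous_iff_continuousAt.2 fun t => (hz₁ t).continuousAt
  have hca : Continuous a := continuous_iff_continuousAt.2 fun t => (ha t).continuousAt
  have hca₁ : Continuous a₁ := continuous_iff_continuousAt.2 fun t => (ha₁ t).continuousAt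
  set B : ℝ → ℝ := fun t => a t * ((z t).re * (z₁ t).re + (z t).im * (z₁ t).im) -
    ε / 2 * (a₁ t * ((z₁ t).re * (z₁ t).re + (z₁ t).im * (z₁ t).im)) with hB
  set B' : ℝ → ℝ := fun t =>
    (a₁ t * ((z t).re * (z₁ t).re + (z t).im * (z₁ t).im) +
      a t * (((z₁ t).re * (z₁ t).re + (z t).re * (z₂ t).re) +
        ((z₁ t).im * (z₁ t).im + (z t).im * (z₂ t).im))) -
    ε / 2 * (a₂ t * ((z₁ t).re * (z₁ t).re + (z₁ t).im * (z₁ t).im) +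
      a₁ t * (((z₂ t).re * (z₁ t).re + (z₁ t).re * (z₂ t).re) +
        ((z₂ t).im * (z₁ t).im + (z₁ t).im * (z₂ t).im))) with hB'
  have hBd : ∀ t, HasDerivAt B (B' t) t := fun t =>
    ((ha t).mul (((hre (hz t)).mul (hre (hz₁ t))).add ((him (hz t)).mul (him (hz₁ t))))).sub
      (((ha₁ t).mul (((hre (hz₁ t)).mul (hre (hz₁ t))).add
        ((him (hz₁ t)).mul (him (hz₁ t))))).const_mul (ε / 2))
  have hB'c : Continuous B' := by
    have := Complex.continuous_re
    have := Complex.continuous_im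
    fun_prop
  have hBi : ∫ t in (0 : ℝ)..T, B' t = 0 := by
    rw [intervalIntegral.integral_eq_sub_of_hasDerivAt (fun t _ => hBd t)
      (hB'c.intervalIntegrable _ _)]
    simp only [hB, hzT, hz₁T, haT, ha₁T, sub_self]
  have hNc : Continuous fun t => ‖z₁ t‖ ^ 2 := by fun_prop
  have hsplit : ε * M / 2 * ∫ t in (0 : ℝ)..T, ‖z₁ t‖ ^ 2 =
      ∫ t in (0 : ℝ)..T, (ε * M / 2 * ‖z₁ t‖ ^ 2 + B' t) := by
    have h1 : Continuous fun t => ε * M / 2 * ‖z₁ t‖ ^ 2 := by fun_prop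
    rw [intervalIntegral.integral_add (h1.intervalIntegrable _ _)
      (hB'c.intervalIntegrable _ _), hBi, add_zero, intervalIntegral.integral_const_mul]
  rw [hsplit]
  refine intervalIntegral.integral_mono_on hT (Continuous.intervalIntegrable (by fun_prop) _ _)
    (Continuous.intervalIntegrable (by fun_prop) _ _) fun t _ => ?_
  have h1 : 0 ≤ a t * ((z₁ t).re ^ 2 + (z₁ t).im ^ 2) := mul_nonneg (hpos t) (by positivity)
  have h2 : 0 ≤ ε * (a t * ((z₂ t).re ^ 2 + (z₂ t).im ^ 2)) :=
    mul_nonneg hε (mul_nonneg (hpos t) (by positivity))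
  have h3 : 0 ≤ ε / 2 * ((M - a₂ t) * ((z₁ t).re ^ 2 + (z₁ t).im ^ 2)) :=
    mul_nonneg (by positivity) (mul_nonneg (sub_nonneg.2 (hM t)) (by positivity))
  rw [← Complex.normSq_eq_norm_sq, Complex.normSq_apply]
  simp only [Complex.mul_re, Complex.sub_re, Complex.sub_im, Complex.conj_re, Complex.conj_im,
    Complex.add_re, Complex.add_im, Complex.mul_im, Complex.ofReal_re, Complex.ofReal_im]
  simp only [hB']
  nlinarith

/-- The multipliers `(1 + ε k²)⁻¹` of `(1 - ε ∂²)⁻¹`. -/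
def smoothing (ε : ℝ) (k : ℤ) : ℝ := (1 + ε * (k : ℝ) ^ 2)⁻¹

lemma smoothing_pos {ε : ℝ} (hε : 0 < ε) (k : ℤ) : 0 < smoothing ε k := by
  unfold smoothing; positivity

lemma smoothing_le_one {ε : ℝ} (hε : 0 < ε) (k : ℤ) : smoothing ε k ≤ 1 := by
  unfold smoothing
  exact inv_le_one_of_one_le₀ (by nlinarith [sq_nonneg (k : ℝ)])

lemma smoothing_mul {ε : ℝ} (hε : 0 < ε) (k : ℤ) :
    smoothing ε k * (1 + ε * (k : ℝ) ^ 2) = 1 := by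
  unfold smoothing
  exact inv_mul_cancel₀ (by positivity)

/-- The commutator estimate on the circle. Here `a` is the coefficient of the angular part of the
Laplacian, `q` a bounded potential, and `∑ₖ dₖ ((a eₖ')' - q eₖ)` is the image of the regularization
`z = ∑ₖ dₖ eₖ` of `w`. The first error term is due to the commutator of `(1 - ε ∂²)⁻¹` with the
second-order operator, the two others to the truncation and the regularization of `w`. -/
lemma re_integral_mul_conj_le {w : Circ → ℂ} (hw : MemLp w 2 (haarAddCircle : Measure Circ))
    {a a₁ a₂ : Circ → ℝ} {q : Circ → ℂ} {A M B ε : ℝ} (hε : 0 < ε)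
    (ha : ∀ t : ℝ, HasDerivAt (fun t : ℝ => a (t : Circ)) (a₁ (t : Circ)) t)
    (ha₁ : ∀ t : ℝ, HasDerivAt (fun t : ℝ => a₁ (t : Circ)) (a₂ (t : Circ)) t)
    (hca : Continuous a) (hca₁ : Continuous a₁) (hca₂ : Continuous a₂)
    (hpos : ∀ y, 0 ≤ a y) (hA : ∀ y, a y ≤ A) (hA₁ : ∀ y, |a₁ y| ≤ A) (hM : ∀ y, a₂ y ≤ M)
    (hqm : AEStronglyMeasurable q (haarAddCircle : Measure Circ)) (hB : ∀ y, ‖q y‖ ≤ B)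
    (s : Finset ℤ) :
    (∫ y, w y * conj (∑ k ∈ s, (smoothing ε k * fourierCoeff w k) *
        ((-(k : ℂ) ^ 2 * a y + Complex.I * k * a₁ y - q y) * fourier k y)) ∂haarAddCircle).re ≤
      M / 2 * ∑ k ∈ s, ε * (k : ℝ) ^ 2 * smoothing ε k ^ 2 * ‖fourierCoeff w k‖ ^ 2 +
      2 * A / ε * (√(∫ y, ‖w y‖ ^ 2 ∂haarAddCircle) *
        √(∫ y, ‖w y‖ ^ 2 ∂haarAddCircle - ∑ k ∈ s, ‖fourierCoeff w k‖ ^ 2)) +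
      B * (√(∫ y, ‖w y‖ ^ 2 ∂haarAddCircle) *
        √(∫ y, ‖w y‖ ^ 2 ∂haarAddCircle - ∑ k ∈ s, ‖fourierCoeff w k‖ ^ 2 +
          ∑ k ∈ s, (1 - smoothing ε k) ^ 2 * ‖fourierCoeff w k‖ ^ 2)) -
      ∫ y, (q y).re * ‖w y‖ ^ 2 ∂haarAddCircle := by
  set b : ℤ → ℂ := fourierCoeff w with hb
  set d : ℤ → ℂ := fun k => smoothing ε k * b k with hd
  set d₁ : ℤ → ℂ := fun k => Complex.I * k * d k with hd₁
  set d₂ : ℤ → ℂ := fun k => Complex.I * k * d₁ k with hd₂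
  set z := trig s d
  set z₁ := trig s d₁
  set z₂ := trig s d₂
  set E := ∫ y, ‖w y‖ ^ 2 ∂haarAddCircle with hE
  have hA0 : 0 ≤ A := (hpos 0).trans (hA 0)
  have hB0 : 0 ≤ B := (norm_nonneg _).trans (hB 0)
  have hE0 : 0 ≤ E := by positivity
  have hbE : ∑ k ∈ s, ‖b k‖ ^ 2 ≤ E := by
    have h1 := integral_norm_sq_sub_trig hw s b
    simp only [← hb, sub_self, norm_zero] at h1
    have h2 : 0 ≤ ∫ y, ‖w y - trig s b y‖ ^ 2 ∂haarAddCircle := by positivity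
    have h3 : ∑ k ∈ s, (0 : ℝ) ^ 2 = 0 := by simp
    linarith
  -- the function `w = z - ε z''` on the frequencies in `s`
  have hwN : ∀ y, trig s b y = z y - ε * z₂ y := by
    intro y
    simp only [z, z₂, trig, Finset.mul_sum, ← Finset.sum_sub_distrib]
    refine Finset.sum_congr rfl fun k _ => ?_
    have h1 := smoothing_mul hε k
    have h2 : (smoothing ε k : ℂ) * (1 + ε * (k : ℂ) ^ 2) = 1 := by exact_mod_cast h1
    have h3 : d₂ k = -(k : ℂ) ^ 2 * d k := by
      simp only [hd₂, hd₁]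
      linear_combination (k : ℂ) ^ 2 * d k * Complex.I_sq
    rw [h3]
    simp only [hd]
    linear_combination (-(b k * fourier k y)) * h2
  set Λ : Circ → ℂ := fun y => a y * z₂ y + a₁ y * z₁ y with hΛ
  have hΛc : Continuous Λ := by
    have h1 := continuous_trig s d₁
    have h2 := continuous_trig s d₂
    fun_prop
  have hsum : ∀ y, ∑ k ∈ s, (smoothing ε k * b k) *
      ((-(k : ℂ) ^ 2 * a y + Complex.I * k * a₁ y - q y) * fourier k y) = Λ y - q y * z y := by
    intro y
    simp only [hΛ, z, z₁, z₂, trig, Finset.mul_sum, ← Finset.sum_add_distrib,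
      ← Finset.sum_sub_distrib]
    refine Finset.sum_congr rfl fun k _ => ?_
    simp only [hd₂, hd₁, hd]
    linear_combination (-(a y * (k : ℂ) ^ 2 * (smoothing ε k * b k) * fourier k y)) * Complex.I_sq
  simp only [hsum]
  have hzL : MemLp z 2 (haarAddCircle : Measure Circ) := memLp_trig s d
  have hbL : MemLp (trig s b) 2 (haarAddCircle : Measure Circ) := memLp_trig s b
  have hΛL : MemLp Λ 2 (haarAddCircle : Measure Circ) := memLp_of_continuous hΛc
  have hqL : ∀ {g : Circ → ℂ}, MemLp g 2 (haarAddCircle : Measure Circ) →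
      MemLp (fun y => q y * g y) 2 (haarAddCircle : Measure Circ) := fun {g} hg =>
    MemLp.of_le_mul hg (hqm.mul hg.1) (c := B) (Eventually.of_forall fun y => by
      rw [norm_mul]
      exact mul_le_mul_of_nonneg_right (hB y) (norm_nonneg _))
  have hsplit : ∫ y, w y * conj (Λ y - q y * z y) ∂haarAddCircle =
      ((∫ y, trig s b y * conj (Λ y) ∂haarAddCircle) +
        ∫ y, (w y - trig s b y) * conj (Λ y) ∂haarAddCircle) +
      ((∫ y, w y * conj (q y * (w y - z y)) ∂haarAddCircle) -
        ∫ y, w y * conj (q y * w y) ∂haarAddCircle) := by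
    have i1 := integrable_mul_conj hbL hΛL
    have i2 : Integrable (fun y => (w y - trig s b y) * conj (Λ y)) _ :=
      integrable_mul_conj (hw.sub hbL) hΛL
    have i3 : Integrable (fun y => w y * conj (q y * (w y - z y))) _ :=
      integrable_mul_conj hw (hqL (hw.sub hzL))
    have i4 := integrable_mul_conj hw (hqL hw)
    rw [← integral_add i1 i2, ← integral_sub i3 i4]
    refine Eq.trans ?_ (integral_add (i1.add i2) (i3.sub i4))
    refine integral_congr_ae (Eventually.of_forall fun y => ?_)
    simp only [map_sub, map_mul]
    ring
  -- the main term
  have hmain : (∫ y, trig s b y * conj (Λ y) ∂haarAddCircle).re ≤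
      M / 2 * ∑ k ∈ s, ε * (k : ℝ) ^ 2 * smoothing ε k ^ 2 * ‖b k‖ ^ 2 := by
    have h1 := integral_re_mul_conj_le (T := 2 * Real.pi) (ε := ε) (M := M)
      (z := fun t => z (t : Circ)) (z₁ := fun t => z₁ (t : Circ)) (z₂ := fun t => z₂ (t : Circ))
      (a := fun t => a (t : Circ)) (a₁ := fun t => a₁ (t : Circ)) (a₂ := fun t => a₂ (t : Circ))
      Real.two_pi_pos.le hε.le (hasDerivAt_trig s d) (hasDerivAt_trig s d₁)
      ((continuous_trig s d₂).comp (AddCircle.continuous_mk' _)) ha ha₁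
      (hca₂.comp (AddCircle.continuous_mk' _)) (by simp [AddCircle.coe_period])
      (by simp [AddCircle.coe_period]) (by simp [AddCircle.coe_period])
      (by simp [AddCircle.coe_period]) (fun t => hpos _) (fun t => hM _)
    have h2 : (∫ y, trig s b y * conj (Λ y) ∂haarAddCircle).re =
        ∫ y, ((z y - ε * z₂ y) * conj (Λ y)).re ∂haarAddCircle := by
      have h3 := integral_re (𝕜 := ℂ) (integrable_mul_conj hbL hΛL)
      rw [← RCLike.re_to_complex, ← h3]
      refine integral_congr_ae (Eventually.of_forall fun y => ?_)
      simp only [hwN, RCLike.re_to_complex]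
    have h4 := integral_norm_sq_trig s d₁
    rw [integral_haar_eq_interval, smul_eq_mul] at h4
    rw [h2, integral_haar_eq_interval, smul_eq_mul]
    have h5 : ∑ k ∈ s, ε * (k : ℝ) ^ 2 * smoothing ε k ^ 2 * ‖b k‖ ^ 2 =
        ε * ∑ k ∈ s, ‖d₁ k‖ ^ 2 := by
      rw [Finset.mul_sum]
      refine Finset.sum_congr rfl fun k _ => ?_
      simp only [hd₁, hd, norm_mul, Complex.norm_I, one_mul, Complex.norm_intCast,
        Complex.norm_real, mul_pow, Real.norm_eq_abs, sq_abs]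
      ring
    rw [h5, ← h4]
    calc _ ≤ (2 * Real.pi)⁻¹ * (ε * M / 2 * ∫ t in (0 : ℝ)..2 * Real.pi, ‖z₁ (t : Circ)‖ ^ 2) :=
          mul_le_mul_of_nonneg_left h1 (inv_nonneg.2 Real.two_pi_pos.le)
      _ = _ := by ring
  -- the truncation error
  have hΛn : √(∫ y, ‖Λ y‖ ^ 2 ∂haarAddCircle) ≤ 2 * A / ε * √E := by
    have h1 : ∀ y, ‖Λ y‖ ^ 2 ≤ 2 * A ^ 2 * (‖z₂ y‖ ^ 2 + ‖z₁ y‖ ^ 2) := by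
      intro y
      have h2 : ‖Λ y‖ ≤ A * ‖z₂ y‖ + A * ‖z₁ y‖ := by
        refine (norm_add_le _ _).trans (add_le_add ?_ ?_) <;> rw [norm_mul, Complex.norm_real]
        · rw [Real.norm_eq_abs, abs_of_nonneg (hpos y)]
          exact mul_le_mul_of_nonneg_right (hA y) (norm_nonneg _)
        · exact mul_le_mul_of_nonneg_right (hA₁ y) (norm_nonneg _)
      have h3 : ‖Λ y‖ ^ 2 ≤ (A * ‖z₂ y‖ + A * ‖z₁ y‖) ^ 2 :=
        pow_le_pow_left₀ (norm_nonneg _) h2 2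
      nlinarith [sq_nonneg (A * ‖z₂ y‖ - A * ‖z₁ y‖)]
    have hi : ∀ e : ℤ → ℂ, Integrable (fun y => ‖trig s e y‖ ^ 2)
        (haarAddCircle : Measure Circ) := fun e => (memLp_trig s e).integrable_norm_pow (by simp)
    have h4 : ∫ y, ‖Λ y‖ ^ 2 ∂haarAddCircle ≤
        2 * A ^ 2 * (∑ k ∈ s, ‖d₂ k‖ ^ 2 + ∑ k ∈ s, ‖d₁ k‖ ^ 2) := by
      rw [← integral_norm_sq_trig, ← integral_norm_sq_trig, ← integral_add (hi _) (hi _),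
        ← integral_const_mul]
      exact integral_mono (hΛL.integrable_norm_pow (by simp))
        (((hi _).add (hi _)).const_mul _) h1
    have hk : ∀ k : ℤ, (k : ℝ) ^ 2 ≤ (k : ℝ) ^ 4 := by
      intro k
      rcases eq_or_ne k 0 with rfl | hk
      · simp
      · have : (1 : ℝ) ≤ (k : ℝ) ^ 2 := by
          have : 1 ≤ k ^ 2 := by
            have := Int.one_le_abs hk
            nlinarith [sq_abs k]
          exact_mod_cast this
        nlinarith
    have hd₂n : ∀ k, ‖d₂ k‖ ^ 2 = (k : ℝ) ^ 4 * smoothing ε k ^ 2 * ‖b k‖ ^ 2 := by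
      intro k
      simp only [hd₂, hd₁, hd, norm_mul, Complex.norm_I, one_mul, Complex.norm_intCast,
        Complex.norm_real, mul_pow, Real.norm_eq_abs, sq_abs]
      ring
    have hd₁n : ∀ k, ‖d₁ k‖ ^ 2 = (k : ℝ) ^ 2 * smoothing ε k ^ 2 * ‖b k‖ ^ 2 := by
      intro k
      simp only [hd₁, hd, norm_mul, Complex.norm_I, one_mul, Complex.norm_intCast,
        Complex.norm_real, mul_pow, Real.norm_eq_abs, sq_abs]
      ring
    have hm : ∀ k : ℤ, (k : ℝ) ^ 4 * smoothing ε k ^ 2 ≤ ε⁻¹ ^ 2 := by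
      intro k
      have h5 : (k : ℝ) ^ 2 * smoothing ε k ≤ ε⁻¹ := by
        have h6 := smoothing_mul hε k
        have h7 := smoothing_pos hε k
        rw [← one_div, le_div_iff₀ hε]
        nlinarith
      have h8 : (k : ℝ) ^ 4 * smoothing ε k ^ 2 = ((k : ℝ) ^ 2 * smoothing ε k) ^ 2 := by ring
      rw [h8]
      exact pow_le_pow_left₀ (mul_nonneg (sq_nonneg _) (smoothing_pos hε k).le) h5 2
    have h9 : ∑ k ∈ s, ‖d₂ k‖ ^ 2 ≤ ε⁻¹ ^ 2 * ∑ k ∈ s, ‖b k‖ ^ 2 := by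
      rw [Finset.mul_sum]
      refine Finset.sum_le_sum fun k _ => ?_
      rw [hd₂n]
      exact mul_le_mul_of_nonneg_right (hm k) (sq_nonneg _)
    have h10 : ∑ k ∈ s, ‖d₁ k‖ ^ 2 ≤ ∑ k ∈ s, ‖d₂ k‖ ^ 2 := by
      refine Finset.sum_le_sum fun k _ => ?_
      rw [hd₂n, hd₁n]
      have := hk k
      gcongr
    have h11 : ε⁻¹ ^ 2 * ∑ k ∈ s, ‖b k‖ ^ 2 ≤ ε⁻¹ ^ 2 * E :=
      mul_le_mul_of_nonneg_left hbE (sq_nonneg _)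
    have h12 : ∫ y, ‖Λ y‖ ^ 2 ∂haarAddCircle ≤ (2 * A / ε) ^ 2 * E := by
      refine h4.trans ?_
      have : 2 * A ^ 2 * (∑ k ∈ s, ‖d₂ k‖ ^ 2 + ∑ k ∈ s, ‖d₁ k‖ ^ 2) ≤
          2 * A ^ 2 * (ε⁻¹ ^ 2 * E + ε⁻¹ ^ 2 * E) :=
        mul_le_mul_of_nonneg_left (by linarith) (by positivity)
      refine this.trans (le_of_eq ?_)
      rw [div_eq_mul_inv]
      ring
    refine (Real.sqrt_le_sqrt h12).trans (le_of_eq ?_)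
    rw [Real.sqrt_mul (sq_nonneg _), Real.sqrt_sq (by positivity)]
  have htrunc : (∫ y, (w y - trig s b y) * conj (Λ y) ∂haarAddCircle).re ≤
      2 * A / ε * (√E * √(E - ∑ k ∈ s, ‖b k‖ ^ 2)) := by
    have h1 := norm_integral_mul_conj_le (hw.sub hbL) hΛL
    have h2 := integral_norm_sq_sub_trig hw s b
    simp only [← hb, sub_self, norm_zero] at h2
    have h3 : ∑ k ∈ s, (0 : ℝ) ^ 2 = 0 := by simp
    rw [h3, add_zero, ← hE] at h2
    simp only [Pi.sub_apply] at h1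
    rw [h2] at h1
    refine (Complex.re_le_norm _).trans (h1.trans ?_)
    calc _ ≤ √(E - ∑ k ∈ s, ‖b k‖ ^ 2) * (2 * A / ε * √E) :=
          mul_le_mul_of_nonneg_left hΛn (Real.sqrt_nonneg _)
      _ = _ := by ring
  -- the regularization error
  have hreg : (∫ y, w y * conj (q y * (w y - z y)) ∂haarAddCircle).re ≤
      B * (√E * √(E - ∑ k ∈ s, ‖b k‖ ^ 2 +
        ∑ k ∈ s, (1 - smoothing ε k) ^ 2 * ‖b k‖ ^ 2)) := by
    have h1 := norm_integral_mul_conj_le hw (hqL (hw.sub hzL))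
    have h2 := integral_norm_sq_sub_trig hw s d
    have h3 : ∀ k, ‖b k - d k‖ ^ 2 = (1 - smoothing ε k) ^ 2 * ‖b k‖ ^ 2 := by
      intro k
      have : b k - d k = ((1 - smoothing ε k : ℝ) : ℂ) * b k := by
        simp only [hd]; push_cast; ring
      rw [this, norm_mul, mul_pow, Complex.norm_real, Real.norm_eq_abs, sq_abs]
    simp only [← hb, h3] at h2
    rw [← hE] at h2
    have h4 : ∫ y, ‖q y * (w - z) y‖ ^ 2 ∂haarAddCircle ≤
        B ^ 2 * ∫ y, ‖w y - z y‖ ^ 2 ∂haarAddCircle := by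
      rw [← integral_const_mul]
      refine integral_mono ((hqL (hw.sub hzL)).integrable_norm_pow (by simp))
        (((hw.sub hzL).integrable_norm_pow (by simp)).const_mul _) fun y => ?_
      simp only [norm_mul, mul_pow, Pi.sub_apply]
      have := hB y
      gcongr
    refine (Complex.re_le_norm _).trans (h1.trans ?_)
    rw [h2] at h4
    have h5 := Real.sqrt_le_sqrt h4
    rw [Real.sqrt_mul (sq_nonneg _), Real.sqrt_sq hB0] at h5
    calc _ ≤ √E * (B * √(E - ∑ k ∈ s, ‖b k‖ ^ 2 +
          ∑ k ∈ s, (1 - smoothing ε k) ^ 2 * ‖b k‖ ^ 2)) :=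
          mul_le_mul_of_nonneg_left h5 (Real.sqrt_nonneg _)
      _ = _ := by ring
  have hpot : (∫ y, w y * conj (q y * w y) ∂haarAddCircle).re =
      ∫ y, (q y).re * ‖w y‖ ^ 2 ∂haarAddCircle := by
    have h3 := integral_re (𝕜 := ℂ) (integrable_mul_conj hw (hqL hw))
    rw [← RCLike.re_to_complex, ← h3]
    refine integral_congr_ae (Eventually.of_forall fun y => ?_)
    simp only [RCLike.re_to_complex, ← Complex.normSq_eq_norm_sq, Complex.normSq_apply,
      map_mul, Complex.mul_re, Complex.mul_im, Complex.conj_re, Complex.conj_im]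
    ring
  rw [hsplit, Complex.add_re, Complex.add_re, Complex.sub_re, hpot]
  linarith

end Fourier

/-! ### The weighted inequality for weak solutions on a half-cylinder -/

section Agmon

open AddCircle (haarAddCircle)
open scoped ComplexConjugate

/-- `weak_hardy` for complex functions. -/
lemma weak_hardy_complex {J : Set ℝ} (hJ : IsOpen J) (hJ' : J.OrdConnected) (h0 : (0 : ℝ) ∉ J)
    (hne : J.Nonempty) {P G : ℝ → ℂ}
    (hP : ∀ K ⊆ J, IsCompact K → MemLp P 2 (volume.restrict K))
    (hG : ∀ K ⊆ J, IsCompact K → MemLp G 2 (volume.restrict K))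
    (hw : ∀ h, IsTest J h → ∫ x, (deriv (deriv h) x * P x + h x * G x) = 0)
    {f : ℝ → ℝ} (hf : IsTest J f) :
    Integrable (fun x => (deriv f x ^ 2 - f x ^ 2 / (4 * x ^ 2)) * ‖P x‖ ^ 2 +
      f x ^ 2 * (G x * conj (P x)).re) ∧
    0 ≤ ∫ x, ((deriv f x ^ 2 - f x ^ 2 / (4 * x ^ 2)) * ‖P x‖ ^ 2 +
      f x ^ 2 * (G x * conj (P x)).re) := by
  have hfin : ∀ K : Set ℝ, IsCompact K → IsFiniteMeasure (volume.restrict K) := fun K hK =>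
    ⟨by rw [Measure.restrict_apply_univ]; exact hK.measure_lt_top⟩
  have hloc : ∀ F : ℝ → ℂ, (∀ K ⊆ J, IsCompact K → MemLp F 2 (volume.restrict K)) →
      LocallyIntegrableOn F J := by
    intro F hF
    rw [locallyIntegrableOn_iff hJ.isLocallyClosed]
    intro K hKJ hK
    have := hfin K hK
    exact (hF K hKJ hK).integrable (by norm_num)
  have hlre : ∀ F : ℝ → ℂ, LocallyIntegrableOn F J → LocallyIntegrableOn (fun x => (F x).re) J := by
    intro F hF
    rw [locallyIntegrableOn_iff hJ.isLocallyClosed] at hF ⊢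
    exact fun K hKJ hK => (hF K hKJ hK).re
  have hlim : ∀ F : ℝ → ℂ, LocallyIntegrableOn F J → LocallyIntegrableOn (fun x => (F x).im) J := by
    intro F hF
    rw [locallyIntegrableOn_iff hJ.isLocallyClosed] at hF ⊢
    exact fun K hKJ hK => (hF K hKJ hK).im
  have hPl := hloc P hP
  have hGl := hloc G hG
  have hint : ∀ h, IsTest J h → Integrable fun x => deriv (deriv h) x * P x + h x * G x := by
    intro h hh
    have h1 : ∀ (F : ℝ → ℂ) (k : ℝ → ℝ), LocallyIntegrableOn F J → IsTest J k →
        Integrable fun x => (k x : ℂ) * F x := by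
      intro F k hF hk
      have h2 := integrable_test_mul (hlre F hF) hk.continuous hk.compact hk.subset
      have h3 := integrable_test_mul (hlim F hF) hk.continuous hk.compact hk.subset
      refine (h2.ofReal.add (h3.ofReal.mul_const Complex.I)).congr
        (Eventually.of_forall fun x => ?_)
      apply Complex.ext <;> simp
    exact (h1 P _ hPl hh.deriv.deriv).add (h1 G _ hGl hh)
  have hre := weak_hardy hJ hJ' h0 hne (hlre P hPl) (hlre G hGl) (fun h hh => by
    have h1 := integral_re (𝕜 := ℂ) (hint h hh)
    rw [hw h hh] at h1
    simpa using h1) hf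
  have him := weak_hardy hJ hJ' h0 hne (hlim P hPl) (hlim G hGl) (fun h hh => by
    have h1 := integral_im (𝕜 := ℂ) (hint h hh)
    rw [hw h hh] at h1
    simpa using h1) hf
  set K := tsupport f with hK
  have hKc : IsCompact K := hf.compact
  have hKJ : K ⊆ J := hf.subset
  -- products of components are integrable against bounded weights supported in `K`
  have hprod : ∀ {a b : ℝ → ℝ} {c : ℝ → ℝ}, MemLp a 2 (volume.restrict K) →
      MemLp b 2 (volume.restrict K) → ContinuousOn c K → (∀ x, x ∉ K → c x = 0) →
      Integrable fun x => c x * (a x * b x) := by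
    intro a b c ha hb hc hc0
    have h1 : IntegrableOn (fun x => a x * b x) K := MemLp.integrable_mul ha hb
    refine (integrableOn_iff_integrable_of_support_subset fun x hx => ?_).1
      (h1.continuousOn_mul hc hKc)
    by_contra h
    exact left_ne_zero_of_mul hx (hc0 x h)
  have hf0 : ∀ x, x ∉ K → f x = 0 := fun x hx => image_eq_zero_of_notMem_tsupport hx
  have hf0' : ∀ x, x ∉ K → deriv f x = 0 := fun x hx =>
    image_eq_zero_of_notMem_tsupport fun h => hx (tsupport_deriv_subset h)
  have hfc := hf.continuous
  have hfc' := hf.deriv.continuous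
  have hc1 : ContinuousOn (fun x => deriv f x ^ 2) K := (hfc'.pow 2).continuousOn
  have hc2 : ContinuousOn (fun x => f x ^ 2) K := (hfc.pow 2).continuousOn
  have hc3 : ContinuousOn (fun x => f x ^ 2 / (4 * x ^ 2)) K :=
    hc2.div (by fun_prop) fun x hx => by
      have : x ≠ 0 := fun h => h0 (h ▸ hKJ hx)
      positivity
  have hpart : ∀ {p g : ℝ → ℝ}, MemLp p 2 (volume.restrict K) → MemLp g 2 (volume.restrict K) →
      Integrable fun x => deriv f x ^ 2 * p x ^ 2 + f x ^ 2 * (g x * p x) -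
        f x ^ 2 * p x ^ 2 / (4 * x ^ 2) := by
    intro p g hp hg
    refine (((hprod hp hp hc1 fun x hx => by simp [hf0' x hx]).add
      (hprod hg hp hc2 fun x hx => by simp [hf0 x hx])).sub
      (hprod hp hp hc3 fun x hx => by simp [hf0 x hx])).congr (Eventually.of_forall fun x => ?_)
    simp only [Pi.add_apply, Pi.sub_apply]
    ring
  have hI1 := hpart (hP K hKJ hKc).re (hG K hKJ hKc).re
  have hI2 := hpart (hP K hKJ hKc).im (hG K hKJ hKc).im
  have heq : (fun x => (deriv f x ^ 2 - f x ^ 2 / (4 * x ^ 2)) * ‖P x‖ ^ 2 +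
      f x ^ 2 * (G x * conj (P x)).re) = fun x =>
      (deriv f x ^ 2 * (P x).re ^ 2 + f x ^ 2 * ((G x).re * (P x).re) -
        f x ^ 2 * (P x).re ^ 2 / (4 * x ^ 2)) +
      (deriv f x ^ 2 * (P x).im ^ 2 + f x ^ 2 * ((G x).im * (P x).im) -
        f x ^ 2 * (P x).im ^ 2 / (4 * x ^ 2)) := by
    funext x
    rw [← Complex.normSq_eq_norm_sq, Complex.normSq_apply, Complex.mul_re, Complex.conj_re,
      Complex.conj_im]
    ring
  rw [heq]
  refine ⟨hI1.add hI2, ?_⟩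
  exact (add_nonneg hre him).trans_eq (integral_add hI1 hI2).symm

/-- Integration over the circle against a bounded kernel maps `L²` to `L²`. -/
lemma memLp_integral_mul {μ : Measure ℝ} [SFinite μ] {u m : Cyl → ℂ}
    (hu : MemLp u 2 (μ.prod haarAddCircle)) (hm : AEStronglyMeasurable m (μ.prod haarAddCircle))
    {C : ℝ} (hC : ∀ᵐ x ∂μ, ∀ y, ‖m (x, y)‖ ≤ C) :
    MemLp (fun x => ∫ y, u (x, y) * m (x, y) ∂haarAddCircle) 2 μ := by
  have hmeas : AEStronglyMeasurable (fun x => ∫ y, u (x, y) * m (x, y) ∂haarAddCircle) μ :=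
    (hu.1.mul hm).integral_prod_right'
  have hsq : Integrable (fun p => ‖u p‖ ^ 2) (μ.prod haarAddCircle) :=
    hu.integrable_norm_pow (by simp)
  rw [memLp_two_iff_integrable_sq_norm hmeas]
  refine (hsq.integral_prod_left.const_mul (C ^ 2)).mono' (hmeas.norm.pow 2) ?_
  filter_upwards [hC, hu.1.prodMk_left, hm.prodMk_left, hsq.prod_right_ae] with x h1 h2 h3 h4
  have hux : MemLp (fun y => u (x, y)) 2 haarAddCircle :=
    (memLp_two_iff_integrable_sq_norm h2).2 h4
  have hmx : MemLp (fun y => conj (m (x, y))) 2 haarAddCircle :=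
    MemLp.of_bound (Complex.continuous_conj.comp_aestronglyMeasurable h3) C
      (Eventually.of_forall fun y => by rw [RCLike.norm_conj]; exact h1 y)
  have h5 := norm_integral_mul_conj_le hux hmx
  simp only [RCLike.conj_conj, RCLike.norm_conj] at h5
  have hC0 : 0 ≤ C := (norm_nonneg _).trans (h1 0)
  have h6 : ∫ y, ‖m (x, y)‖ ^ 2 ∂haarAddCircle ≤ C ^ 2 := by
    have := integral_mono_of_nonneg (μ := haarAddCircle) (f := fun y => ‖m (x, y)‖ ^ 2)
      (g := fun _ : Circ => C ^ 2) (Eventually.of_forall fun y => by positivity)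
      (integrable_const _)
      (Eventually.of_forall fun y => pow_le_pow_left₀ (norm_nonneg _) (h1 y) 2)
    simpa using this
  have h7 : 0 ≤ ∫ y, ‖u (x, y)‖ ^ 2 ∂haarAddCircle := by positivity
  have h8 : 0 ≤ ∫ y, ‖m (x, y)‖ ^ 2 ∂haarAddCircle := by positivity
  rw [Real.norm_of_nonneg (by positivity)]
  calc ‖∫ y, u (x, y) * m (x, y) ∂haarAddCircle‖ ^ 2
      ≤ (√(∫ y, ‖u (x, y)‖ ^ 2 ∂haarAddCircle) * √(∫ y, ‖m (x, y)‖ ^ 2 ∂haarAddCircle)) ^ 2 :=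
        pow_le_pow_left₀ (norm_nonneg _) h5 2
    _ = (∫ y, ‖u (x, y)‖ ^ 2 ∂haarAddCircle) * ∫ y, ‖m (x, y)‖ ^ 2 ∂haarAddCircle := by
        rw [mul_pow, Real.sq_sqrt h7, Real.sq_sqrt h8]
    _ ≤ C ^ 2 * ∫ y, ‖u (x, y)‖ ^ 2 ∂haarAddCircle := by
        rw [mul_comm]
        exact mul_le_mul_of_nonneg_right h6 h7

/-- The function with `∂_y (α ∂_y eₖ) - q eₖ = modeCoeff α α₁ q k * eₖ`, where `α₁ = ∂_y α` and
`eₖ(y) = exp (i k y)`. -/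
def modeCoeff (α α₁ q : Cyl → ℝ) (k : ℤ) (p : Cyl) : ℂ :=
  -(k : ℂ) ^ 2 * α p + Complex.I * k * α₁ p - q p

/-- `u` is an `L²` weak solution of `∂ₓ² u + ∂_y (α ∂_y u) - q u = 0` on `J × 𝕋`, with `α₁ = ∂_y α`.
The equation is tested against the functions `h(x) exp (i k y)`. -/
structure IsWeakSolution (J : Set ℝ) (α α₁ q : Cyl → ℝ) (u : Cyl → ℂ) : Prop where
  memLp : MemLp u 2 ((volume : Measure ℝ).prod haarAddCircle)
  eq : ∀ h, IsTest J h → ∀ k : ℤ, ∫ p : Cyl, u p * conj ((deriv (deriv h) p.1 +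
    h p.1 * modeCoeff α α₁ q k p) * fourier k p.2) ∂((volume : Measure ℝ).prod haarAddCircle) = 0

/-- The coefficients are continuous, `α₁ = ∂_y α`, `α₂ = ∂_y² α`, and `q` is continuous over `J`. -/
structure IsCoefficients (J : Set ℝ) (α α₁ α₂ q : Cyl → ℝ) : Prop where
  cont : Continuous α
  cont₁ : Continuous α₁
  cont₂ : Continuous α₂
  nonneg : ∀ p, 0 ≤ α p
  deriv₁ : ∀ x t : ℝ, HasDerivAt (fun t : ℝ => α (x, (t : Circ))) (α₁ (x, (t : Circ))) t
  deriv₂ : ∀ x t : ℝ, HasDerivAt (fun t : ℝ => α₁ (x, (t : Circ))) (α₂ (x, (t : Circ))) t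
  meas : Measurable q
  contOn : ContinuousOn q (J ×ˢ univ)

variable {J : Set ℝ} {α α₁ α₂ q : Cyl → ℝ} {u : Cyl → ℂ}

lemma IsCoefficients.measurable_modeCoeff (hc : IsCoefficients J α α₁ α₂ q) (k : ℤ) :
    Measurable (modeCoeff α α₁ q k) := by
  have h1 := hc.cont.measurable
  have h2 := hc.cont₁.measurable
  have h3 := hc.meas
  unfold modeCoeff
  fun_prop

/-- Uniform bounds for the coefficients over a compact set. -/
lemma IsCoefficients.exists_bound (hc : IsCoefficients J α α₁ α₂ q) {K : Set ℝ} (hK : IsCompact K)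
    (hKJ : K ⊆ J) : ∃ C : ℝ, 0 ≤ C ∧ ∀ x ∈ K, ∀ y, α (x, y) ≤ C ∧ |α₁ (x, y)| ≤ C ∧
      α₂ (x, y) ≤ C ∧ |q (x, y)| ≤ C := by
  have hK2 : IsCompact (K ×ˢ (univ : Set Circ)) := hK.prod isCompact_univ
  obtain ⟨C1, h1⟩ := hK2.exists_bound_of_continuousOn hc.cont.continuousOn
  obtain ⟨C2, h2⟩ := hK2.exists_bound_of_continuousOn hc.cont₁.continuousOn
  obtain ⟨C3, h3⟩ := hK2.exists_bound_of_continuousOn hc.cont₂.continuousOn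
  obtain ⟨C4, h4⟩ := hK2.exists_bound_of_continuousOn (hc.contOn.mono (prod_mono hKJ subset_rfl))
  refine ⟨|C1| + |C2| + |C3| + |C4|, by positivity, fun x hx y => ?_⟩
  have hm : (x, y) ∈ K ×ˢ (univ : Set Circ) := ⟨hx, mem_univ _⟩
  have e1 := h1 _ hm
  have e2 := h2 _ hm
  have e3 := h3 _ hm
  have e4 := h4 _ hm
  simp only [Real.norm_eq_abs] at e1 e2 e3 e4
  have a1 := le_abs_self C1
  have a2 := le_abs_self C2
  have a3 := le_abs_self C3
  have a4 := le_abs_self C4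
  have b1 := abs_nonneg C1
  have b2 := abs_nonneg C2
  have b3 := abs_nonneg C3
  have b4 := abs_nonneg C4
  exact ⟨by linarith [le_abs_self (α (x, y))], by linarith, by linarith [le_abs_self (α₂ (x, y))],
    by linarith⟩

lemma IsCoefficients.exists_bound_modeCoeff (hc : IsCoefficients J α α₁ α₂ q) {K : Set ℝ}
    (hK : IsCompact K) (hKJ : K ⊆ J) (k : ℤ) : ∃ C : ℝ, ∀ x ∈ K, ∀ y,
      ‖modeCoeff α α₁ q k (x, y)‖ ≤ C := by
  obtain ⟨C, _, h⟩ := hc.exists_bound hK hKJ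
  refine ⟨|(k : ℝ)| ^ 2 * C + |(k : ℝ)| * C + C, fun x hx y => ?_⟩
  obtain ⟨h1, h2, -, h4⟩ := h x hx y
  refine (norm_sub_le _ _).trans (add_le_add ((norm_add_le _ _).trans (add_le_add ?_ ?_)) ?_)
  · simp only [norm_mul, norm_neg, norm_pow, Complex.norm_intCast, Complex.norm_real,
      Real.norm_eq_abs, abs_of_nonneg (hc.nonneg _)]
    gcongr
  · simp only [norm_mul, Complex.norm_I, one_mul, Complex.norm_intCast, Complex.norm_real,
      Real.norm_eq_abs]
    gcongr
  · rwa [Complex.norm_real, Real.norm_eq_abs]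

lemma restrict_prod_haar (K : Set ℝ) :
    ((volume : Measure ℝ).restrict K).prod (haarAddCircle : Measure Circ) =
      ((volume : Measure ℝ).prod haarAddCircle).restrict (K ×ˢ univ) := by
  rw [← Measure.prod_restrict, Measure.restrict_univ]

/-- The `k`-th Fourier coefficient `P` of a weak solution solves `-P'' = G` weakly, where `G` is
obtained from the angular part of the operator; `weak_hardy` applies to it. -/
lemma IsWeakSolution.mode_inequality (hJ : IsOpen J) (hJ' : J.OrdConnected) (h0 : (0 : ℝ) ∉ J)
    (hne : J.Nonempty) (hc : IsCoefficients J α α₁ α₂ q) (hu : IsWeakSolution J α α₁ q u)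
    {f : ℝ → ℝ} (hf : IsTest J f) (k : ℤ) {P G : ℝ → ℂ}
    (hP : P = fun x => fourierCoeff (fun y => u (x, y)) k)
    (hG : G = fun x => ∫ y, u (x, y) * conj (modeCoeff α α₁ q k (x, y) * fourier k y)
      ∂haarAddCircle) :
    Integrable (fun x => (deriv f x ^ 2 - f x ^ 2 / (4 * x ^ 2)) * ‖P x‖ ^ 2 +
      f x ^ 2 * (G x * conj (P x)).re) ∧
    0 ≤ ∫ x, ((deriv f x ^ 2 - f x ^ 2 / (4 * x ^ 2)) * ‖P x‖ ^ 2 +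
      f x ^ 2 * (G x * conj (P x)).re) := by
  have hP' : P = fun x => ∫ y, u (x, y) * conj (fourier k y) ∂haarAddCircle := by
    rw [hP]
    funext x
    simp only [fourierCoeff, smul_eq_mul, fourier_neg]
    exact integral_congr_ae (Eventually.of_forall fun y => mul_comm _ _)
  have hures : ∀ K : Set ℝ, MemLp u 2 (((volume : Measure ℝ).restrict K).prod haarAddCircle) := by
    intro K
    rw [restrict_prod_haar]
    exact hu.memLp.restrict _
  have hem : Measurable fun p : Cyl => conj (fourier k p.2 : ℂ) :=
    (Complex.continuous_conj.comp ((map_continuous (fourier k)).comp continuous_snd)).measurable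
  have hen : ∀ y : Circ, ‖conj (fourier k y : ℂ)‖ = 1 := fun y => by
    rw [RCLike.norm_conj, fourier_apply, Circle.norm_coe]
  have hmm := hc.measurable_modeCoeff k
  have hmem : Measurable fun p : Cyl => conj (modeCoeff α α₁ q k p * fourier k p.2) := by
    simp only [map_mul]
    exact (Complex.continuous_conj.measurable.comp hmm).mul hem
  have hPL : ∀ K ⊆ J, IsCompact K → MemLp P 2 (volume.restrict K) := by
    intro K _ _
    rw [hP']
    exact memLp_integral_mul (hures K) hem.aestronglyMeasurable (C := 1)
      (Eventually.of_forall fun x y => (hen y).le)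
  have hGL : ∀ K ⊆ J, IsCompact K → MemLp G 2 (volume.restrict K) := by
    intro K hKJ hK
    rw [hG]
    obtain ⟨C, hC⟩ := hc.exists_bound_modeCoeff hK hKJ k
    refine memLp_integral_mul (hures K) hmem.aestronglyMeasurable (C := C)
      ((ae_restrict_iff' hK.measurableSet).2 (Eventually.of_forall fun x hx y => ?_))
    rw [map_mul, norm_mul, hen, mul_one, RCLike.norm_conj]
    exact hC x hx y
  refine weak_hardy_complex hJ hJ' h0 hne hPL hGL (fun h hh => ?_) hf
  -- Fubini's theorem
  have hKc : IsCompact (tsupport h) := hh.compact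
  obtain ⟨C, hC⟩ := hc.exists_bound_modeCoeff hKc hh.subset k
  have hfin : IsFiniteMeasure ((volume : Measure ℝ).restrict (tsupport h)) :=
    ⟨by rw [Measure.restrict_apply_univ]; exact hKc.measure_lt_top⟩
  have huK : Integrable u (((volume : Measure ℝ).restrict (tsupport h)).prod haarAddCircle) :=
    (hures _).integrable (by norm_num)
  obtain ⟨D, hD⟩ := hh.deriv.deriv.continuous.bounded_above_of_compact_support
    hh.deriv.deriv.compact
  obtain ⟨D', hD'⟩ := hh.continuous.bounded_above_of_compact_support hh.compact
  have hz2 : ∀ x, x ∉ tsupport h → deriv (deriv h) x = 0 := fun x hx =>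
    image_eq_zero_of_notMem_tsupport fun h' =>
      hx (tsupport_deriv_subset (tsupport_deriv_subset h'))
  have hz : ∀ x, x ∉ tsupport h → h x = 0 := fun x hx => image_eq_zero_of_notMem_tsupport hx
  have hfib : ∀ (φ : ℝ → ℝ) (m : Cyl → ℂ) (D C : ℝ), Measurable φ → Measurable m →
      (∀ x, x ∉ tsupport h → φ x = 0) → (∀ x, ‖φ x‖ ≤ D) →
      (∀ x ∈ tsupport h, ∀ y, ‖m (x, y)‖ ≤ C) →
      Integrable (fun p : Cyl => (φ p.1 : ℂ) * (u p * m p))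
        ((volume : Measure ℝ).prod haarAddCircle) := by
    intro φ m D C hφ hm hφ0 hφD hmC
    have h1 : Integrable (fun p : Cyl => (φ p.1 : ℂ) * (u p * m p))
        (((volume : Measure ℝ).prod haarAddCircle).restrict (tsupport h ×ˢ univ)) := by
      rw [← restrict_prod_haar]
      have h2 : Integrable (fun p : Cyl => m p * u p)
          (((volume : Measure ℝ).restrict (tsupport h)).prod haarAddCircle) := by
        refine huK.bdd_mul hm.aestronglyMeasurable (c := C) ?_
        rw [restrict_prod_haar, ae_restrict_iff' (hKc.measurableSet.prod MeasurableSet.univ)]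
        exact Eventually.of_forall fun p hp => hmC p.1 hp.1 p.2
      have h3 : Measurable fun p : Cyl => (φ p.1 : ℂ) := by fun_prop
      refine (h2.bdd_mul h3.aestronglyMeasurable (c := D) (Eventually.of_forall fun p => ?_)).congr
        (Eventually.of_forall fun p => ?_)
      · rw [Complex.norm_real]
        exact hφD p.1
      · ring
    refine (integrableOn_iff_integrable_of_support_subset (fun p hp => ?_)).1 h1
    refine ⟨?_, mem_univ _⟩
    by_contra hx
    exact hp (by simp [hφ0 _ hx])
  have hi1 := hfib (deriv (deriv h)) (fun p => conj (fourier k p.2 : ℂ)) D 1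
    hh.deriv.deriv.continuous.measurable hem hz2 hD (fun x _ y => (hen y).le)
  have hi2 := hfib h (fun p => conj (modeCoeff α α₁ q k p * fourier k p.2)) D' C
    hh.continuous.measurable hmem hz hD' (fun x hx y => by
      rw [map_mul, norm_mul, hen, mul_one, RCLike.norm_conj]
      exact hC x hx y)
  have heq := hu.eq h hh k
  have hFe : ∀ p : Cyl, u p * conj ((deriv (deriv h) p.1 +
      h p.1 * modeCoeff α α₁ q k p) * fourier k p.2) =
      ((deriv (deriv h) p.1 : ℝ) : ℂ) * (u p * conj (fourier k p.2 : ℂ)) +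
      (h p.1 : ℂ) * (u p * conj (modeCoeff α α₁ q k p * fourier k p.2)) := by
    intro p
    simp only [map_mul, map_add, Complex.conj_ofReal]
    ring
  simp only [hFe] at heq
  rw [integral_add hi1 hi2, integral_prod _ hi1, integral_prod _ hi2,
    ← integral_add hi1.integral_prod_left hi2.integral_prod_left] at heq
  rw [← heq]
  refine integral_congr_ae (Eventually.of_forall fun x => ?_)
  simp only [hP', hG, integral_const_mul]

end Agmon

/-! ### Removal of the regularization -/

section AgmonLimit

open AddCircle (haarAddCircle)
open scoped ComplexConjugate

lemma hasSum_fourierCoeff_sq {w : Circ → ℂ} (hw : MemLp w 2 (haarAddCircle : Measure Circ)) :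
    HasSum (fun k => ‖fourierCoeff w k‖ ^ 2) (∫ y, ‖w y‖ ^ 2 ∂haarAddCircle) := by
  have h1 := hasSum_sq_fourierCoeff (T := 2 * Real.pi) (hw.toLp w)
  have h2 : ∫ y, ‖hw.toLp w y‖ ^ 2 ∂haarAddCircle = ∫ y, ‖w y‖ ^ 2 ∂haarAddCircle :=
    integral_congr_ae (by filter_upwards [hw.coeFn_toLp] with y hy; rw [hy])
  rw [h2, fourierCoeff_congr_ae hw.coeFn_toLp] at h1
  exact h1

lemma sum_mul_le_of_hasSum {a t : ℤ → ℝ} {S : ℝ} (ha : ∀ k, 0 ≤ a k) (hS : HasSum a S)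
    (ht : ∀ k, t k ≤ 1) (s : Finset ℤ) : ∑ k ∈ s, t k * a k ≤ S :=
  (Finset.sum_le_sum fun k _ => mul_le_of_le_one_left (ha k) (ht k)).trans
    (sum_le_hasSum s (fun k _ => ha k) hS)

/-- Dominated convergence for weighted partial sums. -/
lemma tendsto_sum_mul {a : ℤ → ℝ} {S : ℝ} (ha : ∀ k, 0 ≤ a k) (hS : HasSum a S)
    {t : ℕ → ℤ → ℝ} {τ : ℝ} (ht0 : ∀ n k, 0 ≤ t n k) (ht1 : ∀ n k, t n k ≤ 1)
    (ht : ∀ k, Tendsto (fun n => t n k) atTop (𝓝 τ)) :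
    Tendsto (fun n : ℕ => ∑ k ∈ Finset.Icc (-n : ℤ) n, t n k * a k) atTop (𝓝 (τ * S)) := by
  have h1 : ∀ n : ℕ, ∑ k ∈ Finset.Icc (-n : ℤ) n, t n k * a k =
      ∑' k, if k ∈ Finset.Icc (-n : ℤ) n then t n k * a k else 0 := by
    intro n
    rw [tsum_eq_sum (s := Finset.Icc (-n : ℤ) n) fun k hk => if_neg hk]
    exact Finset.sum_congr rfl fun k hk => (if_pos hk).symm
  simp only [h1]
  rw [← hS.tsum_eq, ← tsum_mul_left]
  refine tendsto_tsum_of_dominated_convergence (bound := a) hS.summable (fun k => ?_)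
    (Eventually.of_forall fun n k => ?_)
  · refine ((ht k).mul_const (a k)).congr' ?_
    filter_upwards [eventually_ge_atTop k.natAbs] with n hn
    rw [if_pos (Finset.mem_Icc.2 ⟨by omega, by omega⟩)]
  · split_ifs
    · rw [Real.norm_of_nonneg (mul_nonneg (ht0 n k) (ha k))]
      exact mul_le_of_le_one_left (ha k) (ht1 n k)
    · simpa using ha k

lemma tendsto_smoothing {ε : ℕ → ℝ} (h : Tendsto ε atTop (𝓝 0)) (k : ℤ) :
    Tendsto (fun n => smoothing (ε n) k) atTop (𝓝 1) := by
  have h1 : Tendsto (fun n => 1 + ε n * (k : ℝ) ^ 2) atTop (𝓝 1) := by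
    simpa using (h.mul_const ((k : ℝ) ^ 2)).const_add 1
  simpa [smoothing] using h1.inv₀ one_ne_zero

/-- The weight `ε k² (1 + ε k²)⁻²` of the commutator term. -/
def commWeight (ε : ℝ) (k : ℤ) : ℝ := ε * (k : ℝ) ^ 2 * smoothing ε k ^ 2

lemma commWeight_nonneg {ε : ℝ} (hε : 0 < ε) (k : ℤ) : 0 ≤ commWeight ε k := by
  unfold commWeight
  positivity

lemma commWeight_le_one {ε : ℝ} (hε : 0 < ε) (k : ℤ) : commWeight ε k ≤ 1 := by
  have h1 := smoothing_mul hε k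
  have h2 := smoothing_pos hε k
  have h3 := smoothing_le_one hε k
  have h4 : commWeight ε k = (1 - smoothing ε k) * smoothing ε k := by
    unfold commWeight
    linear_combination smoothing ε k * h1
  rw [h4]
  nlinarith

lemma tendsto_commWeight {ε : ℕ → ℝ} (h : Tendsto ε atTop (𝓝 0)) (k : ℤ) :
    Tendsto (fun n => commWeight (ε n) k) atTop (𝓝 0) := by
  simpa [commWeight] using (h.mul_const ((k : ℝ) ^ 2)).mul ((tendsto_smoothing h k).pow 2)

variable {J : Set ℝ} {α α₁ α₂ q : Cyl → ℝ} {u : Cyl → ℂ}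

/-- The inequality for the truncated and regularized solution, with all error terms. -/
lemma IsWeakSolution.regularized_inequality (hJ : IsOpen J) (hJ' : J.OrdConnected)
    (h0 : (0 : ℝ) ∉ J) (hne : J.Nonempty) (hc : IsCoefficients J α α₁ α₂ q)
    (hu : IsWeakSolution J α α₁ q u) {f : ℝ → ℝ} (hf : IsTest J f) {C : ℝ}
    (hC : ∀ x ∈ tsupport f, ∀ y, α (x, y) ≤ C ∧ |α₁ (x, y)| ≤ C ∧ α₂ (x, y) ≤ C ∧ |q (x, y)| ≤ C)
    {ε : ℝ} (hε : 0 < ε) (s : Finset ℤ) {F : ℝ → ℝ} (hFi : Integrable F)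
    (hF : ∀ᵐ x, F x = (deriv f x ^ 2 - f x ^ 2 / (4 * x ^ 2)) *
        ∑ k ∈ s, smoothing ε k * ‖fourierCoeff (fun y => u (x, y)) k‖ ^ 2 +
      f x ^ 2 * (C / 2 * ∑ k ∈ s, commWeight ε k * ‖fourierCoeff (fun y => u (x, y)) k‖ ^ 2 +
        2 * C / ε * (√(∫ y, ‖u (x, y)‖ ^ 2 ∂haarAddCircle) *
          √(∫ y, ‖u (x, y)‖ ^ 2 ∂haarAddCircle -
            ∑ k ∈ s, ‖fourierCoeff (fun y => u (x, y)) k‖ ^ 2)) +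
        C * (√(∫ y, ‖u (x, y)‖ ^ 2 ∂haarAddCircle) *
          √(∫ y, ‖u (x, y)‖ ^ 2 ∂haarAddCircle -
            ∑ k ∈ s, ‖fourierCoeff (fun y => u (x, y)) k‖ ^ 2 +
            ∑ k ∈ s, (1 - smoothing ε k) ^ 2 * ‖fourierCoeff (fun y => u (x, y)) k‖ ^ 2)) -
        ∫ y, q (x, y) * ‖u (x, y)‖ ^ 2 ∂haarAddCircle)) :
    0 ≤ ∫ x, F x := by
  set P : ℤ → ℝ → ℂ := fun k x => fourierCoeff (fun y => u (x, y)) k with hP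
  set G : ℤ → ℝ → ℂ := fun k x =>
    ∫ y, u (x, y) * conj (modeCoeff α α₁ q k (x, y) * fourier k y) ∂haarAddCircle with hG
  have hm : ∀ k, _ := fun k =>
    hu.mode_inequality hJ hJ' h0 hne hc hf k (P := P k) (G := G k) rfl rfl
  have hsum : 0 ≤ ∫ x, ∑ k ∈ s, smoothing ε k *
      ((deriv f x ^ 2 - f x ^ 2 / (4 * x ^ 2)) * ‖P k x‖ ^ 2 +
        f x ^ 2 * (G k x * conj (P k x)).re) := by
    rw [integral_finsetSum _ fun k _ => (hm k).1.const_mul _]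
    refine Finset.sum_nonneg fun k _ => ?_
    rw [integral_const_mul]
    exact mul_nonneg (smoothing_pos hε k).le (hm k).2
  refine hsum.trans (integral_mono_ae
    (integrable_finsetSum _ fun k _ => (hm k).1.const_mul _) hFi ?_)
  have hsq : Integrable (fun p => ‖u p‖ ^ 2) ((volume : Measure ℝ).prod haarAddCircle) :=
    hu.memLp.integrable_norm_pow (by simp)
  filter_upwards [hF, hu.memLp.1.prodMk_left, hsq.prod_right_ae] with x hFx hx1 hx2
  have hw : MemLp (fun y => u (x, y)) 2 haarAddCircle :=
    (memLp_two_iff_integrable_sq_norm hx1).2 hx2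
  rw [hFx]
  have hrew : ∑ k ∈ s, smoothing ε k *
      ((deriv f x ^ 2 - f x ^ 2 / (4 * x ^ 2)) * ‖P k x‖ ^ 2 +
        f x ^ 2 * (G k x * conj (P k x)).re) =
      (deriv f x ^ 2 - f x ^ 2 / (4 * x ^ 2)) * ∑ k ∈ s, smoothing ε k * ‖P k x‖ ^ 2 +
      f x ^ 2 * ∑ k ∈ s, smoothing ε k * (G k x * conj (P k x)).re := by
    rw [Finset.mul_sum, Finset.mul_sum, ← Finset.sum_add_distrib]
    exact Finset.sum_congr rfl fun k _ => by ring
  simp only [hrew]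
  refine add_le_add le_rfl ?_
  by_cases hx : x ∈ tsupport f
  swap
  · simp [image_eq_zero_of_notMem_tsupport hx]
  refine mul_le_mul_of_nonneg_left ?_ (sq_nonneg _)
  have hCx := hC x hx
  have hqx : Measurable fun y => ((q (x, y) : ℝ) : ℂ) := by
    have := hc.meas
    fun_prop
  have h5 := re_integral_mul_conj_le hw (a := fun y => α (x, y)) (a₁ := fun y => α₁ (x, y))
    (a₂ := fun y => α₂ (x, y)) (q := fun y => ((q (x, y) : ℝ) : ℂ)) (A := C) (M := C) (B := C) hε
    (hc.deriv₁ x) (hc.deriv₂ x) (hc.cont.comp (by fun_prop)) (hc.cont₁.comp (by fun_prop))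
    (hc.cont₂.comp (by fun_prop)) (fun y => hc.nonneg _) (fun y => (hCx y).1)
    (fun y => (hCx y).2.1) (fun y => (hCx y).2.2.1) hqx.aestronglyMeasurable
    (fun y => by rw [Complex.norm_real, Real.norm_eq_abs]; exact (hCx y).2.2.2) s
  have hlhs : ∑ k ∈ s, smoothing ε k * (G k x * conj (P k x)).re =
      (∫ y, u (x, y) * conj (∑ k ∈ s, (smoothing ε k * fourierCoeff (fun y => u (x, y)) k) *
        ((-(k : ℂ) ^ 2 * α (x, y) + Complex.I * k * α₁ (x, y) - q (x, y)) * fourier k y))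
          ∂haarAddCircle).re := by
    have hi : ∀ k, Integrable (fun y => u (x, y) *
        conj (modeCoeff α α₁ q k (x, y) * fourier k y)) haarAddCircle := by
      intro k
      refine integrable_mul_conj hw ?_
      have hmm := hc.measurable_modeCoeff k
      obtain ⟨D, hD⟩ := hc.exists_bound_modeCoeff hf.compact hf.subset k
      have hfm := (map_continuous (fourier (T := 2 * Real.pi) k)).measurable
      refine MemLp.of_bound (C := D) ((hmm.comp measurable_prodMk_left).mul
        hfm).aestronglyMeasurable (Eventually.of_forall fun y => ?_)
      rw [norm_mul, fourier_apply, Circle.norm_coe, mul_one]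
      exact hD x hx y
    have h6 : ∀ y, u (x, y) * conj (∑ k ∈ s,
        (smoothing ε k * fourierCoeff (fun y => u (x, y)) k) *
        ((-(k : ℂ) ^ 2 * α (x, y) + Complex.I * k * α₁ (x, y) - q (x, y)) * fourier k y)) =
        ∑ k ∈ s, (smoothing ε k * conj (P k x)) * (u (x, y) *
          conj (modeCoeff α α₁ q k (x, y) * fourier k y)) := by
      intro y
      rw [map_sum, Finset.mul_sum]
      refine Finset.sum_congr rfl fun k _ => ?_
      rw [map_mul, map_mul (starRingEnd ℂ) (smoothing ε k : ℂ), Complex.conj_ofReal]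
      simp only [hP, modeCoeff]
      ring
    simp only [h6]
    rw [integral_finsetSum _ fun k _ => (hi k).const_mul _, Complex.re_sum]
    refine Finset.sum_congr rfl fun k _ => ?_
    rw [integral_const_mul, mul_assoc, Complex.re_ofReal_mul, mul_comm (conj (P k x))]
  rw [hlhs]
  refine h5.trans (le_of_eq ?_)
  simp only [commWeight, Complex.ofReal_re]

/-- A weak solution satisfies `∫ f² |u|² (1 / (4 x²) + q) ≤ ∫ f'² |u|²`. It is
the limit of `regularized_inequality` as the number of modes tends to infinity and `ε` tends to `0`
slowly enough for the error terms to vanish. -/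
theorem IsWeakSolution.weighted_inequality (hJ : IsOpen J) (hJ' : J.OrdConnected)
    (h0 : (0 : ℝ) ∉ J) (hne : J.Nonempty) (hc : IsCoefficients J α α₁ α₂ q)
    (hu : IsWeakSolution J α α₁ q u) {f : ℝ → ℝ} (hf : IsTest J f) :
    0 ≤ ∫ p : Cyl, (deriv f p.1 ^ 2 - f p.1 ^ 2 / (4 * p.1 ^ 2) - f p.1 ^ 2 * q p) * ‖u p‖ ^ 2
      ∂((volume : Measure ℝ).prod haarAddCircle) := by
  obtain ⟨C, hC0, hC⟩ := hc.exists_bound hf.compact hf.subset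
  set g : ℝ → ℝ := fun x => deriv f x ^ 2 - f x ^ 2 / (4 * x ^ 2) with hg
  set b : ℤ → ℝ → ℝ := fun k x => ‖fourierCoeff (fun y => u (x, y)) k‖ ^ 2 with hb
  set e : ℝ → ℝ := fun x => ∫ y, ‖u (x, y)‖ ^ 2 ∂haarAddCircle with he
  set V : ℝ → ℝ := fun x => ∫ y, q (x, y) * ‖u (x, y)‖ ^ 2 ∂haarAddCircle with hV
  have hf0 : ∀ x, x ∉ tsupport f → f x = 0 := fun x hx => image_eq_zero_of_notMem_tsupport hx
  have hf0' : ∀ x, x ∉ tsupport f → deriv f x = 0 := fun x hx =>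
    image_eq_zero_of_notMem_tsupport fun h => hx (tsupport_deriv_subset h)
  have hfm := hf.continuous.measurable
  have hfm' := hf.deriv.continuous.measurable
  have hgm : Measurable g := by fun_prop
  -- bounds for the weights
  obtain ⟨D, hD0, hDg, hDf⟩ : ∃ D : ℝ, 0 ≤ D ∧ (∀ x, |g x| ≤ D) ∧ ∀ x, f x ^ 2 ≤ D := by
    have h1 : ContinuousOn g (tsupport f) := by
      refine (hf.deriv.continuous.pow 2).continuousOn.sub
        ((hf.continuous.pow 2).continuousOn.div (by fun_prop) fun x hx => ?_)
      have : x ≠ 0 := fun h => h0 (h ▸ hf.subset hx)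
      positivity
    have hcomp : IsCompact (tsupport f) := hf.compact
    obtain ⟨D1, h1⟩ := hcomp.exists_bound_of_continuousOn h1
    obtain ⟨D2, h2⟩ := hcomp.exists_bound_of_continuousOn (hf.continuous.pow 2).continuousOn
    refine ⟨|D1| + |D2|, by positivity, fun x => ?_, fun x => ?_⟩
    · by_cases hx : x ∈ tsupport f
      · have := h1 x hx
        rw [Real.norm_eq_abs] at this
        linarith [le_abs_self D1, abs_nonneg D2]
      · simp only [hg, hf0 x hx, hf0' x hx]
        simp only [ne_eq, OfNat.ofNat_ne_zero, not_false_eq_true, zero_pow, zero_div, sub_self,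
          abs_zero]
        positivity
    · by_cases hx : x ∈ tsupport f
      · have := h2 x hx
        rw [Real.norm_eq_abs, Pi.pow_apply] at this
        linarith [le_abs_self D2, abs_nonneg D1, le_abs_self (f x ^ 2)]
      · rw [hf0 x hx]
        simp only [ne_eq, OfNat.ofNat_ne_zero, not_false_eq_true, zero_pow]
        positivity
  have hsq : Integrable (fun p => ‖u p‖ ^ 2) ((volume : Measure ℝ).prod haarAddCircle) :=
    hu.memLp.integrable_norm_pow (by simp)
  have hei : Integrable e := hsq.integral_prod_left
  have hgp : Integrable (fun p : Cyl => g p.1 * ‖u p‖ ^ 2)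
      ((volume : Measure ℝ).prod haarAddCircle) :=
    hsq.bdd_mul (hgm.comp measurable_fst).aestronglyMeasurable (c := D)
      (Eventually.of_forall fun p => hDg _)
  have hVp : Integrable (fun p : Cyl => f p.1 ^ 2 * q p * ‖u p‖ ^ 2)
      ((volume : Measure ℝ).prod haarAddCircle) := by
    have hqm := hc.meas
    refine hsq.bdd_mul (c := D * C) (by fun_prop : Measurable fun p : Cyl =>
      f p.1 ^ 2 * q p).aestronglyMeasurable (Eventually.of_forall fun p => ?_)
    rw [norm_mul, Real.norm_of_nonneg (sq_nonneg _)]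
    by_cases hx : p.1 ∈ tsupport f
    · exact mul_le_mul (hDf _) (hC p.1 hx p.2).2.2.2 (norm_nonneg _) hD0
    · rw [hf0 _ hx]
      simp only [ne_eq, OfNat.ofNat_ne_zero, not_false_eq_true, zero_pow, zero_mul]
      positivity
  have hVi : Integrable fun x => f x ^ 2 * V x := by
    refine hVp.integral_prod_left.congr (Eventually.of_forall fun x => ?_)
    simp only [hV, ← integral_const_mul, mul_assoc]
  -- Parseval's identity on almost every circle
  have hpars : ∀ᵐ x, HasSum (fun k => b k x) (e x) := by
    filter_upwards [hu.memLp.1.prodMk_left, hsq.prod_right_ae] with x hx1 hx2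
    exact hasSum_fourierCoeff_sq ((memLp_two_iff_integrable_sq_norm hx1).2 hx2)
  have hb0 : ∀ k x, 0 ≤ b k x := fun k x => sq_nonneg _
  have he0 : ∀ x, 0 ≤ e x := fun x => by positivity
  have hem : AEStronglyMeasurable e volume := hei.1
  have hbm : ∀ k, AEStronglyMeasurable (b k) volume := by
    intro k
    have h1 : Measurable fun p : Cyl => (fourier (-k) p.2 : ℂ) :=
      ((map_continuous (fourier (-k))).comp continuous_snd).measurable
    exact (AEStronglyMeasurable.integral_prod_right' (μ := volume) (ν := haarAddCircle)
      (h1.aestronglyMeasurable.mul hu.memLp.1)).norm.pow 2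
  have hsm : ∀ (t : ℤ → ℝ) (s : Finset ℤ),
      AEStronglyMeasurable (fun x => ∑ k ∈ s, t k * b k x) volume := fun t s =>
    Finset.aestronglyMeasurable_fun_sum _ fun k _ => (hbm k).const_mul _
  have hsm1 : ∀ s : Finset ℤ, AEStronglyMeasurable (fun x => ∑ k ∈ s, b k x) volume := fun s =>
    Finset.aestronglyMeasurable_fun_sum _ fun k _ => hbm k
  set s : ℕ → Finset ℤ := fun n => Finset.Icc (-n : ℤ) n with hs
  have hle1 : ∀ {x}, HasSum (fun k => b k x) (e x) → ∀ n, ∑ k ∈ s n, b k x ≤ e x :=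
    fun hx n => sum_le_hasSum _ (fun k _ => hb0 k _) hx
  have htend1 : ∀ {x}, HasSum (fun k => b k x) (e x) →
      Tendsto (fun n => ∑ k ∈ s n, b k x) atTop (𝓝 (e x)) := by
    intro x hx
    have := tendsto_sum_mul (fun k => hb0 k x) hx (t := fun _ _ => 1) (τ := 1) (by simp) (by simp)
      (fun k => tendsto_const_nhds)
    simpa only [one_mul] using this
  -- the truncation error tends to zero
  set T : ℕ → ℝ → ℝ := fun n x => f x ^ 2 * (√(e x) * √(e x - ∑ k ∈ s n, b k x)) with hT
  have hTm : ∀ n, AEStronglyMeasurable (T n) volume := fun n =>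
    (hfm.pow_const 2).aestronglyMeasurable.mul
      ((Real.continuous_sqrt.comp_aestronglyMeasurable hem).mul
        (Real.continuous_sqrt.comp_aestronglyMeasurable (hem.sub (hsm1 _))))
  have hsqrt : ∀ {x r : ℝ}, 0 ≤ r → r ≤ e x → √(e x) * √r ≤ e x := by
    intro x r h1 h2
    calc √(e x) * √r ≤ √(e x) * √(e x) :=
          mul_le_mul_of_nonneg_left (Real.sqrt_le_sqrt h2) (Real.sqrt_nonneg _)
      _ = e x := Real.mul_self_sqrt (he0 x)
  have hTb : ∀ n, ∀ᵐ x, ‖T n x‖ ≤ D * e x := by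
    intro n
    filter_upwards [hpars] with x hx
    rw [Real.norm_of_nonneg (by positivity)]
    refine mul_le_mul (hDf x) (hsqrt (sub_nonneg.2 (hle1 hx n)) ?_) (by positivity) hD0
    linarith [Finset.sum_nonneg fun k (_ : k ∈ s n) => hb0 k x]
  have hTi : ∀ n, Integrable (T n) := fun n => (hei.const_mul D).mono' (hTm n) (hTb n)
  set δ : ℕ → ℝ := fun n => ∫ x, T n x with hδ
  have hδ0 : ∀ n, 0 ≤ δ n := fun n => integral_nonneg fun x => by positivity
  have hδl : Tendsto δ atTop (𝓝 0) := by
    have h1 := tendsto_integral_of_dominated_convergence (μ := volume) (F := T)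
      (f := fun _ => (0 : ℝ)) (fun x => D * e x) hTm (hei.const_mul D) hTb (by
        filter_upwards [hpars] with x hx
        have h2 : Tendsto (fun n => e x - ∑ k ∈ s n, b k x) atTop (𝓝 0) := by
          simpa using (htend1 hx).const_sub (e x)
        have h3 := (h2.sqrt.const_mul (√(e x))).const_mul (f x ^ 2)
        simpa using h3)
    simpa using h1
  -- `ε` tends to zero so slowly that the truncation error divided by `ε` still tends to zero
  set ε : ℕ → ℝ := fun n => √(δ n) + 1 / ((n : ℝ) + 1) with hε
  have hεpos : ∀ n, 0 < ε n := fun n => by positivity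
  have hεl : Tendsto ε atTop (𝓝 0) := by
    have h1 := hδl.sqrt.add (tendsto_one_div_add_atTop_nhds_zero_nat (𝕜 := ℝ))
    rwa [Real.sqrt_zero, add_zero] at h1
  have hδε : Tendsto (fun n => 2 * C / ε n * δ n) atTop (𝓝 0) := by
    refine squeeze_zero (g := fun n => 2 * C * √(δ n)) (fun n => ?_) (fun n => ?_) ?_
    · have := hεpos n
      have := hδ0 n
      positivity
    · rw [div_mul_eq_mul_div, div_le_iff₀ (hεpos n)]
      have h1 := Real.mul_self_sqrt (hδ0 n)
      have h2 : √(δ n) ≤ ε n := by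
        simp only [hε]
        have : 0 ≤ 1 / ((n : ℝ) + 1) := by positivity
        linarith
      have h3 := mul_le_mul_of_nonneg_left h2 (Real.sqrt_nonneg (δ n))
      nlinarith
    · simpa using hδl.sqrt.const_mul (2 * C)
  -- the remaining terms converge by dominated convergence
  set M : ℕ → ℝ → ℝ := fun n x => g x * ∑ k ∈ s n, smoothing (ε n) k * b k x +
    f x ^ 2 * (C / 2 * ∑ k ∈ s n, commWeight (ε n) k * b k x + C * (√(e x) *
      √(e x - ∑ k ∈ s n, b k x + ∑ k ∈ s n, (1 - smoothing (ε n) k) ^ 2 * b k x))) with hM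
  have hw0 : ∀ n k, 0 ≤ (1 - smoothing (ε n) k) ^ 2 := fun n k => sq_nonneg _
  have hw1 : ∀ n k, (1 - smoothing (ε n) k) ^ 2 ≤ 1 := fun n k => by
    have h1 := smoothing_pos (hεpos n) k
    have h2 := smoothing_le_one (hεpos n) k
    nlinarith
  have hMm : ∀ n, AEStronglyMeasurable (M n) volume := fun n =>
    (hgm.aestronglyMeasurable.mul (hsm _ _)).add
      ((hfm.pow_const 2).aestronglyMeasurable.mul (((hsm _ _).const_mul _).add
        (((Real.continuous_sqrt.comp_aestronglyMeasurable hem).mul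
          (Real.continuous_sqrt.comp_aestronglyMeasurable
            ((hem.sub (hsm1 _)).add (hsm _ _)))).const_mul _)))
  have hMb : ∀ n, ∀ᵐ x, ‖M n x‖ ≤ (D + D * (C / 2 + C)) * e x := by
    intro n
    filter_upwards [hpars] with x hx
    have h1 := sum_mul_le_of_hasSum (fun k => hb0 k x) hx
      (fun k => smoothing_le_one (hεpos n) k) (s n)
    have h2 := sum_mul_le_of_hasSum (fun k => hb0 k x) hx
      (fun k => commWeight_le_one (hεpos n) k) (s n)
    have h1' : 0 ≤ ∑ k ∈ s n, smoothing (ε n) k * b k x := Finset.sum_nonneg fun k _ =>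
      mul_nonneg (smoothing_pos (hεpos n) k).le (hb0 k x)
    have h2' : 0 ≤ ∑ k ∈ s n, commWeight (ε n) k * b k x := Finset.sum_nonneg fun k _ =>
      mul_nonneg (commWeight_nonneg (hεpos n) k) (hb0 k x)
    have h3' : 0 ≤ ∑ k ∈ s n, (1 - smoothing (ε n) k) ^ 2 * b k x := Finset.sum_nonneg fun k _ =>
      mul_nonneg (hw0 n k) (hb0 k x)
    have h3 : ∑ k ∈ s n, (1 - smoothing (ε n) k) ^ 2 * b k x ≤ ∑ k ∈ s n, b k x :=
      Finset.sum_le_sum fun k _ => mul_le_of_le_one_left (hb0 k x) (hw1 n k)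
    have h4 := hle1 hx n
    have h5 := hsqrt (x := x) (r := e x - ∑ k ∈ s n, b k x +
      ∑ k ∈ s n, (1 - smoothing (ε n) k) ^ 2 * b k x) (by linarith) (by linarith)
    have h6 : 0 ≤ √(e x) * √(e x - ∑ k ∈ s n, b k x +
      ∑ k ∈ s n, (1 - smoothing (ε n) k) ^ 2 * b k x) := by positivity
    have h7 : C / 2 * ∑ k ∈ s n, commWeight (ε n) k * b k x + C * (√(e x) *
        √(e x - ∑ k ∈ s n, b k x + ∑ k ∈ s n, (1 - smoothing (ε n) k) ^ 2 * b k x)) ≤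
        C / 2 * e x + C * e x := by
      gcongr
    have h8 : 0 ≤ C / 2 * ∑ k ∈ s n, commWeight (ε n) k * b k x + C * (√(e x) *
        √(e x - ∑ k ∈ s n, b k x + ∑ k ∈ s n, (1 - smoothing (ε n) k) ^ 2 * b k x)) := by
      positivity
    calc ‖M n x‖ ≤ D * e x + D * (C / 2 * e x + C * e x) := by
          refine (norm_add_le _ _).trans (add_le_add ?_ ?_)
          · rw [norm_mul, Real.norm_eq_abs, Real.norm_of_nonneg h1']
            exact mul_le_mul (hDg x) h1 h1' hD0
          · rw [norm_mul, Real.norm_of_nonneg (sq_nonneg _), Real.norm_of_nonneg h8]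
            exact mul_le_mul (hDf x) h7 h8 hD0
      _ = _ := by ring
  have hMi : ∀ n, Integrable (M n) := fun n => (hei.const_mul _).mono' (hMm n) (hMb n)
  have hMl : Tendsto (fun n => ∫ x, M n x) atTop (𝓝 (∫ x, g x * e x)) := by
    refine tendsto_integral_of_dominated_convergence _ hMm (hei.const_mul _) hMb ?_
    filter_upwards [hpars] with x hx
    have h1 := tendsto_sum_mul (fun k => hb0 k x) hx (fun n k => (smoothing_pos (hεpos n) k).le)
      (fun n k => smoothing_le_one (hεpos n) k) (tendsto_smoothing hεl)
    have h2 := tendsto_sum_mul (fun k => hb0 k x) hx (fun n k => commWeight_nonneg (hεpos n) k)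
      (fun n k => commWeight_le_one (hεpos n) k) (tendsto_commWeight hεl)
    have h3 := tendsto_sum_mul (fun k => hb0 k x) hx hw0 hw1 (τ := 0) fun k => by
      simpa using ((tendsto_smoothing hεl k).const_sub 1).pow 2
    have h4 := (h1.const_mul (g x)).add (((h2.const_mul (C / 2)).add
      ((((htend1 hx).const_sub (e x)).add h3).sqrt.const_mul (√(e x)) |>.const_mul C)).const_mul
        (f x ^ 2))
    simpa using h4
  have hfin : ∀ n, 0 ≤ (∫ x, M n x) + 2 * C / ε n * δ n - ∫ x, f x ^ 2 * V x := by
    intro n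
    have h1 := hu.regularized_inequality hJ hJ' h0 hne hc hf hC (hεpos n) (s n)
      (F := fun x => M n x + 2 * C / ε n * T n x - f x ^ 2 * V x)
      (((hMi n).add ((hTi n).const_mul _)).sub hVi) (Eventually.of_forall fun x => by
        simp only [hM, hT, hg]
        ring)
    have h2 : Integrable fun x => M n x + 2 * C / ε n * T n x :=
      (hMi n).add ((hTi n).const_mul _)
    rw [integral_sub h2 hVi, integral_add (hMi n) ((hTi n).const_mul _), integral_const_mul] at h1
    exact h1
  have hlim := ge_of_tendsto' ((hMl.add hδε).sub_const (∫ x, f x ^ 2 * V x)) hfin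
  have hend : ∫ p : Cyl, (deriv f p.1 ^ 2 - f p.1 ^ 2 / (4 * p.1 ^ 2) - f p.1 ^ 2 * q p) *
      ‖u p‖ ^ 2 ∂((volume : Measure ℝ).prod haarAddCircle) =
      (∫ x, g x * e x) + 0 - ∫ x, f x ^ 2 * V x := by
    have h1 : ∫ x, g x * e x = ∫ p : Cyl, g p.1 * ‖u p‖ ^ 2
        ∂((volume : Measure ℝ).prod haarAddCircle) := by
      rw [integral_prod _ hgp]
      simp only [he, integral_const_mul]
    have h2 : ∫ x, f x ^ 2 * V x = ∫ p : Cyl, f p.1 ^ 2 * q p * ‖u p‖ ^ 2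
        ∂((volume : Measure ℝ).prod haarAddCircle) := by
      rw [integral_prod _ hVp]
      simp only [hV, ← integral_const_mul, mul_assoc]
    rw [h1, h2, add_zero, ← integral_sub hgp hVp]
    exact integral_congr_ae (Eventually.of_forall fun p => by simp only [hg]; ring)
  rw [hend]
  exact hlim

end AgmonLimit

/-! ### Conjugation to a flat cylinder -/

section Conjugation

open AddCircle (haarAddCircle)
open scoped ComplexConjugate

/-- The derivative `∂ₓ` of a real function on the cylinder. -/
def dx (f : Cyl → ℝ) (p : Cyl) : ℝ := deriv (fun s : ℝ => f (s, p.2)) p.1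

/-- The derivative `∂_y` of a real function on the cylinder. -/
def dy (f : Cyl → ℝ) (p : Cyl) : ℝ := deriv (fun s : ℝ => f (p.1, p.2 + (s : Circ))) 0

lemma hasDerivAt_x_aux {E : Type*} [NormedAddCommGroup E] [NormedSpace ℝ E] {f : Cyl → E}
    (hf : IsSmooth f) (x t : ℝ) : HasDerivAt (fun s : ℝ => f (s, (t : Circ)))
    (fderiv ℝ (fun q => f (cover q)) (x, t) (1, 0)) x := by
  have hd : DifferentiableAt ℝ (fun q => f (cover q)) (x, t) :=
    (ContDiff.differentiable hf (by simp)).differentiableAt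
  have h1 : HasDerivAt (fun s : ℝ => (s, t)) ((1 : ℝ), (0 : ℝ)) x :=
    (hasDerivAt_id _).prodMk (hasDerivAt_const _ _)
  exact HasFDerivAt.comp_hasDerivAt (f := fun s : ℝ => (s, t)) x hd.hasFDerivAt h1

lemma hasDerivAt_y_aux {E : Type*} [NormedAddCommGroup E] [NormedSpace ℝ E] {f : Cyl → E}
    (hf : IsSmooth f) (x t : ℝ) : HasDerivAt (fun s : ℝ => f (x, (s : Circ)))
    (fderiv ℝ (fun q => f (cover q)) (x, t) (0, 1)) t := by
  have hd : DifferentiableAt ℝ (fun q => f (cover q)) (x, t) :=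
    (ContDiff.differentiable hf (by simp)).differentiableAt
  have h1 : HasDerivAt (fun s : ℝ => (x, s)) ((0 : ℝ), (1 : ℝ)) t :=
    (hasDerivAt_const _ _).prodMk (hasDerivAt_id _)
  exact HasFDerivAt.comp_hasDerivAt (f := fun s : ℝ => (x, s)) t hd.hasFDerivAt h1

section RealDerivatives

variable {f : Cyl → ℝ}

lemma dy_coe (hf : IsSmooth f) (x t : ℝ) :
    dy f (x, (t : Circ)) = fderiv ℝ (fun q => f (cover q)) (x, t) (0, 1) := by
  have h1 := hasDerivAt_y_aux hf x t
  rw [← add_zero t] at h1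
  simpa [dy, AddCircle.coe_add] using (h1.comp_const_add t 0).deriv

lemma IsSmooth.hasDerivAt_dx (hf : IsSmooth f) (x : ℝ) (y : Circ) :
    HasDerivAt (fun s : ℝ => f (s, y)) (dx f (x, y)) x := by
  obtain ⟨t, rfl⟩ := QuotientAddGroup.mk_surjective y
  exact (hasDerivAt_x_aux hf x t).differentiableAt.hasDerivAt

lemma IsSmooth.hasDerivAt_dy (hf : IsSmooth f) (x t : ℝ) :
    HasDerivAt (fun s : ℝ => f (x, (s : Circ))) (dy f (x, (t : Circ))) t := by
  rw [dy_coe hf]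
  exact hasDerivAt_y_aux hf x t

lemma IsSmooth.dx (hf : IsSmooth f) : IsSmooth (dx f) := by
  have h : (fun q => AlmostRiem.dx f (cover q)) =
      fun q => fderiv ℝ (fun q => f (cover q)) q (1, 0) :=
    funext fun q => (hasDerivAt_x_aux hf q.1 q.2).deriv
  unfold IsSmooth
  rw [h]
  exact (ContDiff.fderiv_right (m := ∞) hf (by simp)).clm_apply contDiff_const

lemma IsSmooth.dy (hf : IsSmooth f) : IsSmooth (dy f) := by
  have h : (fun q => AlmostRiem.dy f (cover q)) =
      fun q => fderiv ℝ (fun q => f (cover q)) q (0, 1) :=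
    funext fun q => dy_coe hf q.1 q.2
  unfold IsSmooth
  rw [h]
  exact (ContDiff.fderiv_right (m := ∞) hf (by simp)).clm_apply contDiff_const

end RealDerivatives

lemma pderiv_one_of_hasDerivAt {f : Cyl → ℂ} {d : ℂ} {x t : ℝ}
    (h : HasDerivAt (fun s : ℝ => f (x, (s : Circ))) d t) : pderiv 1 f (x, (t : Circ)) = d := by
  rw [← add_zero t] at h
  simpa [pderiv_one, AddCircle.coe_add] using (h.comp_const_add t 0).deriv

lemma pderiv_zero_of_hasDerivAt {f : Cyl → ℂ} {d : ℂ} {x : ℝ} {y : Circ}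
    (h : HasDerivAt (fun s : ℝ => f (s, y)) d x) : pderiv 0 f (x, y) = d := h.deriv

/-- Since `ω g^{-1} = diag (ω, ω⁻¹)`, the Laplacian is `ω⁻¹ (∂ₓ ω ∂ₓ + ∂_y ω⁻¹ ∂_y)`. On `x = 0`
this holds because `ω` takes the junk value `0` there. -/
lemma laplaceBeltrami_eq (Φ : Cyl → ℝ) (φ : Cyl → ℂ) (p : Cyl) :
    laplaceBeltrami Φ φ p = ((areaDensity Φ p)⁻¹ : ℝ) *
      (pderiv 0 (fun q => ((areaDensity Φ q : ℝ) : ℂ) * pderiv 0 φ q) p +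
        pderiv 1 (fun q => (((areaDensity Φ q)⁻¹ : ℝ) : ℂ) * pderiv 1 φ q) p) := by
  have key : ∀ (q : Cyl), (areaDensity Φ q * (metric Φ q)⁻¹ 0 0 = areaDensity Φ q ∧
      areaDensity Φ q * (metric Φ q)⁻¹ 1 1 = (areaDensity Φ q)⁻¹) ∧
      areaDensity Φ q * (metric Φ q)⁻¹ 0 1 = 0 ∧ areaDensity Φ q * (metric Φ q)⁻¹ 1 0 = 0 := by
    intro q
    by_cases h0 : q.1 = 0
    · have : areaDensity Φ q = 0 := by simp [areaDensity_eq, h0]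
      simp [this]
    · have hinv : (metric Φ q)⁻¹ = Matrix.diagonal ![1, q.1 ^ 2 * Real.exp (2 * Φ q)] := by
        refine Matrix.inv_eq_right_inv ?_
        rw [metric, Matrix.diagonal_mul_diagonal, ← Matrix.diagonal_one]
        congr 1
        funext k
        fin_cases k
        · simp
        · have h1 : Real.exp (-2 * Φ q) * Real.exp (2 * Φ q) = 1 := by
            rw [← Real.exp_add]; simp
          have h2 : q.1 ^ (-2 : ℤ) * q.1 ^ 2 = 1 := by
            rw [zpow_neg]
            exact inv_mul_cancel₀ (pow_ne_zero 2 h0)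
          simp only [Fin.mk_one, Matrix.cons_val_one, Matrix.cons_val_fin_one]
          linear_combination Real.exp (-2 * Φ q) * Real.exp (2 * Φ q) * h2 + h1
      have h3 : areaDensity Φ q ^ 2 * (q.1 ^ 2 * Real.exp (2 * Φ q)) = 1 := by
        have h4 : Real.exp (-Φ q) ^ 2 * Real.exp (2 * Φ q) = 1 := by
          rw [← Real.exp_nat_mul, ← Real.exp_add]; simp
        rw [areaDensity_eq, mul_pow, inv_pow, sq_abs]
        have h5 : (q.1 ^ 2)⁻¹ * q.1 ^ 2 = 1 := inv_mul_cancel₀ (pow_ne_zero 2 h0)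
        linear_combination Real.exp (-Φ q) ^ 2 * Real.exp (2 * Φ q) * h5 + h4
      rw [hinv]
      have h6 := (areaDensity_pos Φ (p := q) h0).ne'
      refine ⟨⟨by simp, ?_⟩, by simp, by simp⟩
      simp only [Matrix.diagonal_apply_eq, Matrix.cons_val_one, Matrix.cons_val_fin_one]
      field_simp
      linear_combination h3
  have hz : ∀ (i : Fin 2), pderiv i (fun _ => (0 : ℂ)) p = 0 := fun i =>
    pderiv_eq_zero i (by
      have : tsupport (fun _ : Cyl => (0 : ℂ)) = ∅ := by simp [tsupport, Function.support]
      simp [this])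
  rw [laplaceBeltrami]
  simp only [Fin.sum_univ_two, (key _).1.1, (key _).1.2, (key _).2.1, (key _).2.2,
    Complex.ofReal_zero, zero_mul, hz, add_zero, zero_add]

/-- The half density: `halfDensity Φ ^ 2 = ω⁻¹` on `Ω`. -/
def halfDensity (Φ : Cyl → ℝ) (p : Cyl) : ℝ := Real.exp ((Real.log p.1 + Φ p) / 2)

lemma areaDensity_eq_halfDensity (Φ : Cyl → ℝ) {p : Cyl} (hp : p.1 ≠ 0) :
    areaDensity Φ p = (halfDensity Φ p)⁻¹ ^ 2 := by
  rw [areaDensity_eq, halfDensity, ← Real.exp_neg, ← Real.exp_nat_mul,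
    ← Real.exp_log_eq_abs hp, ← Real.exp_neg, ← Real.exp_add]
  congr 1
  push_cast
  ring

/-- The coefficient `α = x² exp (2 Φ)` of `∂_y²`. -/
def angCoeff (Φ : Cyl → ℝ) (p : Cyl) : ℝ := p.1 ^ 2 * Real.exp (2 * Φ p)

/-- The potential which appears when the Laplacian is conjugated by `halfDensity Φ`. -/
def potential (Φ : Cyl → ℝ) (p : Cyl) : ℝ :=
  3 / (4 * p.1 ^ 2) + dx Φ p / (2 * p.1) + dx Φ p ^ 2 / 4 - dx (dx Φ) p / 2 -
    angCoeff Φ p * (dy (dy Φ) p / 2 + 3 * dy Φ p ^ 2 / 4)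

/-- The test functions `ω^{-1/2} h(x) exp (i k y)`. -/
def modeTest (Φ : Cyl → ℝ) (h : ℝ → ℝ) (k : ℤ) (p : Cyl) : ℂ :=
  (halfDensity Φ p : ℂ) * ((h p.1 : ℂ) * fourier k p.2)

variable {Φ : Cyl → ℝ}

lemma contDiffOn_halfDensity (hΦ : IsSmooth Φ) :
    ContDiffOn ℝ ∞ (fun q => halfDensity Φ (cover q)) (cover ⁻¹' regOmega) := by
  intro q hq
  have h0 : q.1 ≠ 0 := hq
  refine ContDiffAt.contDiffWithinAt ?_
  have h1 : ContDiffAt ℝ ∞ (fun q : ℝ × ℝ => Real.log q.1) q :=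
    (Real.contDiffAt_log.2 h0).comp q contDiffAt_fst
  exact ((h1.add (ContDiff.contDiffAt hΦ)).div_const 2).exp

lemma modeTest_mem (hΦ : IsSmooth Φ) {J : Set ℝ} {h : ℝ → ℝ} (hh : IsTest J h) (k : ℤ)
    {U : Set Cyl} (hU : U ⊆ regOmega) (hJU : J ×ˢ univ ⊆ U) :
    modeTest Φ h k ∈ testFunctions U := by
  refine mul_mem hU (contDiffOn_halfDensity hΦ) ?_
  have hsub : tsupport (fun p : Cyl => (h p.1 : ℂ) * fourier k p.2) ⊆ tsupport h ×ˢ univ := by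
    refine closure_minimal (fun p hp => ⟨subset_tsupport h fun h0 => hp ?_, mem_univ _⟩)
      ((isClosed_tsupport h).prod isClosed_univ)
    simp [h0]
  have hcomp : IsCompact (tsupport h) := hh.compact
  refine ⟨?_, (hcomp.prod isCompact_univ).of_isClosed_subset (isClosed_tsupport _) hsub,
    hsub.trans ((prod_mono hh.subset subset_rfl).trans hJU)⟩
  have h1 : ContDiff ℝ ∞ (fun q : ℝ × ℝ => (h q.1 : ℂ)) :=
    Complex.ofRealCLM.contDiff.comp (hh.smooth.comp contDiff_fst)
  have h2 : ContDiff ℝ ∞ (fun q : ℝ × ℝ => (fourier k (q.2 : Circ) : ℂ)) := by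
    simp only [fourier_coe_apply]
    have h3 : ContDiff ℝ ∞ (fun q : ℝ × ℝ => (q.2 : ℂ)) :=
      Complex.ofRealCLM.contDiff.comp contDiff_snd
    exact ((contDiff_const.mul h3).div_const _).cexp
  exact h1.mul h2

/-- The conjugation identity `ω^{1/2} Δ ω^{-1/2} = ∂ₓ² + ∂_y α ∂_y - Q`. -/
lemma laplaceBeltrami_modeTest (hΦ : IsSmooth Φ) {J : Set ℝ} {h : ℝ → ℝ} (hh : IsTest J h) (k : ℤ)
    (l : ℝ) {p : Cyl} (hp : p.1 ≠ 0) :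
    laplaceBeltrami Φ (modeTest Φ h k) p - l * modeTest Φ h k p =
      halfDensity Φ p * ((deriv (deriv h) p.1 + h p.1 *
        modeCoeff (angCoeff Φ) (fun p => 2 * dy Φ p * angCoeff Φ p)
          (fun p => potential Φ p + l) k p) * fourier k p.2) := by
  obtain ⟨x, y⟩ := p
  obtain ⟨t, rfl⟩ := QuotientAddGroup.mk_surjective y
  change x ≠ 0 at hp
  have hS0 : ∀ p, halfDensity Φ p ≠ 0 := fun p => (Real.exp_pos _).ne'
  set σ : Cyl → ℝ := fun p => (p.1⁻¹ + dx Φ p) / 2 with hσ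
  set τ : Cyl → ℝ := fun p => dy Φ p / 2 with hτ
  -- derivatives of the half density
  have hSx : ∀ s : ℝ, s ≠ 0 → ∀ y : Circ, HasDerivAt (fun s : ℝ => halfDensity Φ (s, y))
      (halfDensity Φ (s, y) * σ (s, y)) s := fun s hs y =>
    (((Real.hasDerivAt_log hs).add (hΦ.hasDerivAt_dx s y)).div_const 2).exp
  have hSy : ∀ t : ℝ, HasDerivAt (fun t : ℝ => halfDensity Φ (x, (t : Circ)))
      (halfDensity Φ (x, (t : Circ)) * τ (x, (t : Circ))) t := fun t =>
    (((hΦ.hasDerivAt_dy x t).const_add (Real.log x)).div_const 2).exp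
  have hσx : HasDerivAt (fun s : ℝ => σ (s, (t : Circ)))
      ((-(x ^ 2)⁻¹ + dx (dx Φ) (x, (t : Circ))) / 2) x :=
    ((hasDerivAt_inv hp).add (hΦ.dx.hasDerivAt_dx x _)).div_const 2
  have hτy : HasDerivAt (fun t : ℝ => τ (x, (t : Circ))) (dy (dy Φ) (x, (t : Circ)) / 2) t :=
    (hΦ.dy.hasDerivAt_dy x t).div_const 2
  -- the radial part
  have hx1 : ∀ s : ℝ, s ≠ 0 → ∀ y : Circ, pderiv 0 (modeTest Φ h k) (s, y) =
      ((halfDensity Φ (s, y) * σ (s, y) * h s + halfDensity Φ (s, y) * deriv h s : ℝ) : ℂ) *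
        fourier k y := by
    intro s hs y
    refine pderiv_zero_of_hasDerivAt ?_
    refine ((((hSx s hs y).mul (hh.hasDerivAt s)).ofReal_comp).mul_const
      (fourier k y)).congr_of_eventuallyEq (Eventually.of_forall fun r => ?_)
    simp only [modeTest, Pi.mul_apply, Complex.ofReal_mul]
    ring
  have hx2 : pderiv 0 (fun q => ((areaDensity Φ q : ℝ) : ℂ) * pderiv 0 (modeTest Φ h k) q)
      (x, (t : Circ)) = (((halfDensity Φ (x, (t : Circ)))⁻¹ * (deriv (deriv h) x +
        ((-(x ^ 2)⁻¹ + dx (dx Φ) (x, (t : Circ))) / 2 - σ (x, (t : Circ)) ^ 2) * h x) : ℝ) : ℂ) *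
        fourier k (t : Circ) := by
    refine pderiv_zero_of_hasDerivAt ?_
    have h1 : HasDerivAt (fun s : ℝ => (halfDensity Φ (s, (t : Circ)))⁻¹ *
        (σ (s, (t : Circ)) * h s + deriv h s)) ((halfDensity Φ (x, (t : Circ)))⁻¹ *
        (deriv (deriv h) x +
        ((-(x ^ 2)⁻¹ + dx (dx Φ) (x, (t : Circ))) / 2 - σ (x, (t : Circ)) ^ 2) * h x)) x := by
      refine (((hSx x hp (t : Circ)).inv (hS0 _)).mul
        ((hσx.mul (hh.hasDerivAt x)).add (hh.deriv.hasDerivAt x))).congr_deriv ?_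
      have := hS0 (x, (t : Circ))
      simp only [Pi.inv_apply, Pi.add_apply, Pi.mul_apply]
      field_simp
      ring
    refine (h1.ofReal_comp.mul_const (fourier k (t : Circ))).congr_of_eventuallyEq ?_
    filter_upwards [isOpen_ne.mem_nhds hp] with s hs
    rw [hx1 s hs, areaDensity_eq_halfDensity Φ hs]
    have := hS0 (s, (t : Circ))
    rw [← mul_assoc, ← Complex.ofReal_mul]
    congr 2
    field_simp
  -- the angular part
  have hy1 : ∀ t : ℝ, pderiv 1 (modeTest Φ h k) (x, (t : Circ)) =
      (halfDensity Φ (x, (t : Circ)) : ℂ) * h x *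
        ((τ (x, (t : Circ)) + Complex.I * k) * fourier k (t : Circ)) := by
    intro t
    refine pderiv_one_of_hasDerivAt ?_
    refine ((hSy t).ofReal_comp.mul ((hasDerivAt_fourier_two_pi k t).const_mul
      (h x : ℂ))).congr_deriv ?_
    push_cast
    ring
  have hy2 : pderiv 1 (fun q => (((areaDensity Φ q)⁻¹ : ℝ) : ℂ) * pderiv 1 (modeTest Φ h k) q)
      (x, (t : Circ)) = (halfDensity Φ (x, (t : Circ)) : ℂ) ^ 3 * h x *
        ((3 * τ (x, (t : Circ)) ^ 2 + dy (dy Φ) (x, (t : Circ)) / 2 - (k : ℂ) ^ 2 +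
          4 * Complex.I * k * τ (x, (t : Circ))) * fourier k (t : Circ)) := by
    refine pderiv_one_of_hasDerivAt ?_
    have h1 := (((hSy t).ofReal_comp.pow 3).mul_const (h x : ℂ)).mul
      ((hτy.ofReal_comp.add_const (Complex.I * k)).mul (hasDerivAt_fourier_two_pi k t))
    refine (h1.congr_of_eventuallyEq (Eventually.of_forall fun t => ?_)).congr_deriv ?_
    · simp only [hy1, areaDensity_eq_halfDensity Φ (p := (x, (t : Circ))) hp, Pi.mul_apply,
        Pi.pow_apply]
      have := hS0 (x, (t : Circ))
      have h2 : ((halfDensity Φ (x, (t : Circ)) : ℝ) : ℂ) ≠ 0 := by exact_mod_cast this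
      push_cast
      field_simp
    · simp only [Pi.mul_apply, Pi.pow_apply]
      push_cast
      linear_combination (halfDensity Φ (x, (t : Circ)) : ℂ) ^ 3 * h x * (k : ℂ) ^ 2 *
        fourier k (t : Circ) * Complex.I_sq
  have hα : angCoeff Φ (x, (t : Circ)) = halfDensity Φ (x, (t : Circ)) ^ 4 := by
    rw [angCoeff, halfDensity, ← Real.exp_nat_mul]
    have h1 : ((4 : ℕ) : ℝ) * ((Real.log x + Φ (x, (t : Circ))) / 2) =
        (2 : ℕ) * Real.log x + 2 * Φ (x, (t : Circ)) := by push_cast; ring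
    rw [h1, Real.exp_add, Real.exp_nat_mul, Real.exp_log_eq_abs hp, sq_abs]
  change laplaceBeltrami Φ (modeTest Φ h k) (x, (t : Circ)) -
    l * modeTest Φ h k (x, (t : Circ)) = halfDensity Φ (x, (t : Circ)) *
    ((deriv (deriv h) x + h x * modeCoeff (angCoeff Φ) (fun p => 2 * dy Φ p * angCoeff Φ p)
          (fun p => potential Φ p + l) k (x, (t : Circ))) * fourier k (t : Circ))
  rw [laplaceBeltrami_eq, hx2, hy2, areaDensity_eq_halfDensity Φ hp]
  simp only [modeTest, modeCoeff, potential, hα, hσ, hτ]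
  have hS1 : ((halfDensity Φ (x, (t : Circ)) : ℝ) : ℂ) ≠ 0 := by exact_mod_cast hS0 _
  have hxc : (x : ℂ) ≠ 0 := by exact_mod_cast hp
  push_cast
  field_simp
  ring

end Conjugation

/-! ### From deficiency functions to weak solutions -/

section Deficiency

open AddCircle (haarAddCircle)
open scoped ComplexConjugate

variable {Φ : Cyl → ℝ}

lemma volume_cyl : (volume : Measure Cyl) =
    ENNReal.ofReal (2 * Real.pi) • (volume : Measure ℝ).prod haarAddCircle := by
  rw [Measure.volume_eq_prod, AddCircle.volume_eq_smul_haarAddCircle, Measure.prod_smul_right]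

lemma prod_haar_eq : (volume : Measure ℝ).prod (haarAddCircle : Measure Circ) =
    (ENNReal.ofReal (2 * Real.pi))⁻¹ • (volume : Measure Cyl) := by
  rw [volume_cyl, smul_smul, ENNReal.inv_mul_cancel, one_smul]
  · simp [Real.pi_pos]
  · exact ENNReal.ofReal_ne_top

lemma measurable_areaDensity {Φ : Cyl → ℝ} (hΦ : IsSmooth Φ) : Measurable (areaDensity Φ) := by
  have h1 := hΦ.continuous.measurable
  have : areaDensity Φ = fun p : Cyl => |p.1|⁻¹ * Real.exp (-Φ p) :=
    funext fun p => areaDensity_eq Φ p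
  rw [this]
  fun_prop

lemma isCoefficients (hΦ : IsSmooth Φ) {J : Set ℝ} (h0 : (0 : ℝ) ∉ J) (l : ℝ) :
    IsCoefficients J (angCoeff Φ) (fun p => 2 * dy Φ p * angCoeff Φ p)
      (fun p => (2 * dy (dy Φ) p + 4 * dy Φ p ^ 2) * angCoeff Φ p)
      (fun p => potential Φ p + l) := by
  have c0 := hΦ.continuous
  have c1 := hΦ.dx.continuous
  have c2 := hΦ.dx.dx.continuous
  have c3 := hΦ.dy.continuous
  have c4 := hΦ.dy.dy.continuous
  have cα : Continuous (angCoeff Φ) := by unfold angCoeff; fun_prop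
  have hα : ∀ x t : ℝ, HasDerivAt (fun t : ℝ => angCoeff Φ (x, (t : Circ)))
      (2 * dy Φ (x, (t : Circ)) * angCoeff Φ (x, (t : Circ))) t := by
    intro x t
    refine ((((hΦ.hasDerivAt_dy x t).const_mul 2).exp).const_mul (x ^ 2)).congr_deriv ?_
    simp only [angCoeff]
    ring
  refine ⟨cα, by fun_prop, by fun_prop, fun p => by unfold angCoeff; positivity, hα,
    fun x t => ?_, ?_, ?_⟩
  · refine (((hΦ.dy.hasDerivAt_dy x t).const_mul 2).mul (hα x t)).congr_deriv ?_
    ring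
  · have m1 := c1.measurable
    have m2 := c2.measurable
    have m3 := c3.measurable
    have m4 := c4.measurable
    have mα := cα.measurable
    unfold potential
    fun_prop
  · have h1 : ∀ p ∈ J ×ˢ (univ : Set Circ), p.1 ≠ 0 := fun p hp h => h0 (h ▸ hp.1)
    unfold potential
    refine ContinuousOn.add (ContinuousOn.sub (ContinuousOn.sub (ContinuousOn.add
      (ContinuousOn.add (ContinuousOn.div (by fun_prop) (by fun_prop) fun p hp => ?_)
      (ContinuousOn.div (by fun_prop) (by fun_prop) fun p hp => ?_)) (by fun_prop)) (by fun_prop))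
      (by fun_prop)) (by fun_prop)
    · have := h1 p hp
      positivity
    · have := h1 p hp
      positivity

lemma dx_eq_zero {f : Cyl → ℝ} {R c : ℝ} (h : ∀ p : Cyl, R < |p.1| → f p = c) (p : Cyl)
    (hp : R < |p.1|) : dx f p = 0 := by
  have h1 : (fun s : ℝ => f (s, p.2)) =ᶠ[𝓝 p.1] fun _ => c := by
    filter_upwards [(isOpen_lt continuous_const continuous_abs).mem_nhds hp] with s hs
    exact h (s, p.2) hs
  exact h1.deriv_eq.trans (deriv_const _ _)

lemma dy_eq_zero {f : Cyl → ℝ} {R c : ℝ} (h : ∀ p : Cyl, R < |p.1| → f p = c) (p : Cyl)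
    (hp : R < |p.1|) : dy f p = 0 := by
  have h1 : (fun s : ℝ => f (p.1, p.2 + (s : Circ))) = fun _ => c :=
    funext fun s => h (p.1, p.2 + (s : Circ)) hp
  rw [dy, h1, deriv_const]

/-- A continuous function on the cylinder which vanishes for large `|x|` is bounded. -/
lemma exists_bound_of_eq_zero {f : Cyl → ℝ} (hf : Continuous f) {R : ℝ}
    (h : ∀ p : Cyl, R < |p.1| → f p = 0) : ∃ C, 0 ≤ C ∧ ∀ p, |f p| ≤ C := by
  obtain ⟨C, hC⟩ := ((isCompact_Icc (a := -R) (b := R)).prod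
    (isCompact_univ (X := Circ))).exists_bound_of_continuousOn hf.continuousOn
  refine ⟨|C|, abs_nonneg _, fun p => ?_⟩
  by_cases hp : R < |p.1|
  · rw [h p hp, abs_zero]
    exact abs_nonneg _
  · exact (hC p ⟨abs_le.1 (not_lt.1 hp), mem_univ _⟩).trans (le_abs_self C)

/-- The potential is `3 / (4 x²)` up to errors of order `1 / |x|`. This is where it matters that `Φ`
is constant for large `|x|`. -/
lemma exists_potential_bound (hΦ : IsSmooth Φ)
    (hconst : ∃ R c : ℝ, ∀ p : Cyl, R ≤ |p.1| → Φ p = c) :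
    ∃ κ C : ℝ, 0 ≤ κ ∧ 0 ≤ C ∧ ∀ p : Cyl, p.1 ≠ 0 →
      |potential Φ p - 3 / (4 * p.1 ^ 2)| ≤ κ / |p.1| + C := by
  obtain ⟨R, c, hc⟩ := hconst
  have hc' : ∀ p : Cyl, R < |p.1| → Φ p = c := fun p hp => hc p hp.le
  have z1 := dx_eq_zero hc'
  have z2 := dx_eq_zero z1
  have z3 := dy_eq_zero hc'
  have z4 := dy_eq_zero z3
  have c0 := hΦ.continuous
  have c1 := hΦ.dx.continuous
  have c2 := hΦ.dx.dx.continuous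
  have c3 := hΦ.dy.continuous
  have c4 := hΦ.dy.dy.continuous
  have cα : Continuous (angCoeff Φ) := by unfold angCoeff; fun_prop
  obtain ⟨κ, hκ, hκ'⟩ := exists_bound_of_eq_zero (f := fun p => dx Φ p / 2) (by fun_prop)
    (R := R) fun p hp => by simp [z1 p hp]
  obtain ⟨C, hC, hC'⟩ := exists_bound_of_eq_zero (f := fun p => dx Φ p ^ 2 / 4 - dx (dx Φ) p / 2 -
    angCoeff Φ p * (dy (dy Φ) p / 2 + 3 * dy Φ p ^ 2 / 4)) (by fun_prop)
    (R := R) fun p hp => by simp [z1 p hp, z2 p hp, z3 p hp, z4 p hp]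
  refine ⟨κ, C, hκ, hC, fun p hp => ?_⟩
  have h1 : potential Φ p - 3 / (4 * p.1 ^ 2) = dx Φ p / 2 / p.1 +
      (dx Φ p ^ 2 / 4 - dx (dx Φ) p / 2 -
        angCoeff Φ p * (dy (dy Φ) p / 2 + 3 * dy Φ p ^ 2 / 4)) := by
    unfold potential
    field_simp
    ring
  rw [h1]
  refine (abs_add_le _ _).trans (add_le_add ?_ (hC' p))
  rw [abs_div]
  exact div_le_div_of_nonneg_right (hκ' p) (abs_nonneg _)

/-- A function in the deficiency space of `Δ - l` becomes a weak solution on the flat cylinder. -/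
lemma isWeakSolution_of_orthogonal (hΦ : IsSmooth Φ) {J : Set ℝ} (hJm : MeasurableSet J)
    {U : Set Cyl} (hUm : MeasurableSet U) (hU : U ⊆ regOmega) (hJU : J ×ˢ univ ⊆ U) (l : ℝ)
    {ψ : Cyl → ℂ} (hψm : Measurable ψ) (hψ : MemLp ψ 2 (area Φ U))
    (horth : ∀ φ ∈ testFunctions U,
      ∫ p, conj (ψ p) * (laplaceBeltrami Φ φ p - l * φ p) ∂(area Φ U) = 0) :
    IsWeakSolution J (angCoeff Φ) (fun p => 2 * dy Φ p * angCoeff Φ p)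
      (fun p => potential Φ p + l)
      ((J ×ˢ univ).indicator fun p => (((halfDensity Φ p)⁻¹ : ℝ) : ℂ) * ψ p) := by
  have hΦm := hΦ.continuous.measurable
  have hSm : Measurable (halfDensity Φ) := by unfold halfDensity; fun_prop
  have hωm := measurable_areaDensity hΦ
  have hω0 : ∀ p, 0 ≤ areaDensity Φ p := fun p => Real.sqrt_nonneg _
  have hJm2 : MeasurableSet (J ×ˢ (univ : Set Circ)) := hJm.prod MeasurableSet.univ
  have hum : Measurable ((J ×ˢ univ).indicator fun p : Cyl =>
      (((halfDensity Φ p)⁻¹ : ℝ) : ℂ) * ψ p) := by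
    refine Measurable.indicator ?_ hJm2
    fun_prop
  refine ⟨?_, fun h hh k => ?_⟩
  · rw [prod_haar_eq]
    refine MemLp.smul_measure ?_ (by simp [Real.pi_pos])
    rw [memLp_two_iff_integrable_sq_norm hum.aestronglyMeasurable]
    have h1 := (memLp_two_iff_integrable_sq_norm hψ.1).1 hψ
    rw [area, integrable_withDensity_iff_integrable_smul' hωm.ennreal_ofReal
      (Eventually.of_forall fun p => ENNReal.ofReal_lt_top)] at h1
    have h2 : Integrable ((J ×ˢ univ).indicator fun p : Cyl =>
        (ENNReal.ofReal (areaDensity Φ p)).toReal • ‖ψ p‖ ^ 2) := by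
      rw [integrable_indicator_iff hJm2]
      exact IntegrableOn.mono_set (s := J ×ˢ univ) (t := U) h1 hJU
    refine h2.congr (Eventually.of_forall fun p => ?_)
    by_cases hp : p ∈ J ×ˢ (univ : Set Circ)
    · simp only [indicator_of_mem hp]
      rw [ENNReal.toReal_ofReal (hω0 p), areaDensity_eq_halfDensity Φ (hU (hJU hp))]
      simp only [norm_mul, Complex.norm_real, mul_pow, Real.norm_eq_abs, sq_abs, smul_eq_mul]
    · simp [indicator_of_notMem hp]
  · have h1 := horth _ (modeTest_mem hΦ hh k hU hJU)
    rw [area, integral_withDensity_eq_integral_toReal_smul hωm.ennreal_ofReal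
      (Eventually.of_forall fun p => ENNReal.ofReal_lt_top)] at h1
    rw [← integral_indicator hUm] at h1
    rw [prod_haar_eq, integral_smul_measure]
    refine smul_eq_zero_of_right _ (star_injective ?_)
    rw [star_zero, ← h1]
    refine integral_conj.symm.trans (integral_congr_ae (Eventually.of_forall fun p => ?_))
    by_cases hpU : p ∈ U
    · have hp0 : p.1 ≠ 0 := hU hpU
      have hS0 : (halfDensity Φ p : ℂ) ≠ 0 := by exact_mod_cast (Real.exp_pos _).ne'
      have hr : (ENNReal.ofReal (areaDensity Φ p)).toReal = (halfDensity Φ p)⁻¹ ^ 2 := by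
        rw [ENNReal.toReal_ofReal (hω0 p), areaDensity_eq_halfDensity Φ hp0]
      simp only [indicator_of_mem hpU, hr, laplaceBeltrami_modeTest hΦ hh k l hp0]
      by_cases hp : p ∈ J ×ˢ (univ : Set Circ)
      · simp only [indicator_of_mem hp, map_mul, Complex.conj_conj, Complex.conj_ofReal,
          Complex.real_smul]
        push_cast
        field_simp
      · have hx : p.1 ∉ J := fun hx => hp ⟨hx, mem_univ _⟩
        have z1 : h p.1 = 0 := image_eq_zero_of_notMem_tsupport fun h' => hx (hh.subset h')
        have z2 : deriv (deriv h) p.1 = 0 :=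
          image_eq_zero_of_notMem_tsupport fun h' => hx (hh.deriv.deriv.subset h')
        simp [indicator_of_notMem hp, z1, z2]
    · simp [indicator_of_notMem hpU, indicator_of_notMem fun hp => hpU (hJU hp)]

end Deficiency

/-! ### Triviality of the deficiency spaces -/

section Cutoff

lemma exists_bound_deriv_smoothTransition :
    ∃ M, 0 ≤ M ∧ (∀ t, |deriv Real.smoothTransition t| ≤ M) ∧
      ∀ t, 1 < t → deriv Real.smoothTransition t = 0 := by
  have hc : Continuous (deriv Real.smoothTransition) :=
    (contDiff_infty_iff_deriv.1 Real.smoothTransition.contDiff).2.continuous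
  have h1 : ∀ t, 1 < t → deriv Real.smoothTransition t = 0 := by
    intro t ht
    have : Real.smoothTransition =ᶠ[𝓝 t] fun _ => 1 := by
      filter_upwards [isOpen_Ioi.mem_nhds ht] with s hs
      exact Real.smoothTransition.one_of_one_le (le_of_lt hs)
    exact this.deriv_eq.trans (deriv_const _ _)
  have h0 : ∀ t, t < 0 → deriv Real.smoothTransition t = 0 := by
    intro t ht
    have : Real.smoothTransition =ᶠ[𝓝 t] fun _ => 0 := by
      filter_upwards [isOpen_Iio.mem_nhds ht] with s hs
      exact Real.smoothTransition.zero_of_nonpos (le_of_lt hs)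
    exact this.deriv_eq.trans (deriv_const _ _)
  obtain ⟨M, hM⟩ := (isCompact_Icc (a := (0 : ℝ)) (b := 1)).exists_bound_of_continuousOn
    hc.continuousOn
  refine ⟨|M|, abs_nonneg _, fun t => ?_, h1⟩
  rcases lt_or_ge t 0 with h | h
  · rw [h0 t h, abs_zero]
    exact abs_nonneg _
  · rcases lt_or_ge 1 t with h' | h'
    · rw [h1 t h', abs_zero]
      exact abs_nonneg _
    · exact (hM t ⟨h, h'⟩).trans (le_abs_self M)

/-- The function `x exp (-b x)` times a cutoff at `1 / (n + 1)` and at `n + 1`. -/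
def cutoff (b : ℝ) (n : ℕ) (x : ℝ) : ℝ :=
  x * Real.exp (-b * x) *
    (Real.smoothTransition ((n + 1) * x - 1) * Real.smoothTransition (2 - (n + 1 : ℝ)⁻¹ * x))

lemma contDiff_cutoff (b : ℝ) (n : ℕ) : ContDiff ℝ ∞ (cutoff b n) := by
  unfold cutoff
  have h : ContDiff ℝ ∞ Real.smoothTransition := Real.smoothTransition.contDiff
  exact (contDiff_id.mul (contDiff_const.mul contDiff_id).exp).mul
    ((h.comp ((contDiff_const.mul contDiff_id).sub contDiff_const)).mul
      (h.comp (contDiff_const.sub (contDiff_const.mul contDiff_id))))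

lemma isTest_cutoff (b : ℝ) (n : ℕ) : IsTest (Ioi 0) (cutoff b n) := by
  have hn : (0 : ℝ) < n + 1 := by positivity
  have hsub : tsupport (cutoff b n) ⊆ Icc (n + 1 : ℝ)⁻¹ (2 * (n + 1)) := by
    refine closure_minimal (fun x hx => ?_) isClosed_Icc
    have h1 := right_ne_zero_of_mul hx
    constructor
    · by_contra h
      refine left_ne_zero_of_mul h1 (Real.smoothTransition.zero_of_nonpos ?_)
      have := mul_lt_mul_of_pos_left (not_le.1 h) hn
      rw [mul_inv_cancel₀ hn.ne'] at this
      linarith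
    · by_contra h
      refine right_ne_zero_of_mul h1 (Real.smoothTransition.zero_of_nonpos ?_)
      have := mul_lt_mul_of_pos_left (not_le.1 h) (inv_pos.2 hn)
      have h2 : (n + 1 : ℝ)⁻¹ * (2 * (n + 1)) = 2 := by field_simp
      linarith
  exact ⟨contDiff_cutoff b n, isCompact_Icc.of_isClosed_subset (isClosed_tsupport _) hsub,
    hsub.trans fun x hx => (inv_pos.2 hn).trans_le hx.1⟩

lemma cutoff_nonneg {b x : ℝ} (hx : 0 ≤ x) (n : ℕ) : 0 ≤ cutoff b n x := by
  have := Real.smoothTransition.nonneg ((n + 1) * x - 1)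
  have := Real.smoothTransition.nonneg (2 - (n + 1 : ℝ)⁻¹ * x)
  unfold cutoff
  positivity

lemma cutoff_le {b x : ℝ} (hx : 0 ≤ x) (n : ℕ) : cutoff b n x ≤ x * Real.exp (-b * x) := by
  unfold cutoff
  refine mul_le_of_le_one_right (by positivity) (mul_le_one₀ (Real.smoothTransition.le_one _)
    (Real.smoothTransition.nonneg _) (Real.smoothTransition.le_one _))

lemma mul_exp_neg_le {b x : ℝ} (hb : 0 < b) : x * Real.exp (-b * x) ≤ b⁻¹ := by
  have h1 := Real.add_one_le_exp (b * x)
  have h2 : Real.exp (b * x) * Real.exp (-b * x) = 1 := by rw [← Real.exp_add]; simp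
  have h3 := Real.exp_pos (-b * x)
  rw [← one_div, le_div_iff₀ hb]
  nlinarith

lemma hasDerivAt_cutoff (b : ℝ) (n : ℕ) (x : ℝ) : HasDerivAt (cutoff b n)
    ((1 - b * x) * Real.exp (-b * x) *
      (Real.smoothTransition ((n + 1) * x - 1) * Real.smoothTransition (2 - (n + 1 : ℝ)⁻¹ * x)) +
    x * Real.exp (-b * x) * ((n + 1) * deriv Real.smoothTransition ((n + 1) * x - 1) *
      Real.smoothTransition (2 - (n + 1 : ℝ)⁻¹ * x) - Real.smoothTransition ((n + 1) * x - 1) *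
      ((n + 1 : ℝ)⁻¹ * deriv Real.smoothTransition (2 - (n + 1 : ℝ)⁻¹ * x)))) x := by
  have hs : ∀ t, HasDerivAt Real.smoothTransition (deriv Real.smoothTransition t) t := fun t =>
    ((Real.smoothTransition.contDiff (n := 1)).differentiable (by simp) t).hasDerivAt
  have h1 : HasDerivAt (fun x : ℝ => (n + 1 : ℝ) * x - 1) (n + 1 : ℝ) x := by
    simpa using ((hasDerivAt_id x).const_mul (n + 1 : ℝ)).sub_const 1
  have h2 : HasDerivAt (fun x : ℝ => 2 - (n + 1 : ℝ)⁻¹ * x) (-(n + 1 : ℝ)⁻¹) x := by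
    simpa using ((hasDerivAt_id x).const_mul (n + 1 : ℝ)⁻¹).const_sub 2
  have h3 : HasDerivAt (fun x : ℝ => Real.exp (-b * x)) (Real.exp (-b * x) * -b) x := by
    simpa using ((hasDerivAt_id x).const_mul (-b)).exp
  refine (((hasDerivAt_id x).mul h3).mul (((hs _).comp x h1).mul ((hs _).comp x h2))).congr_deriv ?_
  simp only [Pi.mul_apply, id, Function.comp]
  ring

lemma exists_bound_deriv_cutoff {b : ℝ} (hb : 0 < b) :
    ∃ D, ∀ n, ∀ x, 0 < x → |deriv (cutoff b n) x| ≤ D := by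
  obtain ⟨M, hM0, hM, hM1⟩ := exists_bound_deriv_smoothTransition
  refine ⟨1 * (1 * 1) + (2 * M + M * b⁻¹), fun n x hx => ?_⟩
  rw [(hasDerivAt_cutoff b n x).deriv]
  set A := Real.smoothTransition ((n + 1) * x - 1) with hA
  set B := Real.smoothTransition (2 - (n + 1 : ℝ)⁻¹ * x) with hB
  have hA1 : |A| ≤ 1 := abs_le.2 ⟨by linarith [Real.smoothTransition.nonneg ((n + 1) * x - 1)],
    Real.smoothTransition.le_one _⟩
  have hB1 : |B| ≤ 1 := abs_le.2
    ⟨by linarith [Real.smoothTransition.nonneg (2 - (n + 1 : ℝ)⁻¹ * x)],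
      Real.smoothTransition.le_one _⟩
  have hn : (0 : ℝ) < n + 1 := by positivity
  have hn1 : (n + 1 : ℝ)⁻¹ ≤ 1 := inv_le_one_of_one_le₀ (by
    have : (0 : ℝ) ≤ n := by positivity
    linarith)
  have hexp : |(1 - b * x) * Real.exp (-b * x)| ≤ 1 := by
    have h1 := Real.add_one_le_exp (b * x)
    have h2 : Real.exp (b * x) * Real.exp (-b * x) = 1 := by rw [← Real.exp_add]; simp
    have h3 := Real.exp_pos (-b * x)
    have h4 : 0 < b * x := mul_pos hb hx
    rw [abs_le]
    constructor <;> nlinarith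
  have hexp1 : Real.exp (-b * x) ≤ 1 := Real.exp_le_one_iff.2 (by nlinarith)
  have hexp2 := mul_exp_neg_le (x := x) hb
  refine (abs_add_le _ _).trans (add_le_add ?_ ?_)
  · rw [abs_mul, abs_mul A]
    gcongr
  have hd1 : |x * Real.exp (-b * x) * ((n + 1) * deriv Real.smoothTransition ((n + 1) * x - 1) *
      B)| ≤ 2 * M := by
    -- the derivative of the inner cutoff is supported in `(n + 1) x ≤ 2`
    by_cases h : 1 < (n + 1) * x - 1
    · rw [hM1 _ h]
      simp only [mul_zero, zero_mul, abs_zero]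
      positivity
    · have h2 : (n + 1) * x ≤ 2 := by linarith
      rw [show x * Real.exp (-b * x) * ((n + 1) * deriv Real.smoothTransition ((n + 1) * x - 1) *
        B) = ((n + 1) * x) * (Real.exp (-b * x) *
          (deriv Real.smoothTransition ((n + 1) * x - 1) * B)) by ring, abs_mul,
        abs_of_pos (mul_pos hn hx), abs_mul, abs_of_pos (Real.exp_pos _), abs_mul]
      have h3 : Real.exp (-b * x) * (|deriv Real.smoothTransition ((n + 1) * x - 1)| * |B|) ≤
          1 * (M * 1) := by
        have := hM ((n + 1) * x - 1)
        gcongr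
      calc _ ≤ 2 * (1 * (M * 1)) := mul_le_mul h2 h3 (by positivity) (by norm_num)
        _ = 2 * M := by ring
  have hd2 : |x * Real.exp (-b * x) * (A * ((n + 1 : ℝ)⁻¹ *
      deriv Real.smoothTransition (2 - (n + 1 : ℝ)⁻¹ * x)))| ≤ M * b⁻¹ := by
    rw [abs_mul, abs_of_pos (mul_pos hx (Real.exp_pos _)), abs_mul A, abs_mul,
      abs_of_pos (inv_pos.2 hn)]
    have h3 : |A| * ((n + 1 : ℝ)⁻¹ * |deriv Real.smoothTransition (2 - (n + 1 : ℝ)⁻¹ * x)|) ≤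
        1 * (1 * M) := by
      have := hM (2 - (n + 1 : ℝ)⁻¹ * x)
      gcongr
    calc _ ≤ b⁻¹ * (1 * (1 * M)) := mul_le_mul hexp2 h3 (by positivity) (by positivity)
      _ = _ := by ring
  rw [mul_sub]
  exact (abs_sub _ _).trans (add_le_add hd1 hd2)

lemma eventually_cutoff_eq (b : ℝ) {x : ℝ} (hx : 0 < x) : ∀ᶠ n in atTop,
    cutoff b n x = x * Real.exp (-b * x) ∧
    deriv (cutoff b n) x = (1 - b * x) * Real.exp (-b * x) := by
  have h1 : Tendsto (fun n : ℕ => (n + 1 : ℝ)) atTop atTop :=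
    tendsto_atTop_add_const_right _ _ tendsto_natCast_atTop_atTop
  filter_upwards [h1.eventually_gt_atTop (2 / x), h1.eventually_gt_atTop x] with n hn hn'
  obtain ⟨M, -, -, hM⟩ := exists_bound_deriv_smoothTransition
  have h2 : 1 < (n + 1) * x - 1 := by
    rw [div_lt_iff₀ hx] at hn
    linarith
  have h3 : 1 < 2 - (n + 1 : ℝ)⁻¹ * x := by
    have : (n + 1 : ℝ)⁻¹ * x < 1 := by
      rw [inv_mul_lt_iff₀ (by positivity)]
      linarith
    linarith
  rw [(hasDerivAt_cutoff b n x).deriv, cutoff, Real.smoothTransition.one_of_one_le h2.le,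
    Real.smoothTransition.one_of_one_le h3.le, hM _ h2, hM _ h3]
  constructor <;> ring

end Cutoff

section Vanishing

open AddCircle (haarAddCircle)
open scoped ComplexConjugate

variable {Φ : Cyl → ℝ}

/-- For large `l`, square integrable weak solutions on a half-cylinder vanish: `weighted_inequality`
is applied with truncations of `f = |x| exp (-b |x|)`, for which
`f'² - f² / (4 x²) - f² (Q + l) < 0`. The borderline behaviour `3 / (4 x²)` of the potential `Q`
is just sufficient. -/
theorem IsWeakSolution.ae_eq_zero (hΦ : IsSmooth Φ) {κ C b l : ℝ} (hκ : 0 ≤ κ) (hC : 0 ≤ C)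
    (hpot : ∀ p : Cyl, p.1 ≠ 0 → |potential Φ p - 3 / (4 * p.1 ^ 2)| ≤ κ / |p.1| + C)
    (hb : 0 < b) (hκb : κ ≤ 2 * b) (hl : b ^ 2 + C < l) {σ : ℝ} (hσ : σ ^ 2 = 1) {u : Cyl → ℂ}
    (hu : IsWeakSolution {x | 0 < σ * x} (angCoeff Φ) (fun p => 2 * dy Φ p * angCoeff Φ p)
      (fun p => potential Φ p + l) u) :
    ∀ᵐ p : Cyl ∂((volume : Measure ℝ).prod haarAddCircle), 0 < σ * p.1 → u p = 0 := by
  set J : Set ℝ := {x | 0 < σ * x} with hJdef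
  have hσ0 : σ ≠ 0 := by rintro rfl; norm_num at hσ
  have hJ : IsOpen J := isOpen_lt continuous_const (by fun_prop)
  have hJ' : J.OrdConnected := by
    refine ⟨fun x hx y hy z hz => ?_⟩
    change 0 < σ * z
    change 0 < σ * x at hx
    change 0 < σ * y at hy
    rcases lt_or_gt_of_ne hσ0 with h | h
    · nlinarith [hz.1, hz.2, mul_nonneg_of_nonpos_of_nonpos h.le (sub_nonpos.2 hz.2)]
    · nlinarith [hz.1, hz.2, mul_nonneg h.le (sub_nonneg.2 hz.1)]
  have h0 : (0 : ℝ) ∉ J := by simp [hJdef]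
  have hne : J.Nonempty := ⟨σ, by simp only [hJdef, mem_ofPred_eq]; nlinarith⟩
  have hc := isCoefficients hΦ h0 l
  set f : ℕ → ℝ → ℝ := fun n x => cutoff b n (σ * x) with hf
  have hfd : ∀ n x, deriv (f n) x = σ * deriv (cutoff b n) (σ * x) := fun n x => by
    simp only [hf]
    rw [deriv_comp_mul_left, smul_eq_mul]
  have hft : ∀ n, IsTest J (f n) := by
    intro n
    have ht := isTest_cutoff b n
    have hcl : IsClosedEmbedding fun x : ℝ => σ * x :=
      (Homeomorph.mulLeft₀ σ hσ0).isClosedEmbedding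
    refine ⟨ht.smooth.comp (contDiff_const.mul contDiff_id),
      ht.compact.comp_isClosedEmbedding hcl, fun x hx => ?_⟩
    exact ht.subset (tsupport_comp_subset_preimage (f := fun x => σ * x) (cutoff b n)
      (by fun_prop) hx)
  have hsq : Integrable (fun p => ‖u p‖ ^ 2) ((volume : Measure ℝ).prod haarAddCircle) :=
    hu.memLp.integrable_norm_pow (by simp)
  obtain ⟨D, hD⟩ := exists_bound_deriv_cutoff hb
  have hl0 : 0 ≤ l := by nlinarith
  -- the weight, before and after the passage to the limit
  set W : ℕ → Cyl → ℝ := fun n p => deriv (f n) p.1 ^ 2 - f n p.1 ^ 2 / (4 * p.1 ^ 2) -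
    f n p.1 ^ 2 * (potential Φ p + l) with hW
  set w : Cyl → ℝ := fun p => Real.exp (-b * (σ * p.1)) ^ 2 * ((1 - b * (σ * p.1)) ^ 2 - 1 / 4 -
    p.1 ^ 2 * (potential Φ p + l)) with hw
  have hx2 : ∀ x : ℝ, (σ * x) ^ 2 = x ^ 2 := fun x => by rw [mul_pow, hσ, one_mul]
  have habs : ∀ x : ℝ, 0 < σ * x → |x| = σ * x := fun x hx => by
    rw [← abs_of_pos hx, ← sq_eq_sq₀ (abs_nonneg _) (abs_nonneg _), sq_abs, sq_abs, hx2]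
  have hWm : ∀ n, Measurable (W n) := by
    intro n
    have m1 := (hft n).continuous.measurable
    have m2 := (hft n).deriv.continuous.measurable
    have m3 := hc.meas
    fun_prop
  have hW0 : ∀ n p, ¬ 0 < σ * p.1 → W n p = 0 := by
    intro n p hp
    have z1 : f n p.1 = 0 := image_eq_zero_of_notMem_tsupport fun h' => hp ((hft n).subset h')
    have z2 : deriv (f n) p.1 = 0 :=
      image_eq_zero_of_notMem_tsupport fun h' => hp ((hft n).deriv.subset h')
    simp [hW, z1, z2]
  set E : ℝ := D ^ 2 + 1 + (1 + κ * b⁻¹ + (C + l) * b⁻¹ ^ 2) with hE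
  have hE0 : 0 ≤ E := by positivity
  have hWb : ∀ n p, |W n p| ≤ E := by
    intro n p
    by_cases hp : 0 < σ * p.1
    swap
    · rw [hW0 n p hp, abs_zero]
      exact hE0
    have hp0 : p.1 ≠ 0 := by rintro h; simp [h] at hp
    have hd : deriv (f n) p.1 ^ 2 ≤ D ^ 2 := by
      rw [hfd, mul_pow, hσ, one_mul, ← sq_abs]
      exact pow_le_pow_left₀ (abs_nonneg _) (hD n _ hp) 2
    have hf1 : f n p.1 ^ 2 ≤ (σ * p.1 * Real.exp (-b * (σ * p.1))) ^ 2 :=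
      pow_le_pow_left₀ (cutoff_nonneg hp.le n) (cutoff_le hp.le n) 2
    have hexp1 : Real.exp (-b * (σ * p.1)) ≤ 1 := Real.exp_le_one_iff.2 (by nlinarith)
    have hf2 : f n p.1 ^ 2 ≤ p.1 ^ 2 := by
      refine hf1.trans ?_
      rw [mul_pow, hx2]
      exact mul_le_of_le_one_right (sq_nonneg _) (pow_le_one₀ (Real.exp_pos _).le hexp1)
    have hr : σ * p.1 * Real.exp (-b * (σ * p.1)) ≤ b⁻¹ := mul_exp_neg_le hb
    have hr0 : 0 ≤ σ * p.1 * Real.exp (-b * (σ * p.1)) := by positivity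
    have hf3 : f n p.1 ^ 2 ≤ b⁻¹ ^ 2 := hf1.trans (pow_le_pow_left₀ hr0 hr 2)
    have hf4 : f n p.1 ^ 2 ≤ b⁻¹ * (σ * p.1) := by
      refine hf1.trans ?_
      rw [sq]
      exact mul_le_mul hr (mul_le_of_le_one_right hp.le hexp1) hr0 (inv_nonneg.2 hb.le)
    have hp2 : 0 < p.1 ^ 2 := by positivity
    have ht2 : |f n p.1 ^ 2 / (4 * p.1 ^ 2)| ≤ 1 := by
      rw [abs_of_nonneg (by positivity), div_le_one (by positivity)]
      linarith
    have ht3 : |f n p.1 ^ 2 * (potential Φ p + l)| ≤ 1 + κ * b⁻¹ + (C + l) * b⁻¹ ^ 2 := by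
      have h1 := hpot p hp0
      have h2 : |potential Φ p + l| ≤ 3 / (4 * p.1 ^ 2) + κ / (σ * p.1) + (C + l) := by
        rw [habs _ hp] at h1
        have h3 : potential Φ p + l = (potential Φ p - 3 / (4 * p.1 ^ 2)) +
          (3 / (4 * p.1 ^ 2) + l) := by ring
        rw [h3]
        refine (abs_add_le _ _).trans ?_
        rw [abs_of_nonneg (by positivity : 0 ≤ 3 / (4 * p.1 ^ 2) + l)]
        linarith
      rw [abs_mul, abs_of_nonneg (sq_nonneg _)]
      calc f n p.1 ^ 2 * |potential Φ p + l|
          ≤ f n p.1 ^ 2 * (3 / (4 * p.1 ^ 2) + κ / (σ * p.1) + (C + l)) :=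
            mul_le_mul_of_nonneg_left h2 (sq_nonneg _)
        _ = f n p.1 ^ 2 * (3 / (4 * p.1 ^ 2)) + f n p.1 ^ 2 * (κ / (σ * p.1)) +
            f n p.1 ^ 2 * (C + l) := by ring
        _ ≤ p.1 ^ 2 * (3 / (4 * p.1 ^ 2)) + b⁻¹ * (σ * p.1) * (κ / (σ * p.1)) +
            b⁻¹ ^ 2 * (C + l) := by
            gcongr
        _ ≤ 1 + κ * b⁻¹ + (C + l) * b⁻¹ ^ 2 := by
            have e1 : p.1 ^ 2 * (3 / (4 * p.1 ^ 2)) = 3 / 4 := by field_simp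
            have e2 : b⁻¹ * (σ * p.1) * (κ / (σ * p.1)) = κ * b⁻¹ := by
              have := hp.ne'
              field_simp
            rw [e1, e2]
            linarith
    calc |W n p| ≤ |deriv (f n) p.1 ^ 2| + |f n p.1 ^ 2 / (4 * p.1 ^ 2)| +
          |f n p.1 ^ 2 * (potential Φ p + l)| :=
          (abs_sub _ _).trans (add_le_add (abs_sub _ _) le_rfl)
      _ ≤ E := by
          rw [abs_of_nonneg (sq_nonneg _)]
          linarith
  have hlim : ∀ p : Cyl, 0 < σ * p.1 → Tendsto (fun n => W n p) atTop (𝓝 (w p)) := by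
    intro p hp
    have hp0 : p.1 ≠ 0 := by rintro h; simp [h] at hp
    refine tendsto_const_nhds.congr' ?_
    filter_upwards [eventually_cutoff_eq b hp] with n hn
    simp only [hW, hw, hfd]
    rw [hn.2]
    simp only [hf]
    rw [hn.1]
    have e1 : (σ * p.1 * Real.exp (-b * (σ * p.1))) ^ 2 =
        p.1 ^ 2 * Real.exp (-b * (σ * p.1)) ^ 2 := by rw [mul_pow, hx2]
    have e2 : (σ * ((1 - b * (σ * p.1)) * Real.exp (-b * (σ * p.1)))) ^ 2 =
        (1 - b * (σ * p.1)) ^ 2 * Real.exp (-b * (σ * p.1)) ^ 2 := by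
      rw [mul_pow, hσ]; ring
    rw [e1, e2]
    field_simp
  have hneg : ∀ p : Cyl, 0 < σ * p.1 → w p < 0 := by
    intro p hp
    have hp0 : p.1 ≠ 0 := by rintro h; simp [h] at hp
    have h1 := (abs_le.1 (hpot p hp0)).1
    rw [habs _ hp] at h1
    have hp2 : 0 < p.1 ^ 2 := by positivity
    have h2 : p.1 ^ 2 * (3 / (4 * p.1 ^ 2) - κ / (σ * p.1) - C + l) ≤
        p.1 ^ 2 * (potential Φ p + l) := mul_le_mul_of_nonneg_left (by linarith) hp2.le
    have h3 : p.1 ^ 2 * (3 / (4 * p.1 ^ 2) - κ / (σ * p.1) - C + l) =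
        3 / 4 - κ * (σ * p.1) + (l - C) * (σ * p.1) ^ 2 := by
      rw [← hx2]
      have := hp.ne'
      field_simp
      ring
    refine mul_neg_of_pos_of_neg (by positivity) ?_
    have h4 : 0 < (l - C - b ^ 2) * (σ * p.1) ^ 2 := mul_pos (by linarith) (by positivity)
    have h5 : κ * (σ * p.1) ≤ 2 * b * (σ * p.1) := mul_le_mul_of_nonneg_right hκb hp.le
    nlinarith
  set F : Cyl → ℝ := fun p => if 0 < σ * p.1 then w p * ‖u p‖ ^ 2 else 0 with hF
  have hFl : ∀ p, Tendsto (fun n => W n p * ‖u p‖ ^ 2) atTop (𝓝 (F p)) := by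
    intro p
    by_cases hp : 0 < σ * p.1
    · simp only [hF, if_pos hp]
      exact (hlim p hp).mul_const _
    · simp only [hF, if_neg hp, hW0 _ p hp, zero_mul]
      exact tendsto_const_nhds
  have hmeas : ∀ n, AEStronglyMeasurable (fun p => W n p * ‖u p‖ ^ 2)
      ((volume : Measure ℝ).prod haarAddCircle) := fun n =>
    (hWm n).aestronglyMeasurable.mul hsq.1
  have hbound : ∀ n p, ‖W n p * ‖u p‖ ^ 2‖ ≤ E * ‖u p‖ ^ 2 := fun n p => by
    rw [norm_mul, Real.norm_of_nonneg (sq_nonneg ‖u p‖)]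
    exact mul_le_mul_of_nonneg_right (hWb n p) (sq_nonneg _)
  have hDCT := tendsto_integral_of_dominated_convergence (fun p => E * ‖u p‖ ^ 2) hmeas
    (hsq.const_mul E) (fun n => Eventually.of_forall (hbound n)) (Eventually.of_forall hFl)
  have hge : 0 ≤ ∫ p, F p ∂((volume : Measure ℝ).prod haarAddCircle) :=
    ge_of_tendsto' hDCT fun n => hu.weighted_inequality hJ hJ' h0 hne hc (hft n)
  have hFn : ∀ p, F p ≤ 0 := by
    intro p
    by_cases hp : 0 < σ * p.1
    · simp only [hF, if_pos hp]
      exact mul_nonpos_of_nonpos_of_nonneg (hneg p hp).le (sq_nonneg _)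
    · simp only [hF, if_neg hp, le_refl]
  have hFi : Integrable F ((volume : Measure ℝ).prod haarAddCircle) :=
    (hsq.const_mul E).mono' (aestronglyMeasurable_of_tendsto_ae atTop hmeas
      (Eventually.of_forall hFl)) (Eventually.of_forall fun p =>
        le_of_tendsto' (hFl p).norm fun n => hbound n p)
  have hzero : ∫ p, -F p ∂((volume : Measure ℝ).prod haarAddCircle) = 0 := by
    rw [integral_neg]
    have h1 : ∫ p, F p ∂((volume : Measure ℝ).prod haarAddCircle) ≤ 0 :=
      integral_nonpos hFn
    linarith
  have hae := (integral_eq_zero_iff_of_nonneg (fun p => neg_nonneg.2 (hFn p)) hFi.neg).1 hzero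
  filter_upwards [hae] with p hp hpos
  have h1 : w p * ‖u p‖ ^ 2 = 0 := by
    have : F p = 0 := neg_eq_zero.1 hp
    simpa only [hF, if_pos hpos] using this
  have h2 := (mul_eq_zero.1 h1).resolve_left (hneg p hpos).ne
  exact norm_eq_zero.1 (pow_eq_zero_iff (two_ne_zero) |>.1 h2)

end Vanishing

section Core

open AddCircle (haarAddCircle)
open scoped ComplexConjugate

/-- One `l > 0` for which the range of `Δ - l` on test functions has trivial orthogonal complement,
in each region `U` which is a union of half-cylinders. -/
theorem exists_deficiency_eq_zero {Φ : Cyl → ℝ} (hΦ : IsSmooth Φ)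
    (hconst : ∃ R c : ℝ, ∀ p : Cyl, R ≤ |p.1| → Φ p = c) :
    ∃ l : ℝ, 0 < l ∧ ∀ U : Set Cyl, MeasurableSet U → U ⊆ regOmega →
      (∀ p ∈ U, ∀ p' : Cyl, 0 < p.1 * p'.1 → p' ∈ U) → ∀ ψ : L2 Φ U,
      (∀ φ ∈ testFunctions U,
        ∫ p, conj (ψ p) * (laplaceBeltrami Φ φ p - l * φ p) ∂(area Φ U) = 0) → ψ = 0 := by
  obtain ⟨κ, C, hκ, hC, hpot⟩ := exists_potential_bound hΦ hconst
  -- `IsWeakSolution.ae_eq_zero` is applied with `b = κ + 1`, and asks for `b ^ 2 + C < l`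
  refine ⟨(κ + 1) ^ 2 + C + 1, by positivity, fun U hUm hU hsat ψ horth => ?_⟩
  have hψm : Measurable ψ := (Lp.stronglyMeasurable ψ).measurable
  -- `ψ` vanishes on each half-cylinder contained in `U`
  have hhalf : ∀ σ : ℝ, σ ^ 2 = 1 → {x : ℝ | 0 < σ * x} ×ˢ univ ⊆ U →
      ∀ᵐ p : Cyl, 0 < σ * p.1 → ψ p = 0 := by
    intro σ hσ hσU
    have hJm : MeasurableSet {x : ℝ | 0 < σ * x} :=
      (isOpen_lt continuous_const (by fun_prop)).measurableSet
    have h1 := (isWeakSolution_of_orthogonal hΦ hJm hUm hU hσU _ hψm (Lp.memLp ψ) horth).ae_eq_zero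
      hΦ hκ hC hpot (b := κ + 1) (by positivity) (by linarith) (by linarith) hσ
    rw [volume_cyl]
    refine Measure.ae_smul_measure (h1.mono fun p hp hpσ => ?_) _
    have h2 := hp hpσ
    rw [indicator_of_mem (show p ∈ {x : ℝ | 0 < σ * x} ×ˢ univ from ⟨hpσ, mem_univ _⟩)] at h2
    refine (mul_eq_zero.1 h2).resolve_left ?_
    exact_mod_cast inv_ne_zero (Real.exp_pos _).ne'
  rw [Lp.eq_zero_iff_ae_eq_zero]
  refine (withDensity_absolutelyContinuous _ _).ae_le ?_
  have hcase : ∀ σ : ℝ, σ ^ 2 = 1 → ∀ᵐ p : Cyl, p ∈ U → 0 < σ * p.1 → ψ p = 0 := by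
    intro σ hσ
    by_cases h : ∃ p ∈ U, 0 < σ * p.1
    · obtain ⟨p, hp, hpσ⟩ := h
      refine (hhalf σ hσ fun p' hp' => hsat p hp p' ?_).mono fun p h _ => h
      have h1 : 0 < (σ * p.1) * (σ * p'.1) := mul_pos hpσ hp'.1
      nlinarith
    · exact Eventually.of_forall fun p hp hpσ => absurd ⟨p, hp, hpσ⟩ h
  filter_upwards [ae_restrict_mem hUm, ae_restrict_of_ae (hcase 1 (by norm_num)),
    ae_restrict_of_ae (hcase (-1) (by norm_num))] with p hp h1 h2
  rcases lt_or_gt_of_ne (hU hp : p.1 ≠ 0) with h | h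
  · exact h2 hp (by linarith)
  · exact h1 hp (by linarith)

end Core

/-! ### Integration by parts and essential self-adjointness -/

section Symmetry

open scoped ComplexConjugate

lemma IsSmooth.hasDerivAt_pderiv_zero {f : Cyl → ℂ} (hf : IsSmooth f) (x : ℝ) (y : Circ) :
    HasDerivAt (fun s : ℝ => f (s, y)) (AlmostRiem.pderiv 0 f (x, y)) x := by
  obtain ⟨t, rfl⟩ := QuotientAddGroup.mk_surjective y
  exact (hasDerivAt_x_aux hf x t).differentiableAt.hasDerivAt

lemma IsSmooth.hasDerivAt_pderiv_one {f : Cyl → ℂ} (hf : IsSmooth f) (x t : ℝ) :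
    HasDerivAt (fun s : ℝ => f (x, (s : Circ))) (AlmostRiem.pderiv 1 f (x, (t : Circ))) t := by
  rw [pderiv_one_of_hasDerivAt (hasDerivAt_y_aux hf x t)]
  exact hasDerivAt_y_aux hf x t

/-- Leibniz' rule. -/
lemma pderiv_mul_conj {f g : Cyl → ℂ} (hf : IsSmooth f) (hg : IsSmooth g) (i : Fin 2) (p : Cyl) :
    pderiv i (fun p => g p * conj (f p)) p =
      pderiv i g p * conj (f p) + g p * conj (pderiv i f p) := by
  obtain ⟨x, y⟩ := p
  obtain ⟨t, rfl⟩ := QuotientAddGroup.mk_surjective y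
  fin_cases i
  · exact pderiv_zero_of_hasDerivAt
      ((hg.hasDerivAt_pderiv_zero x _).mul (hf.hasDerivAt_pderiv_zero x _).star)
  · exact pderiv_one_of_hasDerivAt
      ((hg.hasDerivAt_pderiv_one x t).mul (hf.hasDerivAt_pderiv_one x t).star)

lemma mul_conj_mem {U : Set Cyl} {f g : Cyl → ℂ} (hf : IsSmooth f) (hg : g ∈ testFunctions U) :
    (fun p => g p * conj (f p)) ∈ testFunctions U := by
  have hs : tsupport (fun p => g p * conj (f p)) ⊆ tsupport g :=
    tsupport_subset_of_eq_zero fun p hp => by simp [image_eq_zero_of_notMem_tsupport hp]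
  exact ⟨ContDiff.mul hg.1 (Complex.conjCLE.contDiff.comp hf),
    hg.2.1.of_isClosed_subset (isClosed_tsupport _) hs, hs.trans hg.2.2⟩

lemma integrable_of_mem {U : Set Cyl} {f : Cyl → ℂ} (hf : f ∈ testFunctions U) : Integrable f :=
  hf.1.continuous.integrable_of_hasCompactSupport hf.2.1

lemma integral_pderiv_eq_zero {U : Set Cyl} {f : Cyl → ℂ} (hf : f ∈ testFunctions U) (i : Fin 2) :
    ∫ p, pderiv i f p = 0 := by
  have hi0 := integrable_of_mem (pderiv_mem hf 0)
  have hi1 := integrable_of_mem (pderiv_mem hf 1)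
  have hfi := integrable_of_mem hf
  rw [Measure.volume_eq_prod] at hi0 hi1 hfi ⊢
  fin_cases i
  · change ∫ p, pderiv 0 f p ∂(volume.prod volume) = 0
    rw [integral_prod_symm _ hi0]
    refine integral_eq_zero_of_ae ?_
    filter_upwards [hi0.prod_left_ae, hfi.prod_left_ae] with y h1 h2
    exact integral_eq_zero_of_hasDerivAt_of_integrable
      (fun x => hf.1.hasDerivAt_pderiv_zero x y) h1 h2
  · change ∫ p, pderiv 1 f p ∂(volume.prod volume) = 0
    rw [integral_prod _ hi1]
    refine integral_eq_zero_of_ae (Eventually.of_forall fun x => ?_)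
    change ∫ y : Circ, pderiv 1 f (x, y) = 0
    rw [← AddCircle.intervalIntegral_preimage (2 * Real.pi) 0,
      intervalIntegral.integral_eq_sub_of_hasDerivAt
        (fun t _ => hf.1.hasDerivAt_pderiv_one x t)]
    · rw [zero_add, AddCircle.coe_period, AddCircle.coe_zero, sub_self]
    · refine Continuous.intervalIntegrable ?_ _ _
      exact (hf.1.pderiv 1).continuous.comp
        (continuous_const.prodMk (AddCircle.continuous_mk' _))

variable {Φ : Cyl → ℝ} {U : Set Cyl}

lemma integral_area (hΦ : IsSmooth Φ) (f : Cyl → ℂ) (hf : ∀ p, p ∉ U → f p = 0) :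
    ∫ p, f p ∂(area Φ U) = ∫ p, (areaDensity Φ p : ℂ) * f p := by
  rw [area, integral_withDensity_eq_integral_toReal_smul
    (measurable_areaDensity hΦ).ennreal_ofReal (Eventually.of_forall fun p =>
      ENNReal.ofReal_lt_top)]
  have h1 : ∀ p, (ENNReal.ofReal (areaDensity Φ p)).toReal • f p = (areaDensity Φ p : ℂ) * f p :=
    fun p => by
      have h2 : 0 ≤ areaDensity Φ p := Real.sqrt_nonneg _
      rw [ENNReal.toReal_ofReal h2, Complex.real_smul]
  simp only [h1]
  exact setIntegral_eq_integral_of_forall_compl_eq_zero fun p hp => by rw [hf p hp, mul_zero]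

/-- The Dirichlet form of the metric. -/
def dirichlet (Φ : Cyl → ℝ) (f g : Cyl → ℂ) : ℂ :=
  ∫ p, ((areaDensity Φ p : ℂ) * (pderiv 0 g p * conj (pderiv 0 f p)) +
    (((areaDensity Φ p)⁻¹ : ℝ) : ℂ) * (pderiv 1 g p * conj (pderiv 1 f p)))

lemma eq_zero_of_notMem {f : Cyl → ℂ} (hf : f ∈ testFunctions U) {p : Cyl} (hp : p ∉ U) : f p = 0 :=
  image_eq_zero_of_notMem_tsupport fun h => hp (hf.2.2 h)

/-- Green's formula. -/
lemma integral_laplaceBeltrami (hΦ : IsSmooth Φ) (hU : U ⊆ regOmega) {f g : Cyl → ℂ}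
    (hf : f ∈ testFunctions U) (hg : g ∈ testFunctions U) :
    ∫ p, laplaceBeltrami Φ g p * conj (f p) ∂(area Φ U) = -dirichlet Φ f g := by
  rw [integral_area hΦ _ fun p hp => by rw [eq_zero_of_notMem hf hp, map_zero, mul_zero]]
  have hA : (fun q => ((areaDensity Φ q : ℝ) : ℂ) * pderiv 0 g q) ∈ testFunctions U :=
    mul_mem hU (contDiffOn_areaDensity hΦ) (pderiv_mem hg 0)
  have hB : (fun q => (((areaDensity Φ q)⁻¹ : ℝ) : ℂ) * pderiv 1 g q) ∈ testFunctions U :=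
    mul_mem (c := fun q => (areaDensity Φ q)⁻¹) hU
      ((contDiffOn_areaDensity hΦ).inv fun q hq => (areaDensity_pos Φ hq).ne') (pderiv_mem hg 1)
  have hAf := mul_conj_mem hf.1 hA
  have hBf := mul_conj_mem hf.1 hB
  have h1 := integral_pderiv_eq_zero hAf 0
  have h2 := integral_pderiv_eq_zero hBf 1
  have hsum : ∫ p, ((areaDensity Φ p : ℂ) * (laplaceBeltrami Φ g p * conj (f p)) +
      ((areaDensity Φ p : ℂ) * (pderiv 0 g p * conj (pderiv 0 f p)) +
      (((areaDensity Φ p)⁻¹ : ℝ) : ℂ) * (pderiv 1 g p * conj (pderiv 1 f p)))) = 0 := by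
    rw [← add_zero (0 : ℂ)]
    nth_rewrite 1 [← h1]
    rw [← h2, ← integral_add (integrable_of_mem (pderiv_mem hAf 0))
      (integrable_of_mem (pderiv_mem hBf 1))]
    refine integral_congr_ae (Eventually.of_forall fun p => ?_)
    simp only [pderiv_mul_conj hf.1 hA.1, pderiv_mul_conj hf.1 hB.1]
    by_cases hp : p ∈ U
    · have h3 : (areaDensity Φ p : ℂ) ≠ 0 := by exact_mod_cast (areaDensity_pos Φ (hU hp)).ne'
      rw [laplaceBeltrami_eq]
      push_cast
      field_simp
      ring
    · rw [eq_zero_of_notMem hf hp, eq_zero_of_notMem (pderiv_mem hf 0) hp,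
        eq_zero_of_notMem (pderiv_mem hf 1) hp]
      simp
  have hi1 : Integrable fun p => (areaDensity Φ p : ℂ) * (laplaceBeltrami Φ g p * conj (f p)) :=
    integrable_of_mem (mul_mem hU (contDiffOn_areaDensity hΦ)
      (mul_conj_mem hf.1 (laplaceBeltrami_mem hΦ hU hg)))
  have hi2 : Integrable fun p => (areaDensity Φ p : ℂ) * (pderiv 0 g p * conj (pderiv 0 f p)) :=
    integrable_of_mem (mul_mem hU (contDiffOn_areaDensity hΦ)
      (mul_conj_mem (hf.1.pderiv 0) (pderiv_mem hg 0)))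
  have hi3 : Integrable fun p =>
      (((areaDensity Φ p)⁻¹ : ℝ) : ℂ) * (pderiv 1 g p * conj (pderiv 1 f p)) :=
    integrable_of_mem (mul_mem (c := fun q => (areaDensity Φ q)⁻¹) hU
      ((contDiffOn_areaDensity hΦ).inv fun q hq => (areaDensity_pos Φ hq).ne')
      (mul_conj_mem (hf.1.pderiv 1) (pderiv_mem hg 1)))
  exact eq_neg_of_add_eq_zero_left ((integral_add hi1 (hi2.add hi3)).symm.trans hsum)

lemma conj_dirichlet (f g : Cyl → ℂ) : conj (dirichlet Φ f g) = dirichlet Φ g f := by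
  rw [dirichlet, dirichlet, ← integral_conj]
  refine integral_congr_ae (Eventually.of_forall fun p => ?_)
  simp only [map_add, map_mul, Complex.conj_ofReal, Complex.conj_conj]
  ring

lemma dirichlet_self_re_nonneg (f : Cyl → ℂ) : 0 ≤ (dirichlet Φ f f).re := by
  have h : dirichlet Φ f f = ((∫ p, (areaDensity Φ p * ‖pderiv 0 f p‖ ^ 2 +
      (areaDensity Φ p)⁻¹ * ‖pderiv 1 f p‖ ^ 2) : ℝ) : ℂ) := by
    refine Eq.trans (integral_congr_ae (Eventually.of_forall fun p => ?_))
      (integral_ofReal (𝕜 := ℂ))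
    simp only [Complex.mul_conj, Complex.normSq_eq_norm_sq]
    push_cast
    rfl
  rw [h, Complex.ofReal_re]
  have hω : ∀ p, 0 ≤ areaDensity Φ p := fun p => Real.sqrt_nonneg _
  exact integral_nonneg fun p => add_nonneg (mul_nonneg (hω p) (sq_nonneg _))
    (mul_nonneg (inv_nonneg.2 (hω p)) (sq_nonneg _))

lemma exists_test_of_mem_domain (hΦ : IsSmooth Φ) (hU : U ⊆ regOmega)
    (t : (laplacian Φ hΦ U hU).domain) : ∃ φ : testFunctions U,
      (t : L2 Φ U) = testToL2 Φ hΦ U hU φ ∧ laplacian Φ hΦ U hU t = laplaceToL2 Φ hΦ U hU φ := by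
  obtain ⟨_, φ, rfl⟩ := t
  exact ⟨φ, rfl, laplacian_apply Φ hΦ U hU φ⟩

lemma inner_laplace_test (hΦ : IsSmooth Φ) (hU : U ⊆ regOmega) (φ χ : testFunctions U) :
    ⟪testToL2 Φ hΦ U hU φ, laplaceToL2 Φ hΦ U hU χ⟫_ℂ = -dirichlet Φ φ χ := by
  rw [← integral_laplaceBeltrami hΦ hU φ.2 χ.2]
  exact inner_toLp_eq (memLp_of_mem hΦ hU (laplaceBeltrami_mem hΦ hU χ.2)) (memLp_of_mem hΦ hU φ.2)

lemma inner_toLp_right {X : Type*} [MeasurableSpace X] {μ : Measure X} (ψ : Lp ℂ 2 μ) {f : X → ℂ}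
    (hf : MemLp f 2 μ) : ⟪ψ, hf.toLp f⟫_ℂ = ∫ x, conj (ψ x) * f x ∂μ := by
  rw [L2.inner_def]
  refine integral_congr_ae ?_
  filter_upwards [hf.coeFn_toLp] with x hx
  rw [hx, RCLike.inner_apply, mul_comm]

/-- The Laplace-Beltrami operator on test functions is essentially self-adjoint, and its closure
has a resolvent. -/
theorem exists_laplacian_resolvent (hΦ : IsSmooth Φ)
    (hconst : ∃ R c : ℝ, ∀ p : Cyl, R ≤ |p.1| → Φ p = c) (hUm : MeasurableSet U)
    (hU : U ⊆ regOmega) (hsat : ∀ p ∈ U, ∀ p' : Cyl, 0 < p.1 * p'.1 → p' ∈ U) :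
    Dense ((laplacian Φ hΦ U hU).domain : Set (L2 Φ U)) ∧
    IsUniqueSelfAdjointExtension (laplacian Φ hΦ U hU) (LinearPMap.adjoint (laplacian Φ hΦ U hU)) ∧
    ∃ (l : ℝ) (R : L2 Φ U →L[ℂ] L2 Φ U),
      IsResolvent (LinearPMap.adjoint (laplacian Φ hΦ U hU)) l R := by
  obtain ⟨l, hl, hdef⟩ := exists_deficiency_eq_zero hΦ hconst
  set T := laplacian Φ hΦ U hU
  have hrange : ∀ ψ : L2 Φ U, (∀ t : T.domain, ⟪ψ, T t - (l : ℂ) • (t : L2 Φ U)⟫_ℂ = 0) →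
      ψ = 0 := by
    intro ψ hψ
    refine hdef U hUm hU hsat ψ fun φ hφ => ?_
    have h1 := hψ ⟨testToL2 Φ hΦ U hU ⟨φ, hφ⟩, LinearMap.mem_range_self _ _⟩
    have h2 : T ⟨testToL2 Φ hΦ U hU ⟨φ, hφ⟩, LinearMap.mem_range_self _ _⟩ =
        laplaceToL2 Φ hΦ U hU ⟨φ, hφ⟩ := laplacian_apply Φ hΦ U hU ⟨φ, hφ⟩
    rw [h2] at h1
    have hL := laplaceBeltrami_mem hΦ hU hφ
    have h3 : laplaceToL2 Φ hΦ U hU ⟨φ, hφ⟩ - (l : ℂ) • testToL2 Φ hΦ U hU ⟨φ, hφ⟩ =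
        ((memLp_of_mem hΦ hU hL).sub ((memLp_of_mem hΦ hU hφ).const_smul (l : ℂ))).toLp _ := by
      rw [MemLp.toLp_sub (memLp_of_mem hΦ hU hL) ((memLp_of_mem hΦ hU hφ).const_smul (l : ℂ)),
        MemLp.toLp_const_smul _ (memLp_of_mem hΦ hU hφ)]
      rfl
    rw [h3, inner_toLp_right] at h1
    simpa using h1
  -- `T` maps its domain to itself, so the domain contains the range of `T - l`
  have hdense : Dense (T.domain : Set (L2 Φ U)) := by
    have h1 : T.domainᗮ = ⊥ := by
      refine (Submodule.eq_bot_iff _).2 fun ψ hψ => hrange ψ fun t => ?_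
      obtain ⟨φ, h2, h3⟩ := exists_test_of_mem_domain hΦ hU t
      have h4 : T t ∈ T.domain := by
        rw [h3]
        exact ⟨⟨_, laplaceBeltrami_mem hΦ hU φ.2⟩, rfl⟩
      exact (Submodule.mem_orthogonal' _ _).1 hψ _
        (T.domain.sub_mem h4 (T.domain.smul_mem _ t.2))
    have h2 := (Submodule.topologicalClosure_eq_top_iff).2 h1
    exact Submodule.dense_iff_topologicalClosure_eq_top.2 h2
  obtain ⟨h1, R, h2⟩ := exists_isResolvent_adjoint hdense (fun s t => by
    obtain ⟨φ, h1, h2⟩ := exists_test_of_mem_domain hΦ hU s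
    obtain ⟨χ, h3, h4⟩ := exists_test_of_mem_domain hΦ hU t
    rw [h1, h2, h3, h4, inner_laplace_test, ← inner_conj_symm, inner_laplace_test, map_neg,
      conj_dirichlet]) (fun t => by
    obtain ⟨φ, h1, h2⟩ := exists_test_of_mem_domain hΦ hU t
    rw [h1, h2, inner_laplace_test, Complex.neg_re]
    exact neg_nonpos.2 (dirichlet_self_re_nonneg _)) hl hrange
  exact ⟨hdense, h1, l, R, h2⟩

end Symmetry

/-! ### Uniqueness and invariant subspaces for the evolution equations -/

section Uniqueness

variable {H : Type*} [NormedAddCommGroup H] [InnerProductSpace ℂ H] [CompleteSpace H]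
  {A : H →ₗ.[ℂ] H} {l : ℝ} {R : H →L[ℂ] H}

lemma IsResolvent.heat_unique (h : IsResolvent A l R) {u₀ : H} {u w : ℝ → H}
    (hu : IsHeatSolution A u₀ u) (hw : IsHeatSolution A u₀ w) {t : ℝ} (ht : 0 ≤ t) : w t = u t := by
  refine sub_eq_zero.1 (h.firstOrder_eq_zero (c := 1) (by simp) (d := fun t => w t - u t)
    (hw.1.sub hu.1) (by rw [hw.2.1, hu.2.1, sub_self]) (fun v t ht => ?_) ht)
  simp only [inner_sub_right, one_mul]
  exact (hw.2.2 v t ht).sub (hu.2.2 v t ht)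

lemma IsResolvent.schrodinger_unique (h : IsResolvent A l R) {u₀ : H} {u w : ℝ → H}
    (hu : IsSchrodingerSolution A u₀ u) (hw : IsSchrodingerSolution A u₀ w) {t : ℝ} (ht : 0 ≤ t) :
    w t = u t := by
  refine sub_eq_zero.1 (h.firstOrder_eq_zero (c := Complex.I) (by simp) (d := fun t => w t - u t)
    (hw.1.sub hu.1) (by rw [hw.2.1, hu.2.1, sub_self]) (fun v t ht => ?_) ht)
  simp only [inner_sub_right, mul_sub]
  exact (hw.2.2 v t ht).sub (hu.2.2 v t ht)

lemma IsResolvent.wave_unique (h : IsResolvent A l R) {u₀ u₁ : H} {u w : ℝ → H}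
    (hu : IsWaveSolution A u₀ u₁ u) (hw : IsWaveSolution A u₀ u₁ w) {t : ℝ} (ht : 0 ≤ t) :
    w t = u t := by
  refine sub_eq_zero.1 (h.secondOrder_eq_zero (d := fun t => w t - u t)
    (hw.1.sub hu.1) (by rw [hw.2.1, hu.2.1, sub_self]) (fun v => ?_) ht)
  obtain ⟨f, hf0, hf⟩ := hu.2.2 v
  obtain ⟨g, hg0, hg⟩ := hw.2.2 v
  refine ⟨fun t => g t - f t, sub_eq_zero.2 (hg0.trans hf0.symm), fun t ht => ?_⟩
  simp only [inner_sub_right]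
  exact ⟨(hg t ht).1.sub (hf t ht).1, (hg t ht).2.sub (hf t ht).2⟩

/-- The symmetric operator `P` maps the domain of `A` to itself and commutes with `A`. -/
structure Reduces (P : H →L[ℂ] H) (A : H →ₗ.[ℂ] H) : Prop where
  symm : ∀ x y, ⟪P x, y⟫_ℂ = ⟪x, P y⟫_ℂ
  graph : ∀ x z, (x, z) ∈ A.graph → (P x, P z) ∈ A.graph

variable {P : H →L[ℂ] H}

lemma Reduces.exists_domain (hP : Reduces P A) (v : A.domain) :
    ∃ v' : A.domain, (v' : H) = P v ∧ A v' = P (A v) := by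
  have h := hP.graph _ _ (A.mem_graph v)
  obtain ⟨v', h1, h2⟩ := A.mem_graph_iff.1 h
  exact ⟨v', h1, h2⟩

lemma Reduces.heat (hP : Reduces P A) {u₀ : H} {u : ℝ → H} (hu : IsHeatSolution A u₀ u) :
    IsHeatSolution A (P u₀) fun t => P (u t) := by
  refine ⟨P.continuous.comp_continuousOn hu.1, congrArg P hu.2.1, fun v t ht => ?_⟩
  obtain ⟨v', h1, h2⟩ := hP.exists_domain v
  have h3 := hu.2.2 v' t ht
  simp only [h1, h2, hP.symm] at h3
  exact h3

lemma Reduces.schrodinger (hP : Reduces P A) {u₀ : H} {u : ℝ → H}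
    (hu : IsSchrodingerSolution A u₀ u) :
    IsSchrodingerSolution A (P u₀) fun t => P (u t) := by
  refine ⟨P.continuous.comp_continuousOn hu.1, congrArg P hu.2.1, fun v t ht => ?_⟩
  obtain ⟨v', h1, h2⟩ := hP.exists_domain v
  have h3 := hu.2.2 v' t ht
  simp only [h1, h2, hP.symm] at h3
  exact h3

lemma Reduces.wave (hP : Reduces P A) {u₀ u₁ : H} {u : ℝ → H} (hu : IsWaveSolution A u₀ u₁ u) :
    IsWaveSolution A (P u₀) (P u₁) fun t => P (u t) := by
  refine ⟨P.continuous.comp_continuousOn hu.1, congrArg P hu.2.1, fun v => ?_⟩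
  obtain ⟨v', h1, h2⟩ := hP.exists_domain v
  obtain ⟨f, hf0, hf⟩ := hu.2.2 v'
  simp only [h1, h2, hP.symm] at hf0 hf
  exact ⟨f, hf0, hf⟩

end Uniqueness

/-! ### Decoupling of the two half-cylinders -/

section Decoupling

open scoped ComplexConjugate

variable {Φ : Cyl → ℝ}

lemma mem_graph_adjoint_laplacian_iff (hΦ : IsSmooth Φ) {U : Set Cyl} (hU : U ⊆ regOmega)
    (hd : Dense ((laplacian Φ hΦ U hU).domain : Set (L2 Φ U))) (v w : L2 Φ U) :
    (v, w) ∈ (LinearPMap.adjoint (laplacian Φ hΦ U hU)).graph ↔ ∀ φ : testFunctions U,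
      ⟪w, testToL2 Φ hΦ U hU φ⟫_ℂ = ⟪v, laplaceToL2 Φ hΦ U hU φ⟫_ℂ := by
  rw [mem_graph_adjoint_iff hd]
  constructor
  · intro h φ
    have h1 := h ⟨testToL2 Φ hΦ U hU φ, LinearMap.mem_range_self _ φ⟩
    rwa [laplacian_apply] at h1
  · intro h t
    obtain ⟨φ, h1, h2⟩ := exists_test_of_mem_domain hΦ hU t
    rw [h1, h2]
    exact h φ

lemma testFunctions_mono {U V : Set Cyl} (h : U ⊆ V) : testFunctions U ≤ testFunctions V :=
  fun _ hφ => ⟨hφ.1, hφ.2.1, hφ.2.2.trans h⟩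

/-- Restriction to a half-cylinder which is open and closed in `Ω` preserves test functions. -/
lemma indicator_mem {V : Set Cyl} (hV : IsOpen V) (hV' : IsOpen (regOmega \ V)) {φ : Cyl → ℂ}
    (hφ : φ ∈ testFunctions regOmega) : V.indicator φ ∈ testFunctions V := by
  have h0 : ∀ p, p ∉ V → V.indicator φ =ᶠ[𝓝 p] 0 := by
    intro p hp
    by_cases hpΩ : p ∈ regOmega
    · filter_upwards [hV'.mem_nhds ⟨hpΩ, hp⟩] with r hr
      exact indicator_of_notMem hr.2 φ
    · have h1 : φ =ᶠ[𝓝 p] 0 :=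
        notMem_tsupport_iff_eventuallyEq.1 fun h => hpΩ (hφ.2.2 h)
      filter_upwards [h1] with r hr
      by_cases hrV : r ∈ V
      · rw [indicator_of_mem hrV, hr]
      · rw [indicator_of_notMem hrV]
        rfl
  refine ⟨contDiff_iff_contDiffAt.2 fun q => ?_, ?_, fun p hp => ?_⟩
  · by_cases hq : cover q ∈ V
    · refine (ContDiff.contDiffAt hφ.1).congr_of_eventuallyEq ?_
      filter_upwards [continuous_cover.continuousAt.eventually (hV.mem_nhds hq)] with r hr
      exact indicator_of_mem hr φ
    · have h1 : (fun q => V.indicator φ (cover q)) =ᶠ[𝓝 q] fun _ => 0 := by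
        filter_upwards [continuous_cover.continuousAt.eventually (h0 _ hq)] with r hr
        exact hr
      exact contDiffAt_const.congr_of_eventuallyEq h1
  · exact hφ.2.1.of_isClosed_subset (isClosed_tsupport _)
      (closure_mono fun p hp h => hp (by by_cases hpV : p ∈ V <;> simp [hpV, h]))
  · by_contra hpV
    exact notMem_tsupport_iff_eventuallyEq.2 (h0 p hpV) hp

lemma isOpen_regPlus : IsOpen regPlus := isOpen_lt continuous_const continuous_fst

lemma isOpen_regMinus : IsOpen regMinus := isOpen_lt continuous_fst continuous_const

lemma regOmega_diff_regPlus : regOmega \ regPlus = regMinus := by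
  ext p
  simp only [regOmega, regPlus, regMinus, Set.mem_sdiff, mem_ofPred_eq, not_lt]
  exact ⟨fun h => lt_of_le_of_ne h.2 h.1, fun h => ⟨h.ne, h.le⟩⟩

lemma regOmega_diff_regMinus : regOmega \ regMinus = regPlus := by
  ext p
  simp only [regOmega, regPlus, regMinus, Set.mem_sdiff, mem_ofPred_eq, not_lt]
  exact ⟨fun h => lt_of_le_of_ne h.2 (Ne.symm h.1), fun h => ⟨h.ne', h.le⟩⟩

lemma exists_split {φ : Cyl → ℂ} (hφ : φ ∈ testFunctions regOmega) :
    ∃ φm ∈ testFunctions regMinus, ∃ φp ∈ testFunctions regPlus, φ = φm + φp := by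
  refine ⟨_, indicator_mem isOpen_regMinus (regOmega_diff_regMinus ▸ isOpen_regPlus) hφ, _,
    indicator_mem isOpen_regPlus (regOmega_diff_regPlus ▸ isOpen_regMinus) hφ, ?_⟩
  funext p
  rcases lt_trichotomy p.1 0 with h | h | h
  · have h1 : p ∈ regMinus := h
    have h2 : p ∉ regPlus := not_lt.2 h.le
    simp [h1, h2]
  · have h1 : p ∉ regMinus := not_lt.2 h.ge
    have h2 : p ∉ regPlus := not_lt.2 h.le
    have h3 : p ∉ regOmega := fun h' => h' h
    simp [h1, h2, eq_zero_of_notMem hφ h3]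
  · have h1 : p ∉ regMinus := not_lt.2 h.le
    have h2 : p ∈ regPlus := h
    simp [h1, h2]

lemma area_mono (Φ : Cyl → ℝ) {U V : Set Cyl} (h : U ⊆ V) : area Φ U ≤ area Φ V := by
  refine Measure.le_iff.2 fun s hs => ?_
  rw [area, area, withDensity_apply _ hs, withDensity_apply _ hs]
  exact lintegral_mono' (Measure.restrict_mono subset_rfl (Measure.restrict_mono h le_rfl)) le_rfl

lemma inner_test_eq (hΦ : IsSmooth Φ) {U : Set Cyl} (hU : U ⊆ regOmega) {w : L2 Φ regOmega}
    {w' : L2 Φ U} (hw : w' =ᵐ[area Φ U] w) {f : Cyl → ℂ} (hf : f ∈ testFunctions U) :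
    ⟪w, (memLp_of_mem hΦ subset_rfl (testFunctions_mono hU hf)).toLp f⟫_ℂ =
      ⟪w', (memLp_of_mem hΦ hU hf).toLp f⟫_ℂ := by
  have h1 : ∀ p, p ∉ U → conj (w p) * f p = 0 := fun p hp => by
    rw [eq_zero_of_notMem hf hp, mul_zero]
  rw [inner_toLp_right, inner_toLp_right, integral_area hΦ _ fun p hp => h1 p fun h => hp (hU h),
    ← integral_area hΦ _ h1]
  refine integral_congr_ae ?_
  filter_upwards [hw] with p hp
  rw [hp]

/-- `Δ = Δ⁻ ⊕ Δ⁺`, since every test function on `Ω` is the sum of a test function on `Ω₋` and of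
one on `Ω₊`. -/
theorem isDirectSum_adjoint (hΦ : IsSmooth Φ)
    (hd : Dense ((laplacian Φ hΦ regOmega subset_rfl).domain : Set (L2 Φ regOmega)))
    (hdm : Dense ((laplacian Φ hΦ regMinus regMinus_subset).domain : Set (L2 Φ regMinus)))
    (hdp : Dense ((laplacian Φ hΦ regPlus regPlus_subset).domain : Set (L2 Φ regPlus))) :
    IsDirectSum (LinearPMap.adjoint (laplacian Φ hΦ regOmega subset_rfl))
      (LinearPMap.adjoint (laplacian Φ hΦ regMinus regMinus_subset))
      (LinearPMap.adjoint (laplacian Φ hΦ regPlus regPlus_subset)) := by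
  intro v w
  rw [mem_graph_adjoint_laplacian_iff hΦ _ hd]
  constructor
  · intro h
    have key : ∀ (U : Set Cyl) (hU : U ⊆ regOmega)
        (_ : Dense ((laplacian Φ hΦ U hU).domain : Set (L2 Φ U))), ∃ v' w' : L2 Φ U,
        (v', w') ∈ (LinearPMap.adjoint (laplacian Φ hΦ U hU)).graph ∧
          v' =ᵐ[area Φ U] v ∧ w' =ᵐ[area Φ U] w := by
      intro U hU hdU
      have hv := (Lp.memLp v).mono_measure (area_mono Φ hU)
      have hw := (Lp.memLp w).mono_measure (area_mono Φ hU)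
      refine ⟨hv.toLp v, hw.toLp w, ?_, hv.coeFn_toLp, hw.coeFn_toLp⟩
      rw [mem_graph_adjoint_laplacian_iff hΦ hU hdU]
      intro φ
      exact (inner_test_eq hΦ hU hw.coeFn_toLp φ.2).symm.trans
        ((h ⟨φ, testFunctions_mono hU φ.2⟩).trans
        (inner_test_eq hΦ hU hv.coeFn_toLp (laplaceBeltrami_mem hΦ hU φ.2)))
    exact ⟨key _ regMinus_subset hdm, key _ regPlus_subset hdp⟩
  · rintro ⟨⟨vm, wm, hm, hvm, hwm⟩, vp, wp, hp, hvp, hwp⟩ ⟨φ, hφ⟩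
    have key : ∀ (U : Set Cyl) (hU : U ⊆ regOmega)
        (_ : Dense ((laplacian Φ hΦ U hU).domain : Set (L2 Φ U))) (v' w' : L2 Φ U),
        (v', w') ∈ (LinearPMap.adjoint (laplacian Φ hΦ U hU)).graph →
          v' =ᵐ[area Φ U] v → w' =ᵐ[area Φ U] w → ∀ (f : Cyl → ℂ) (hf : f ∈ testFunctions U),
        ⟪w, testToL2 Φ hΦ regOmega subset_rfl ⟨f, testFunctions_mono hU hf⟩⟫_ℂ =
          ⟪v, laplaceToL2 Φ hΦ regOmega subset_rfl ⟨f, testFunctions_mono hU hf⟩⟫_ℂ := by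
      intro U hU hdU v' w' hg hv hw f hf
      exact (inner_test_eq hΦ hU hw hf).trans
        (((mem_graph_adjoint_laplacian_iff hΦ hU hdU v' w').1 hg ⟨f, hf⟩).trans
        (inner_test_eq hΦ hU hv (laplaceBeltrami_mem hΦ hU hf)).symm)
    obtain ⟨φm, hφm, φp, hφp, rfl⟩ := exists_split hφ
    have h1 := key _ regMinus_subset hdm vm wm hm hvm hwm φm hφm
    have h2 := key _ regPlus_subset hdp vp wp hp hvp hwp φp hφp
    have h3 : (⟨φm + φp, hφ⟩ : testFunctions regOmega) =
        ⟨φm, testFunctions_mono regMinus_subset hφm⟩ +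
          ⟨φp, testFunctions_mono regPlus_subset hφp⟩ := rfl
    rw [h3, map_add, map_add, inner_add_right, inner_add_right, h1, h2]

/-- Multiplication by the indicator function of `Ω₊`. -/
def restrictPlus (Φ : Cyl → ℝ) : L2 Φ regOmega →L[ℂ] L2 Φ regOmega :=
  LinearMap.mkContinuous
    { toFun := fun v => ((Lp.memLp v).indicator isOpen_regPlus.measurableSet).toLp _
      map_add' := fun v w => by
        rw [← MemLp.toLp_add]
        refine MemLp.toLp_congr _ _ ?_
        filter_upwards [Lp.coeFn_add v w] with p hp
        by_cases h : p ∈ regPlus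
        · simp only [Pi.add_apply, indicator_of_mem h]
          exact hp
        · simp [h]
      map_smul' := fun c v => by
        rw [RingHom.id_apply, ← MemLp.toLp_const_smul]
        refine MemLp.toLp_congr _ _ ?_
        filter_upwards [Lp.coeFn_smul c v] with p hp
        by_cases h : p ∈ regPlus
        · simp only [Pi.smul_apply, indicator_of_mem h]
          exact hp
        · simp [h] } 1 fun v => by
    rw [one_mul]
    refine Lp.norm_le_norm_of_ae_le ?_
    filter_upwards [((Lp.memLp v).indicator isOpen_regPlus.measurableSet).coeFn_toLp] with p hp
    refine (congrArg norm hp).trans_le ?_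
    exact norm_indicator_le_norm_self _ _

lemma restrictPlus_coeFn (v : L2 Φ regOmega) :
    restrictPlus Φ v =ᵐ[area Φ regOmega] regPlus.indicator v :=
  ((Lp.memLp v).indicator isOpen_regPlus.measurableSet).coeFn_toLp

lemma restrictPlus_eq_self_iff (v : L2 Φ regOmega) :
    restrictPlus Φ v = v ↔ SupportedInPlus v := by
  constructor
  · intro h
    have h1 := restrictPlus_coeFn v
    rw [h] at h1
    filter_upwards [h1] with p hp hpp
    rw [hp, indicator_of_notMem hpp]
  · intro h
    refine Lp.ext ?_
    filter_upwards [restrictPlus_coeFn v, h] with p h1 h2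
    by_cases hp : p ∈ regPlus
    · rw [h1, indicator_of_mem hp]
    · rw [h1, indicator_of_notMem hp, h2 hp]

lemma reduces_restrictPlus {A : L2 Φ regOmega →ₗ.[ℂ] L2 Φ regOmega}
    {Am : L2 Φ regMinus →ₗ.[ℂ] L2 Φ regMinus} {Ap : L2 Φ regPlus →ₗ.[ℂ] L2 Φ regPlus}
    (h : IsDirectSum A Am Ap) : Reduces (restrictPlus Φ) A := by
  have hac : ∀ {U : Set Cyl}, U ⊆ regOmega → area Φ U ≪ area Φ regOmega := fun hU =>
    Measure.absolutelyContinuous_of_le (area_mono Φ hU)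
  have hin : ∀ {U : Set Cyl}, MeasurableSet U → ∀ᵐ p ∂(area Φ U), p ∈ U := fun hU =>
    (withDensity_absolutelyContinuous _ _).ae_le (ae_restrict_mem hU)
  refine ⟨fun x y => ?_, fun v w hvw => ?_⟩
  · rw [L2.inner_def, L2.inner_def]
    refine integral_congr_ae ?_
    filter_upwards [restrictPlus_coeFn x, restrictPlus_coeFn y] with p h1 h2
    rw [h1, h2]
    by_cases hp : p ∈ regPlus <;> simp [hp]
  · obtain ⟨-, vp, wp, hp, hvp, hwp⟩ := (h v w).1 hvw
    have hplus : ∀ x : L2 Φ regOmega, restrictPlus Φ x =ᵐ[area Φ regPlus] x := by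
      intro x
      filter_upwards [(hac regPlus_subset).ae_le (restrictPlus_coeFn x),
        hin isOpen_regPlus.measurableSet] with p h1 h2
      rw [h1, indicator_of_mem h2]
    have hminus : ∀ x : L2 Φ regOmega,
        ((0 : L2 Φ regMinus) : Cyl → ℂ) =ᵐ[area Φ regMinus] restrictPlus Φ x := by
      intro x
      filter_upwards [(hac regMinus_subset).ae_le (restrictPlus_coeFn x),
        hin isOpen_regMinus.measurableSet, Lp.coeFn_zero ℂ 2 (area Φ regMinus)] with p h1 h2 h3
      have h4 : p ∉ regPlus := not_lt.2 (le_of_lt (show p.1 < 0 from h2))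
      rw [h1, indicator_of_notMem h4, h3]
      rfl
    exact (h _ _).2 ⟨⟨0, 0, Am.graph.zero_mem, hminus v, hminus w⟩,
      vp, wp, hp, hvp.trans (hplus v).symm, hwp.trans (hplus w).symm⟩

end Decoupling

end AlmostRiem

end

theorem mainTheorem4 (Φ : AlmostRiem.Cyl → ℝ) (hΦ : AlmostRiem.IsSmooth Φ)
    (hconst : ∃ R c : ℝ, ∀ p : AlmostRiem.Cyl, R ≤ |p.1| → Φ p = c) :
    ∃ (A : AlmostRiem.L2 Φ AlmostRiem.regOmega →ₗ.[ℂ] AlmostRiem.L2 Φ AlmostRiem.regOmega)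
      (Aminus : AlmostRiem.L2 Φ AlmostRiem.regMinus →ₗ.[ℂ] AlmostRiem.L2 Φ AlmostRiem.regMinus)
      (Aplus : AlmostRiem.L2 Φ AlmostRiem.regPlus →ₗ.[ℂ] AlmostRiem.L2 Φ AlmostRiem.regPlus),
      -- the unique self-adjoint extensions of the three Laplace-Beltrami operators
      AlmostRiem.IsUniqueSelfAdjointExtension
        (AlmostRiem.laplacian Φ hΦ AlmostRiem.regOmega subset_rfl) A ∧
      AlmostRiem.IsUniqueSelfAdjointExtension
        (AlmostRiem.laplacian Φ hΦ AlmostRiem.regMinus AlmostRiem.regMinus_subset) Aminus ∧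
      AlmostRiem.IsUniqueSelfAdjointExtension
        (AlmostRiem.laplacian Φ hΦ AlmostRiem.regPlus AlmostRiem.regPlus_subset) Aplus ∧
      AlmostRiem.IsDirectSum A Aminus Aplus ∧
      -- the Schrödinger equation
      (∀ u₀ : AlmostRiem.L2 Φ AlmostRiem.regOmega,
        ∃ u : ℝ → AlmostRiem.L2 Φ AlmostRiem.regOmega,
          AlmostRiem.IsSchrodingerSolution A u₀ u ∧
          (∀ w : ℝ → AlmostRiem.L2 Φ AlmostRiem.regOmega,
            AlmostRiem.IsSchrodingerSolution A u₀ w → ∀ t : ℝ, 0 ≤ t → w t = u t) ∧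
          (AlmostRiem.SupportedInPlus u₀ →
            ∀ t : ℝ, 0 ≤ t → AlmostRiem.SupportedInPlus (u t))) ∧
      -- the heat equation
      (∀ u₀ : AlmostRiem.L2 Φ AlmostRiem.regOmega,
        ∃ u : ℝ → AlmostRiem.L2 Φ AlmostRiem.regOmega,
          AlmostRiem.IsHeatSolution A u₀ u ∧
          (∀ w : ℝ → AlmostRiem.L2 Φ AlmostRiem.regOmega,
            AlmostRiem.IsHeatSolution A u₀ w → ∀ t : ℝ, 0 ≤ t → w t = u t) ∧
          (AlmostRiem.SupportedInPlus u₀ →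
            ∀ t : ℝ, 0 ≤ t → AlmostRiem.SupportedInPlus (u t))) ∧
      -- the wave equation
      (∀ u₀ u₁ : AlmostRiem.L2 Φ AlmostRiem.regOmega,
        ∃ u : ℝ → AlmostRiem.L2 Φ AlmostRiem.regOmega,
          AlmostRiem.IsWaveSolution A u₀ u₁ u ∧
          (∀ w : ℝ → AlmostRiem.L2 Φ AlmostRiem.regOmega,
            AlmostRiem.IsWaveSolution A u₀ u₁ w → ∀ t : ℝ, 0 ≤ t → w t = u t) ∧
          (AlmostRiem.SupportedInPlus u₀ → AlmostRiem.SupportedInPlus u₁ →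
            ∀ t : ℝ, 0 ≤ t → AlmostRiem.SupportedInPlus (u t))) := by
  have hsΩ : ∀ p ∈ AlmostRiem.regOmega, ∀ p' : AlmostRiem.Cyl,
      0 < p.1 * p'.1 → p' ∈ AlmostRiem.regOmega := fun p _ p' h =>
    right_ne_zero_of_mul h.ne'
  have hsm : ∀ p ∈ AlmostRiem.regMinus, ∀ p' : AlmostRiem.Cyl,
      0 < p.1 * p'.1 → p' ∈ AlmostRiem.regMinus := fun p hp p' h =>
    neg_of_mul_pos_right h (le_of_lt (show p.1 < 0 from hp))
  have hsp : ∀ p ∈ AlmostRiem.regPlus, ∀ p' : AlmostRiem.Cyl,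
      0 < p.1 * p'.1 → p' ∈ AlmostRiem.regPlus := fun p hp p' h =>
    pos_of_mul_pos_right h (le_of_lt (show 0 < p.1 from hp))
  obtain ⟨hd, hA, l, R, hR⟩ :=
    AlmostRiem.exists_laplacian_resolvent hΦ hconst AlmostRiem.isOpen_regOmega.measurableSet
    subset_rfl hsΩ
  obtain ⟨hdm, hAm, -⟩ :=
    AlmostRiem.exists_laplacian_resolvent hΦ hconst AlmostRiem.isOpen_regMinus.measurableSet
    AlmostRiem.regMinus_subset hsm
  obtain ⟨hdp, hAp, -⟩ :=
    AlmostRiem.exists_laplacian_resolvent hΦ hconst AlmostRiem.isOpen_regPlus.measurableSet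
    AlmostRiem.regPlus_subset hsp
  have hsum := AlmostRiem.isDirectSum_adjoint hΦ hd hdm hdp
  -- restriction to `Ω₊` maps solutions to solutions, so uniqueness gives the claims on supports
  have hP := AlmostRiem.reduces_restrictPlus hsum
  refine ⟨_, _, _, hA, hAm, hAp, hsum, fun u₀ => ?_, fun u₀ => ?_, fun u₀ u₁ => ?_⟩
  · obtain ⟨u, hu⟩ := hR.exists_schrodinger u₀
    refine ⟨u, hu, fun w hw t ht => hR.schrodinger_unique hu hw ht, fun hs t ht => ?_⟩
    have h1 := hP.schrodinger hu
    rw [(AlmostRiem.restrictPlus_eq_self_iff u₀).2 hs] at h1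
    exact (AlmostRiem.restrictPlus_eq_self_iff _).1 (hR.schrodinger_unique hu h1 ht)
  · obtain ⟨u, hu⟩ := hR.exists_heat u₀
    refine ⟨u, hu, fun w hw t ht => hR.heat_unique hu hw ht, fun hs t ht => ?_⟩
    have h1 := hP.heat hu
    rw [(AlmostRiem.restrictPlus_eq_self_iff u₀).2 hs] at h1
    exact (AlmostRiem.restrictPlus_eq_self_iff _).1 (hR.heat_unique hu h1 ht)
  · obtain ⟨u, hu⟩ := hR.exists_wave u₀ u₁
    refine ⟨u, hu, fun w hw t ht => hR.wave_unique hu hw ht, fun hs hs' t ht => ?_⟩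
    have h1 := hP.wave hu
    rw [(AlmostRiem.restrictPlus_eq_self_iff u₀).2 hs,
      (AlmostRiem.restrictPlus_eq_self_iff u₁).2 hs'] at h1
    exact (AlmostRiem.restrictPlus_eq_self_iff _).1 (hR.wave_unique hu h1 ht)
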